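/- **Setting.** For $\nu,g>0$, $\Omega\in\mathbb R$, $\mathcal N\ge 0$ consider the Cauchy problem for the three-dimensional viscous primitive equations with Prandtl number $P=1$ (diffusivity $\mu=\nu$) on $\mathbb R^3$: $$\partial_t u-\nu\Delta u+\Omega e_3\times u+(u\cdot\nabla)u+\nabla \pi=g\theta e_3,\quad \partial_t\theta-\nu\Delta\theta+(u\cdot\nabla)\theta=-\mathcal N^2u_3,\quad \operatorname{div}u=0,\quad (u,\theta)|_{t=0}=(u_0,\theta_0).$$ Write $\hat f(\xi)=\int_{\mathbb R^3}e^{-2\pi i x\cdot\xi}f(x)\,dx$. Fix a radial Schwartz function $\psi$ with $\operatorname{supp}\hat\psi\subset\{3/4\le|\xi|\le 8/3\}$ and $\sum_{j\in\mathbb Z}\hat\psi(2^{-j}\xi)=1$ for $\xi\ne0$, and let $\Delta_jf=\psi_j*f$ with $\psi_j=2^{3j}\psi(2^j\cdot)$. On tempered distributions modulo polynomials (equivalently, modulo tempered distributions whose Fourier transform is supported in $\{0\}$) put $$\|f\|_{F\dot B^s_{p,r}}=\big\|\{2^{js}\|\widehat{\Delta_jf}\|_{L^p}\}_{j\in\mathbb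 Z}\big\|_{\ell^r(\mathbb Z)},\qquad \|f\|_{\tilde L^\delta(J;F\dot B^s_{p,r})}=\big\|\{2^{js}\|\widehat{\Delta_jf}\|_{L^\delta(J;L^p)}\}_{j\in\mathbb Z}\big\|_{\ell^r(\mathbb Z)};$$ $F\dot B^s_{p,r}$ is the space where the first norm is finite, and $\tilde L^\delta(J;F\dot B^s_{p,r})$ is the space of strongly measurable functions from the time interval $J$ to $F\dot B^s_{p,r}$ (defined almost everywhere) for which the second norm is finite. Let $\widetilde{\mathbb P}$ be the Leray projection on the first three components and the identity on the fourth, $\widetilde\nabla=(\partial_1,\partial_2,\partial_3,0)$, $\mathcal B'(u,\theta)=(\Omega e_3\times u-g\theta e_3,\ \mathcal N^2u_3)$, and $T(t)=\exp\!\big(t(\nu\Delta-\widetilde{\mathbb P}\mathcal B'\widetilde{\mathbb P})\big)$, defined as a matrix Fourier multiplier. A mild solution on $J$ is a function $v=(u,\theta)$ with $$v(t)=T(t)v_0-\int_0^tT(t-\tau)\,\widetilde{\mathbb P}\,\widetilde\nabla\cdot[v(\tau)\otimes v(\tau)]\,d\tau\quad(t\in J),\qquad v_0=(u_0,\theta_0),$$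 where the Fourier transforms of products are given by (absolutely convergent) convolutions. **Theorem 1.4.** Let $1<p\le\infty$, $1\le r<\infty$, $\alpha\in(0,1)$ (with $3/\infty=0$), and set $$X^\alpha(J)=\big[\tilde L^{\frac2{1+\alpha}}(J;F\dot B^{3-\frac3p+\alpha}_{p,r})\big]^4\cap\big[\tilde L^{\frac2{1-\alpha}}(J;F\dot B^{3-\frac3p-\alpha}_{p,r})\big]^4 .$$ 1. For all $\nu,g>0$, $\Omega\in\mathbb R$, $\mathcal N\ge0$ and all $(u_0,\theta_0)\in[F\dot B^{2-3/p}_{p,r}]^4$ with $\operatorname{div}u_0=0$ there is $T>0$ such that the problem has one and only one mild solution in $[C([0,T];F\dot B^{2-3/p}_{p,r})]^4\cap X^\alpha([0,T])$. 2. There is a constant $C>0$, depending only on $p,r,\alpha,\psi$ (in particular independent of $\nu,\Omega,\mathcal N$), such that for all $\nu,g,\mathcal N>0$, $\Omega\in\mathbb R$ and all $(u_0,\theta_0)\in[F\dot B^{2-3/p}_{p,r}]^4$ with $\operatorname{div}u_0=0$ and $$\|(u_0,\sqrt g\,\theta_0/\mathcal N)\|_{F\dot B^{2-3/p}_{p,r}}\le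 C\nu$$ (the norm of a vector being the sum of the norms of its components), the problem has one and only one global mild solution in $[C([0,\infty);F\dot B^{2-3/p}_{p,r})]^4\cap X^\alpha([0,\infty))$. In both cases the velocity of the solution satisfies $\operatorname{div}u(t)=0$ for all $t$. -/

import Mathlib

open scoped SchwartzMap FourierTransform LineDeriv ENNReal Topology Matrix
open MeasureTheory Filter Set

namespace PrimitiveEq

/-- Three-dimensional Euclidean space. -/
abbrev R3 : Type := EuclideanSpace ℝ (Fin 3)

/-! ### Tempered distributions modulo polynomials

The Fourier transform is Mathlib's one, `𝓕 f ξ = ∫ exp (-2πi x·ξ) f x dx`, so `∂ₖ` has the symbol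
`2πi ξₖ` and `-Δ` has the symbol `4π²|ξ|²`. -/

/-- A Schwartz test function on `ℝ³` that is compactly supported in `ℝ³ \ {0}`. -/
def IsTestOffZero (φ : 𝓢(R3, ℂ)) : Prop :=
  HasCompactSupport φ ∧ (0 : R3) ∉ tsupport φ

/-- A product `g φ` of a test function away from the origin is again one. -/
theorem IsTestOffZero.smulLeft {φ : 𝓢(R3, ℂ)} (hφ : IsTestOffZero φ) (g : R3 → ℂ) :
    IsTestOffZero (SchwartzMap.smulLeftCLM ℂ g φ) := by
  have h := SchwartzMap.tsupport_smulLeftCLM_subset g φ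
  refine ⟨?_, fun h0 => hφ.2 (h h0).1⟩
  exact hφ.1.of_isClosed_subset (isClosed_tsupport _) (fun x hx => (h hx).1)

/-- The polynomials, as a subspace of the tempered distributions on `ℝ³`: the tempered
distributions whose Fourier transform is supported in `{0}`. -/
def polynomials : Submodule ℂ 𝓢'(R3, ℂ) where
  carrier := {U | ∀ φ : 𝓢(R3, ℂ), IsTestOffZero φ → (𝓕 U : 𝓢'(R3, ℂ)) φ = 0}
  add_mem' := by
    intro U V hU hV φ hφ
    have h1 := hU φ hφ
    have h2 := hV φ hφ
    rw [TemperedDistribution.fourier_apply] at h1 h2 ⊢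
    change U (𝓕 φ) + V (𝓕 φ) = 0
    rw [h1, h2, add_zero]
  zero_mem' := by
    intro φ _
    rfl
  smul_mem' := by
    intro c U hU φ hφ
    have h1 := hU φ hφ
    rw [TemperedDistribution.fourier_apply] at h1 ⊢
    change c • U (𝓕 φ) = 0
    rw [h1, smul_zero]

/-- `𝓢'ₕ(ℝ³) = 𝓢'(ℝ³) / 𝒫`: tempered distributions modulo polynomials. -/
noncomputable abbrev Sh : Type := 𝓢'(R3, ℂ) ⧸ polynomials

/-- The class of a tempered distribution modulo polynomials. -/
noncomputable abbrev Sh.mk (U : 𝓢'(R3, ℂ)) : Sh := Submodule.Quotient.mk U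

theorem lineDeriv_mem_polynomials (m : R3) (U : 𝓢'(R3, ℂ)) (hU : U ∈ polynomials) :
    (∂_{m} U : 𝓢'(R3, ℂ)) ∈ polynomials := by
  intro φ hφ
  rw [TemperedDistribution.fourier_lineDerivOp_eq]
  have h := hU _ (hφ.smulLeft (fun x : R3 => ((inner ℝ x m : ℝ) : ℂ)))
  change (2 * Real.pi * Complex.I) •
    (TemperedDistribution.smulLeftCLM ℂ (fun x : R3 => ((inner ℝ x m : ℝ) : ℂ)) (𝓕 U)) φ = 0
  rw [TemperedDistribution.smulLeftCLM_apply_apply, h, smul_zero]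

/-- The partial derivative `∂ₖ` on `𝓢'ₕ(ℝ³)`. -/
noncomputable def partialDeriv (k : Fin 3) : Sh →ₗ[ℂ] Sh :=
  polynomials.mapQ polynomials
    (LineDeriv.lineDerivOpCLM ℂ 𝓢'(R3, ℂ) (EuclideanSpace.single k (1 : ℝ)) :
      𝓢'(R3, ℂ) →L[ℂ] 𝓢'(R3, ℂ)).toLinearMap
    (fun U hU => lineDeriv_mem_polynomials _ U hU)

/-- The divergence `∂₁w₁ + ∂₂w₂ + ∂₃w₃` of the velocity part of `w = (u₁, u₂, u₃, θ)`. -/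
noncomputable def divVelocity (w : Fin 4 → Sh) : Sh :=
  ∑ k : Fin 3, partialDeriv k (w k.castSucc)

/-! ### Littlewood-Paley blocks and Fourier-Besov spaces -/

/-- A radial Schwartz function `ψ` on `ℝ³` that generates a homogeneous dyadic partition of unity
in the frequency variable. -/
structure LittlewoodPaley where
  ψ : 𝓢(R3, ℂ)
  radial : ∀ x y : R3, ‖x‖ = ‖y‖ → ψ x = ψ y
  supp : tsupport (𝓕 ψ : 𝓢(R3, ℂ)) ⊆ {ξ | 3 / 4 ≤ ‖ξ‖ ∧ ‖ξ‖ ≤ 8 / 3}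
  partition : ∀ ξ : R3, ξ ≠ 0 →
    HasSum (fun j : ℤ => (𝓕 ψ : 𝓢(R3, ℂ)) ((2 : ℝ) ^ (-j) • ξ)) 1

/-- The function `ξ ↦ ψ̂(2^{-j} ξ)`, that is, the Fourier transform of `ψⱼ = 2^{3j} ψ(2^j ·)`. -/
noncomputable def LittlewoodPaley.hat (L : LittlewoodPaley) (j : ℤ) (ξ : R3) : ℂ :=
  (𝓕 L.ψ : 𝓢(R3, ℂ)) ((2 : ℝ) ^ (-j) • ξ)

theorem LittlewoodPaley.isTestOffZero (L : LittlewoodPaley) (j : ℤ) (φ : 𝓢(R3, ℂ)) :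
    IsTestOffZero (SchwartzMap.smulLeftCLM ℂ (L.hat j) φ) := by
  have h := SchwartzMap.tsupport_smulLeftCLM_subset (L.hat j) φ
  have h2 : (0 : ℝ) < 2 ^ (-j) := by positivity
  have hsub : tsupport (L.hat j) ⊆
      (fun ξ : R3 => (2 : ℝ) ^ (-j) • ξ) ⁻¹' {ξ | 3 / 4 ≤ ‖ξ‖ ∧ ‖ξ‖ ≤ 8 / 3} := by
    refine (tsupport_comp_subset_preimage (𝓕 L.ψ : 𝓢(R3, ℂ)) (by fun_prop)).trans ?_
    exact Set.preimage_mono L.supp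
  refine ⟨?_, fun h0 => ?_⟩
  · refine HasCompactSupport.of_support_subset_isCompact
      (isCompact_closedBall (0 : R3) (8 / 3 * ((2 : ℝ) ^ (-j))⁻¹)) ?_
    intro x hx
    have hx2 := (hsub (h (subset_tsupport _ hx)).2).2
    rw [norm_smul, Real.norm_of_nonneg h2.le] at hx2
    rw [mem_closedBall_zero_iff, ← div_eq_mul_inv, le_div_iff₀ h2]
    linarith
  · have h3 := (hsub (h h0).2).1
    norm_num at h3

/-- The dyadic block `Δⱼ U = ψⱼ * U`, the Fourier multiplier with symbol `ψ̂(2^{-j} ξ)`. -/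
noncomputable def dyadicBlock (L : LittlewoodPaley) (j : ℤ) : 𝓢'(R3, ℂ) →L[ℂ] 𝓢'(R3, ℂ) :=
  TemperedDistribution.fourierMultiplierCLM ℂ (L.hat j)

theorem fourier_dyadicBlock_eq_zero (L : LittlewoodPaley) (j : ℤ) (U : 𝓢'(R3, ℂ))
    (hU : U ∈ polynomials) : (𝓕 (dyadicBlock L j U) : 𝓢'(R3, ℂ)) = 0 := by
  rw [dyadicBlock, TemperedDistribution.fourierMultiplierCLM_apply,
    FourierTransform.fourier_fourierInv_eq]
  ext φ
  rw [TemperedDistribution.smulLeftCLM_apply_apply]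
  exact hU _ (L.isTestOffZero j φ)

/-- The Fourier transform of `Δⱼ u`, a tempered distribution that depends only on the class `u`
modulo polynomials. -/
noncomputable def blockHat (L : LittlewoodPaley) (j : ℤ) : Sh →ₗ[ℂ] 𝓢'(R3, ℂ) :=
  polynomials.liftQ
    ((FourierTransform.fourierCLM ℂ 𝓢'(R3, ℂ) : 𝓢'(R3, ℂ) →L[ℂ] 𝓢'(R3, ℂ)) ∘L
      dyadicBlock L j).toLinearMap
    (fun U hU => fourier_dyadicBlock_eq_zero L j U hU)

/-- The `L^p` norm of a tempered distribution; it is `∞` if the distribution is not given by a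
function in `L^p(ℝ³)`. -/
noncomputable def distLpNorm (p : ℝ≥0∞) (U : 𝓢'(R3, ℂ)) : ℝ≥0∞ :=
  ⨅ (f : R3 → ℂ) (_ : MemLp f p volume) (_ : ∀ φ : 𝓢(R3, ℂ), U φ = ∫ ξ, φ ξ * f ξ),
    eLpNorm f p volume

/-- The number `‖𝓕(Δⱼ u)‖_{L^p}`. -/
noncomputable def blockNorm (L : LittlewoodPaley) (p : ℝ≥0∞) (j : ℤ) (u : Sh) : ℝ≥0∞ :=
  distLpNorm p (blockHat L j u)

/-- The norm `‖{2^{js} ‖𝓕(Δⱼ u)‖_{L^p}}ⱼ‖_{ℓ^r(ℤ)}` of the Fourier-Besov space `FḂ^s_{p,r}(ℝ³)`;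
the space consists of the `u` in `𝓢'ₕ(ℝ³)` for which it is finite. -/
noncomputable def fbNorm (L : LittlewoodPaley) (s : ℝ) (p r : ℝ≥0∞) (u : Sh) : ℝ≥0∞ :=
  eLpNorm (fun j : ℤ => (2 : ℝ≥0∞) ^ ((j : ℝ) * s) * blockNorm L p j u) r Measure.count

/-- Membership in `FḂ^s_{p,r}(ℝ³)`. -/
def MemFB (L : LittlewoodPaley) (s : ℝ) (p r : ℝ≥0∞) (u : Sh) : Prop :=
  fbNorm L s p r u < ∞

/-! ### Function spaces in space-time -/

/-- `u ∈ C(J, FḂ^s_{p,r}(ℝ³))`. -/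
def ContinuousFB (L : LittlewoodPaley) (s : ℝ) (p r : ℝ≥0∞) (J : Set ℝ) (u : ℝ → Sh) : Prop :=
  (∀ t ∈ J, MemFB L s p r (u t)) ∧
    ∀ t ∈ J, Tendsto (fun τ => fbNorm L s p r (u τ - u t)) (𝓝[J] t) (𝓝 0)

/-- Strong measurability on `J` of an `FḂ^s_{p,r}(ℝ³)`-valued function: it is, at almost every time,
the limit in norm of a sequence of `FḂ^s_{p,r}(ℝ³)`-valued simple functions. -/
def StronglyMeasurableFB (L : LittlewoodPaley) (s : ℝ) (p r : ℝ≥0∞) (J : Set ℝ)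
    (u : ℝ → Sh) : Prop :=
  ∃ F : ℕ → SimpleFunc ℝ Sh, (∀ n t, MemFB L s p r (F n t)) ∧
    ∀ᵐ t ∂(volume.restrict J), Tendsto (fun n => fbNorm L s p r (F n t - u t)) atTop (𝓝 0)

/-- The Chemin-Lerner norm `‖{2^{js} ‖𝓕(Δⱼ u)‖_{L^δ(J; L^p)}}ⱼ‖_{ℓ^r(ℤ)}`. -/
noncomputable def cheminLernerNorm (L : LittlewoodPaley) (δ : ℝ≥0∞) (s : ℝ) (p r : ℝ≥0∞)
    (J : Set ℝ) (u : ℝ → Sh) : ℝ≥0∞ :=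
  eLpNorm (fun j : ℤ => (2 : ℝ≥0∞) ^ ((j : ℝ) * s) *
    eLpNorm (fun t => blockNorm L p j (u t)) δ (volume.restrict J)) r Measure.count

/-- Membership in the Chemin-Lerner space `L̃^δ(J; FḂ^s_{p,r}(ℝ³))`: strongly measurable
functions from `J` to `FḂ^s_{p,r}(ℝ³)` of finite Chemin-Lerner norm. -/
structure MemCheminLerner (L : LittlewoodPaley) (δ : ℝ≥0∞) (s : ℝ) (p r : ℝ≥0∞)
    (J : Set ℝ) (u : ℝ → Sh) : Prop where
  mem : ∀ᵐ t ∂(volume.restrict J), MemFB L s p r (u t)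
  meas : StronglyMeasurableFB L s p r J u
  finite : cheminLernerNorm L δ s p r J u < ∞

/-- The critical regularity index `2 - 3/p` (with `3/∞ = 0`). -/
noncomputable def critIndex (p : ℝ≥0∞) : ℝ := 2 - 3 * (p⁻¹).toReal

/-- The class `[C(J, FḂ^{2-3/p}_{p,r})]⁴ ∩ X^α`, where `X^α` is the intersection of
`[L̃^{2/(1+α)}(J; FḂ^{3-3/p+α}_{p,r})]⁴` and `[L̃^{2/(1-α)}(J; FḂ^{3-3/p-α}_{p,r})]⁴`. -/
structure InSolutionClass (L : LittlewoodPaley) (p r : ℝ≥0∞) (α : ℝ) (J : Set ℝ)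
    (v : ℝ → Fin 4 → Sh) : Prop where
  cont : ∀ a, ContinuousFB L (critIndex p) p r J (fun t => v t a)
  plus : ∀ a, MemCheminLerner L (ENNReal.ofReal (2 / (1 + α))) (critIndex p + 1 + α) p r J
    (fun t => v t a)
  minus : ∀ a, MemCheminLerner L (ENNReal.ofReal (2 / (1 - α))) (critIndex p + 1 - α) p r J
    (fun t => v t a)

/-! ### The primitive equations in Fourier variables -/

/-- The frequency `(ξ₁, ξ₂, ξ₃, 0)`. -/
noncomputable def freq (ξ : R3) : Fin 4 → ℝ := Fin.snoc (α := fun _ => ℝ) (fun k : Fin 3 => ξ k) 0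

/-- The symbol of the partial Helmholtz projection: the Leray projection on the three velocity
components, the identity on the temperature component. -/
noncomputable def helmholtz (ξ : R3) : Matrix (Fin 4) (Fin 4) ℂ :=
  Matrix.of fun a b => (if a = b then 1 else 0) - ((freq ξ a * freq ξ b / ‖ξ‖ ^ 2 : ℝ) : ℂ)

/-- The zero-order linear terms `(Ω e₃ × u - g θ e₃, 𝒩² u₃)` acting on `(u₁, u₂, u₃, θ)`. -/
def couplingMatrix (g Ω N : ℝ) : Matrix (Fin 4) (Fin 4) ℂ :=
  !![0, -(Ω : ℂ), 0, 0;
     (Ω : ℂ), 0, 0, 0;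
     0, 0, 0, -(g : ℂ);
     0, 0, (N : ℂ) ^ 2, 0]

/-- The symbol at time `t` of the Stokes-Coriolis-stratification semigroup, the solution operator
of the linearized equations
`∂ₜu - νΔu + Ω e₃ × u + ∇π = g θ e₃`, `∂ₜθ - μΔθ = -𝒩² u₃`, `div u = 0`
after elimination of the pressure by the Helmholtz projection. -/
noncomputable def semigroup (ν μ g Ω N t : ℝ) (ξ : R3) : Matrix (Fin 4) (Fin 4) ℂ :=
  NormedSpace.exp (-(t : ℂ) •
    (((4 * Real.pi ^ 2 * ‖ξ‖ ^ 2 : ℝ) : ℂ) •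
        Matrix.diagonal ![(ν : ℂ), (ν : ℂ), (ν : ℂ), (μ : ℂ)] +
      helmholtz ξ * couplingMatrix g Ω N * helmholtz ξ))

/-- The function `f` is the Fourier transform of `u` on `ℝ³ \ {0}`, which is where the Fourier
transform of a distribution modulo polynomials is defined. -/
def IsFourierTransform (u : Sh) (f : R3 → ℂ) : Prop :=
  LocallyIntegrableOn f {0}ᶜ volume ∧
    ∃ U : 𝓢'(R3, ℂ), Sh.mk U = u ∧
      ∀ φ : 𝓢(R3, ℂ), IsTestOffZero φ → (𝓕 U : 𝓢'(R3, ℂ)) φ = ∫ ξ, φ ξ * f ξ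

/-- The Fourier transform of `P ∇·(v ⊗ v)` at `ξ`, where `P` is the partial Helmholtz projection,
`∇ = (∂₁, ∂₂, ∂₃, 0)` and `V` is the Fourier transform of `v = (u, θ)`. The Fourier transform of
the product `vₐ v_b` is the convolution of `Vₐ` and `V_b`. -/
noncomputable def nonlinearity (V : R3 → Fin 4 → ℂ) (ξ : R3) : Fin 4 → ℂ :=
  helmholtz ξ *ᵥ fun b => ∑ a, (2 * Real.pi * Complex.I * (freq ξ a : ℂ)) *
    ∫ η, V (ξ - η) a * V η b

/-- The function `v = (u, θ)` is a mild solution on the time interval `J` (which starts at `0`) of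
the Cauchy problem for the primitive equations
`∂ₜu - νΔu + Ω e₃ × u + (u·∇)u + ∇π = g θ e₃`, `∂ₜθ - μΔθ + (u·∇)θ = -𝒩² u₃`, `div u = 0`
with initial value `v₀`, that is, with the semigroup `T` and the partial Helmholtz projection `P`,
`v(t) = T(t) v₀ - ∫₀ᵗ T(t - τ) P ∇·(v(τ) ⊗ v(τ)) dτ` for all `t ∈ J`.
The equation is written for the Fourier transforms, and all integrals converge absolutely. -/
def IsMildSolution (ν μ g Ω N : ℝ) (J : Set ℝ) (v₀ : Fin 4 → Sh) (v : ℝ → Fin 4 → Sh) : Prop :=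
  ∃ (V₀ : R3 → Fin 4 → ℂ) (V : ℝ → R3 → Fin 4 → ℂ),
    (∀ a, IsFourierTransform (v₀ a) (fun ξ => V₀ ξ a)) ∧
    Measurable (Function.uncurry V) ∧
    (∀ t ∈ J, ∀ a, IsFourierTransform (v t a) (fun ξ => V t ξ a)) ∧
    (∀ᵐ τ ∂(volume.restrict J), ∀ᵐ ξ : R3, ∀ a b, Integrable (fun η => V τ (ξ - η) a * V τ η b)) ∧
    ∀ t ∈ J, ∀ᵐ ξ : R3,
      IntervalIntegrable (fun τ => semigroup ν μ g Ω N (t - τ) ξ *ᵥ nonlinearity (V τ) ξ)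
        volume 0 t ∧
      V t ξ = semigroup ν μ g Ω N t ξ *ᵥ V₀ ξ -
        ∫ τ in (0 : ℝ)..t, semigroup ν μ g Ω N (t - τ) ξ *ᵥ nonlinearity (V τ) ξ

/-- On the time interval `J` the Cauchy problem with initial value `v₀` has one and only one mild
solution in the class `[C(J, FḂ^{2-3/p}_{p,r})]⁴ ∩ X^α`; its velocity is divergence free. -/
def HasUniqueMildSolution (L : LittlewoodPaley) (p r : ℝ≥0∞) (α ν μ g Ω N : ℝ) (J : Set ℝ)
    (v₀ : Fin 4 → Sh) : Prop :=
  ∃ v : ℝ → Fin 4 → Sh,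
    InSolutionClass L p r α J v ∧ IsMildSolution ν μ g Ω N J v₀ v ∧
    (∀ t ∈ J, divVelocity (v t) = 0) ∧
    ∀ w : ℝ → Fin 4 → Sh,
      InSolutionClass L p r α J w → IsMildSolution ν μ g Ω N J v₀ w → Set.EqOn w v J

end PrimitiveEq

/-! The theorem is a contraction argument for Duhamel's formula, carried out on functions of
frequency. Off the origin, a class modulo polynomials of finite Fourier-Besov norm is given by a
function (`exists_isFourierTransform_of_memFB`); conversely, finite critical norm makes a function
tempered (`exists_sh_of_spaceNorm_lt_top`). Smooth dyadic blocks may be replaced by sharp annuli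
(`IsFourierTransform.fbNorm_le`, `IsFourierTransform.spaceNorm_le`). As only the modulus of the
transform matters, the estimates become inequalities between `[0, ∞]`-valued functions.

Linear part. Because viscosity and diffusivity agree, the semigroup symbol is a scalar heat factor
times the exponential of the projected coupling (`semigroup_eq_smul`). For stable stratification,
rescaling the temperature by `√g / N` makes that coupling skew-Hermitian, so its exponential is
unitary and the decay constant is absolute (`decayBound_Ici`). On bounded times a crude exponential
bound suffices, which also covers `N = 0` (`decayBound_Icc`). Integration of the heat factor in time
gains `2 / δ` derivatives in `L^δ`, and the two exponents of `X^α` are exactly those reached from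
critical data and from forcing in `L^1` in time of critical order.

Quadratic part. For output frequency `2^j`, the larger of the two interacting frequencies is at
least about `2^j`. Bernstein's inequality on the smaller one and Hölder's inequality in time give
geometric decay both in the distance from output to larger frequency (since `p > 1`) and in the gap
between the two inputs (since `α > 0`). This is `forceNorm_conv_le`. After normalization by the
smoothing constants the bilinear bound is proportional to `1 / ν` (`timeConst_mul_timeConst`),
whence the smallness condition `≤ C ν`.

Half of the heat decay is kept in reserve. It pays for the weight `1 + b t |ξ|²`, which passes
through Duhamel's formula (`growth_mul_decay_le`) and through convolutions (`growth_le_mul`). A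
fixed point in the weighted norm has up to two more derivatives at every positive time, and this
yields pointwise membership and strong measurability in the spaces of order `3 - 3/p ± α`.
Continuity at the critical order follows annulus by annulus and then by dominated convergence in
`ℓ^r`, with `r < ∞`.

Existence needs only that the linear evolution be small in the solution norm: short time provides
this in the first statement, small data in the second. Uniqueness needs no smallness, because the
norm of any two solutions is small on short slabs and one can march forward in time (`mild_unique`).
Divergence-freeness plays no role in the estimates; it persists because `ξ` annihilates the
projection from the left. -/

namespace PrimitiveEq

/-! ### Minkowski's integral inequality with values in `[0, ∞]` -/

section Minkowski

variable {T X : Type*} [MeasurableSpace T] [MeasurableSpace X]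

/-- The `L^p` norm of the sections of a jointly measurable function is measurable. -/
theorem measurable_eLpNorm_section {F : T → X → ℝ≥0∞} (hF : Measurable (Function.uncurry F))
    (p : ℝ≥0∞) (μ : Measure X) [SFinite μ] : Measurable fun t => eLpNorm (F t) p μ := by
  rcases eq_or_ne p 0 with rfl | hp0
  · simp
  rcases eq_or_ne p ∞ with rfl | hp
  · simp only [eLpNorm_exponent_top]
    refine measurable_of_Iic fun c => ?_
    -- The essential supremum is at most `c` exactly when the set where `F t` exceeds `c` is null,
    -- and the measure of that set is measurable in `t` by Tonelli.
    have h1 : Measurable fun t => ∫⁻ x, (Ioi c).indicator 1 (F t x) ∂μ := by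
      refine Measurable.lintegral_prod_right (f := fun t x => (Ioi c).indicator 1 (F t x)) ?_
      exact (measurable_one.indicator measurableSet_Ioi).comp hF
    have h2 : (fun t => eLpNormEssSup (F t) μ) ⁻¹' Iic c =
        {t | ∫⁻ x, (Ioi c).indicator 1 (F t x) ∂μ = 0} := by
      ext t
      have hm : Measurable fun x => (Ioi c).indicator (1 : ℝ≥0∞ → ℝ≥0∞) (F t x) :=
        (measurable_one.indicator measurableSet_Ioi).comp (hF.comp measurable_prodMk_left)
      rw [mem_ofPred_eq, lintegral_eq_zero_iff hm, mem_preimage, mem_Iic]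
      constructor
      · intro h
        filter_upwards [ENNReal.ae_le_essSup (μ := μ) (F t)] with x hx
        have : ¬ c < F t x := not_lt.2 (hx.trans h)
        simp [this]
      · intro h
        refine essSup_le_of_ae_le c ?_
        filter_upwards [h] with x hx
        by_contra hc
        have : c < F t x := not_le.1 hc
        simp [this] at hx
    rw [h2]
    exact h1 (measurableSet_singleton 0)
  · simp only [eLpNorm_eq_lintegral_rpow_enorm_toReal hp0 hp, enorm_eq_self]
    exact (Measurable.lintegral_prod_right (f := fun t x => F t x ^ p.toReal)
      (hF.pow_const _)).pow_const _

variable (ν : Measure T) (μ : Measure X) [SigmaFinite ν] [SFinite μ]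

/-- Let `a t` be the `L^p` norm of the section at `t`. Hölder's inequality with the weight `a` gives
`(∫ F)^p ≤ (∫ F^p a^(1-p)) (∫ a)^(p-1)`; after integration in `x`, Tonelli turns the first factor
into `∫ a`. No duality is used. -/
theorem lintegral_rpow_lintegral_le {F : T → X → ℝ≥0∞} (hF : Measurable (Function.uncurry F))
    {p : ℝ} (hp : 1 < p) :
    ∫⁻ x, (∫⁻ t, F t x ∂ν) ^ p ∂μ ≤ (∫⁻ t, (∫⁻ x, F t x ^ p ∂μ) ^ (1 / p) ∂ν) ^ p := by
  have hp0 : 0 < p := by linarith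
  set a : T → ℝ≥0∞ := fun t => (∫⁻ x, F t x ^ p ∂μ) ^ (1 / p) with ha
  have ham : Measurable a := (Measurable.lintegral_prod_right (f := fun t x => F t x ^ p)
      (hF.pow_const _)).pow_const _
  by_cases hA : ∫⁻ t, a t ∂ν = ∞
  · rw [hA, ENNReal.top_rpow_of_pos hp0]; exact le_top
  have hlim : Tendsto (fun ε : ℝ≥0∞ => (∫⁻ t, a t ∂ν + ε) ^ p) (𝓝[>] 0)
      (𝓝 ((∫⁻ t, a t ∂ν) ^ p)) := by
    have : Continuous fun ε : ℝ≥0∞ => (∫⁻ t, a t ∂ν + ε) ^ p :=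
      ENNReal.continuous_rpow_const.comp (continuous_const.add continuous_id)
    have h := this.tendsto 0
    rw [add_zero] at h
    exact h.mono_left nhdsWithin_le_nhds
  refine ge_of_tendsto hlim ?_
  filter_upwards [self_mem_nhdsWithin] with ε hε
  -- A positive perturbation of small integral keeps the weight away from zero, so that its negative
  -- powers are harmless; it is removed in the limit `ε → 0`.
  obtain ⟨g, hg0, hgm, hgε⟩ := exists_pos_lintegral_lt_of_sigmaFinite ν (ne_of_gt hε)
  set b : T → ℝ≥0∞ := fun t => a t + g t with hb
  have hbm : Measurable b := ham.add hgm.coe_nnreal_ennreal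
  have hb0 : ∀ t, b t ≠ 0 := fun t => by
    have := hg0 t
    simp [hb, this.ne']
  have hbint : ∫⁻ t, b t ∂ν ≤ ∫⁻ t, a t ∂ν + ε := by
    rw [hb, lintegral_add_left ham]; gcongr
  have hbtop : ∀ᵐ t ∂ν, b t ≠ ∞ := by
    filter_upwards [ae_lt_top ham hA] with t ht
    simp [hb, ht.ne]
  set q := p.conjExponent with hq
  have hpq : p.HolderConjugate q := Real.HolderConjugate.conjExponent hp
  have hq0 : 0 < q := hpq.symm.pos
  have key : ∀ x, (∫⁻ t, F t x ∂ν) ^ p ≤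
      (∫⁻ t, F t x ^ p * b t ^ (1 - p) ∂ν) * (∫⁻ t, b t ∂ν) ^ (p - 1) := by
    intro x
    have hFx : Measurable fun t => F t x := hF.comp measurable_prodMk_right
    have h1 : ∫⁻ t, F t x ∂ν = ∫⁻ t, ((fun t => F t x * b t ^ (-(1/q))) * fun t => b t ^ (1/q)) t ∂ν := by
      refine lintegral_congr_ae ?_
      filter_upwards [hbtop] with t ht
      simp only [Pi.mul_apply]
      rw [mul_assoc, ← ENNReal.rpow_add _ _ (hb0 t) ht, neg_add_cancel, ENNReal.rpow_zero, mul_one]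
    have h2 := ENNReal.lintegral_mul_le_Lp_mul_Lq ν hpq
      (f := fun t => F t x * b t ^ (-(1/q))) (g := fun t => b t ^ (1/q))
      (hFx.mul (hbm.pow_const _)).aemeasurable (hbm.pow_const _).aemeasurable
    rw [← h1] at h2
    refine (ENNReal.rpow_le_rpow h2 hp0.le).trans ?_
    rw [ENNReal.mul_rpow_of_nonneg _ _ hp0.le, ← ENNReal.rpow_mul, one_div_mul_cancel hp0.ne',
      ENNReal.rpow_one, ← ENNReal.rpow_mul]
    have e1 : 1 / q * p = p - 1 := by
      have := hpq.sub_one_mul_conj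
      field_simp
      linarith
    rw [e1]
    gcongr with t t
    · rw [ENNReal.mul_rpow_of_nonneg _ _ hp0.le, ← ENNReal.rpow_mul]
      have : -(1/q) * p = 1 - p := by linarith [e1]
      rw [this]
    · rw [← ENNReal.rpow_mul, one_div_mul_cancel hq0.ne', ENNReal.rpow_one]
  have hmeas : Measurable (Function.uncurry fun t x => F t x ^ p * b t ^ (1 - p)) := by
    exact (hF.pow_const p).mul ((hbm.pow_const _).comp measurable_fst)
  calc ∫⁻ x, (∫⁻ t, F t x ∂ν) ^ p ∂μ
      ≤ ∫⁻ x, (∫⁻ t, F t x ^ p * b t ^ (1 - p) ∂ν) * (∫⁻ t, b t ∂ν) ^ (p - 1) ∂μ :=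
        lintegral_mono key
    _ = (∫⁻ x, (∫⁻ t, F t x ^ p * b t ^ (1 - p) ∂ν) ∂μ) * (∫⁻ t, b t ∂ν) ^ (p - 1) := by
        rw [lintegral_mul_const]
        exact Measurable.lintegral_prod_left (f := fun t x => F t x ^ p * b t ^ (1 - p)) hmeas
    _ = (∫⁻ t, (∫⁻ x, F t x ^ p ∂μ) * b t ^ (1 - p) ∂ν) * (∫⁻ t, b t ∂ν) ^ (p - 1) := by
        rw [← lintegral_lintegral_swap hmeas.aemeasurable]
        congr 1
        refine lintegral_congr fun t => ?_
        rw [lintegral_mul_const]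
        exact (hF.comp measurable_prodMk_left).pow_const _
    _ ≤ (∫⁻ t, b t ∂ν) * (∫⁻ t, b t ∂ν) ^ (p - 1) := by
        gcongr ?_ * _
        refine lintegral_mono_ae ?_
        filter_upwards [hbtop] with t ht
        have e : ∫⁻ x, F t x ^ p ∂μ = a t ^ p := by
          rw [ha]; simp only
          rw [← ENNReal.rpow_mul, one_div_mul_cancel hp0.ne', ENNReal.rpow_one]
        rw [e]
        calc a t ^ p * b t ^ (1 - p) ≤ b t ^ p * b t ^ (1 - p) := by
              gcongr; exact le_self_add
          _ = b t := by rw [← ENNReal.rpow_add _ _ (hb0 t) ht]; simp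
    _ = (∫⁻ t, b t ∂ν) ^ p := by
        nth_rw 1 [← ENNReal.rpow_one (∫⁻ t, b t ∂ν)]
        rw [← ENNReal.rpow_add_of_nonneg _ _ zero_le_one (by linarith)]
        simp
    _ ≤ _ := by gcongr

/-- **Minkowski's integral inequality** for nonnegative functions. -/
theorem eLpNorm_lintegral_le {F : T → X → ℝ≥0∞} (hF : Measurable (Function.uncurry F))
    {p : ℝ≥0∞} (hp : 1 ≤ p) :
    eLpNorm (fun x => ∫⁻ t, F t x ∂ν) p μ ≤ ∫⁻ t, eLpNorm (F t) p μ ∂ν := by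
  rcases eq_or_ne p ∞ with rfl | hptop
  · have ham := measurable_eLpNorm_section hF ∞ μ
    simp only [eLpNorm_exponent_top] at ham ⊢
    refine essSup_le_of_ae_le _ ?_
    have h1 : ∀ᵐ z ∂(ν.prod μ), F z.1 z.2 ≤ eLpNormEssSup (F z.1) μ := by
      refine (Measure.ae_prod_iff_ae_ae ?_).2 (ae_of_all _ fun t => ?_)
      · exact measurableSet_le hF (ham.comp measurable_fst)
      · exact ENNReal.ae_le_essSup (F t)
    have h2 : ∀ᵐ x ∂μ, ∀ᵐ t ∂ν, F t x ≤ eLpNormEssSup (F t) μ :=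
      Measure.ae_ae_comm (p := fun t x => F t x ≤ eLpNormEssSup (F t) μ)
        (measurableSet_le hF (ham.comp measurable_fst)) |>.1 (Measure.ae_ae_of_ae_prod h1)
    filter_upwards [h2] with x hx
    simpa using lintegral_mono_ae hx
  have hp0 : p ≠ 0 := (zero_lt_one.trans_le hp).ne'
  rcases hp.eq_or_lt with rfl | hp1
  · simp only [eLpNorm_one_eq_lintegral_enorm, enorm_eq_self]
    rw [lintegral_lintegral_swap hF.aemeasurable]
  have hpr : 1 < p.toReal := by
    rwa [← ENNReal.toReal_one, ENNReal.toReal_lt_toReal ENNReal.one_ne_top hptop]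
  have h := lintegral_rpow_lintegral_le ν μ hF hpr
  simp only [eLpNorm_eq_lintegral_rpow_enorm_toReal hp0 hptop, enorm_eq_self]
  have hpr0 : p.toReal ≠ 0 := by linarith
  refine (ENNReal.rpow_le_rpow h (by positivity)).trans_eq ?_
  rw [← ENNReal.rpow_mul, mul_one_div_cancel hpr0, ENNReal.rpow_one]

/-- Countable subadditivity of the `L^p` norm for nonnegative functions. -/
theorem eLpNorm_tsum_le {ι : Type*} [Countable ι] {f : ι → X → ℝ≥0∞}
    (hf : ∀ i, Measurable (f i)) {p : ℝ≥0∞} (hp : 1 ≤ p) :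
    eLpNorm (fun x => ∑' i, f i x) p μ ≤ ∑' i, eLpNorm (f i) p μ := by
  let _ : MeasurableSpace ι := ⊤
  have h := eLpNorm_lintegral_le (Measure.count : Measure ι) μ (F := f)
    (measurable_from_prod_countable_right hf) hp
  simpa only [lintegral_count] using h

omit [SFinite μ] in
theorem eLpNorm_const_mul_ennreal (c : ℝ≥0∞) {f : X → ℝ≥0∞} (hf : AEMeasurable f μ)
    {p : ℝ≥0∞} (hp : p ≠ 0) : eLpNorm (fun x => c * f x) p μ = c * eLpNorm f p μ := by
  rcases eq_or_ne p ∞ with rfl | hp'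
  · simp only [eLpNorm_exponent_top, eLpNormEssSup, enorm_eq_self]
    exact ENNReal.essSup_const_mul
  · have h0 : 0 < p.toReal := ENNReal.toReal_pos hp hp'
    simp only [eLpNorm_eq_lintegral_rpow_enorm_toReal hp hp', enorm_eq_self]
    simp_rw [ENNReal.mul_rpow_of_nonneg _ _ h0.le]
    rw [lintegral_const_mul'' _ (hf.pow_const _),
      ENNReal.mul_rpow_of_nonneg _ _ (by positivity), ← ENNReal.rpow_mul,
      mul_one_div_cancel h0.ne', ENNReal.rpow_one]

end Minkowski

/-- **Young's inequality** `‖f * g‖_p ≤ ‖f‖_p ‖g‖_1` for nonnegative functions. -/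
theorem eLpNorm_convolution_le {G : Type*} [AddGroup G] [MeasurableSpace G] [MeasurableAdd₂ G]
    [MeasurableSub₂ G] (μ ν : Measure G) [SigmaFinite ν] [SFinite μ] [μ.IsAddRightInvariant]
    {f g : G → ℝ≥0∞} (hf : Measurable f) (hg : Measurable g) {p : ℝ≥0∞} (hp : 1 ≤ p) :
    eLpNorm (fun x => ∫⁻ y, f (x - y) * g y ∂ν) p μ ≤ eLpNorm f p μ * ∫⁻ y, g y ∂ν := by
  have hm : Measurable (Function.uncurry fun y x => f (x - y) * g y) :=
    (hf.comp (measurable_snd.sub measurable_fst)).mul (hg.comp measurable_fst)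
  refine (eLpNorm_lintegral_le ν μ hm hp).trans ?_
  rw [← lintegral_const_mul _ hg]
  refine lintegral_mono fun y => ?_
  have h1 : (fun x => f (x - y) * g y) = fun x => g y * f (x - y) := by
    ext x; rw [mul_comm]
  simp only
  rw [h1, eLpNorm_const_mul_ennreal μ _ (f := fun x => f (x - y))
    (hf.comp (measurable_id.sub_const y)).aemeasurable
    (zero_lt_one.trans_le hp).ne', mul_comm]
  gcongr
  exact (eLpNorm_comp_measurePreserving hf.aestronglyMeasurable
    (measurePreserving_sub_right μ y)).le

/-! ### Shifts and Young's inequality for sequences indexed by the integers -/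

section Sequences

variable {r : ℝ≥0∞}

theorem eLpNorm_count_shift (a : ℤ → ℝ≥0∞) (m : ℤ) :
    eLpNorm (fun j => a (j + m)) r Measure.count = eLpNorm a r Measure.count := by
  refine eLpNorm_comp_measurePreserving (f := fun j : ℤ => j + m)
    (measurable_of_countable a).aestronglyMeasurable ?_
  exact measurePreserving_add_right _ m

theorem le_eLpNorm_count (a : ℤ → ℝ≥0∞) (hr : r ≠ 0) (j : ℤ) :
    a j ≤ eLpNorm a r Measure.count := by
  have h := eLpNorm_mono_measure (p := r) a (Measure.restrict_le_self (μ := Measure.count) (s := {j}))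
  refine le_trans ?_ h
  rw [Measure.restrict_singleton, Measure.count_singleton, one_smul]
  rcases eq_or_ne r ∞ with rfl | hr'
  · simp
  · rw [eLpNorm_eq_lintegral_rpow_enorm_toReal hr hr', lintegral_dirac, ← ENNReal.rpow_mul,
      mul_one_div_cancel (ENNReal.toReal_pos hr hr').ne', ENNReal.rpow_one, enorm_eq_self]

/-- Young's inequality for sequences. -/
theorem eLpNorm_count_tsum_shift_le {ι : Type*} [Countable ι] (hr : 1 ≤ r) (w : ι → ℝ≥0∞)
    (σ : ι → ℤ) (a : ℤ → ℝ≥0∞) :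
    eLpNorm (fun j => ∑' i, w i * a (j + σ i)) r Measure.count ≤
      (∑' i, w i) * eLpNorm a r Measure.count := by
  refine (eLpNorm_tsum_le _ (fun i => measurable_of_countable _) hr).trans ?_
  rw [← ENNReal.tsum_mul_right]
  refine ENNReal.tsum_le_tsum fun i => ?_
  rw [eLpNorm_const_mul_ennreal _ _ (measurable_of_countable _).aemeasurable
    (zero_lt_one.trans_le hr).ne',
    eLpNorm_count_shift]

end Sequences

end PrimitiveEq

namespace PrimitiveEq
/-! ### Sharp dyadic annuli -/

theorem two_rpow_ne_zero (x : ℝ) : (2 : ℝ≥0∞) ^ x ≠ 0 := by simp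

theorem two_rpow_ne_top (x : ℝ) : (2 : ℝ≥0∞) ^ x ≠ ∞ := by simp

theorem two_rpow_add (x y : ℝ) : (2 : ℝ≥0∞) ^ (x + y) = 2 ^ x * 2 ^ y :=
  ENNReal.rpow_add _ _ two_ne_zero ENNReal.ofNat_ne_top

theorem ofReal_two_zpow (j : ℤ) : ENNReal.ofReal ((2 : ℝ) ^ j) = 2 ^ (j : ℝ) := by
  rw [← Real.rpow_intCast, ← ENNReal.ofReal_rpow_of_pos two_pos, ENNReal.ofReal_ofNat]

/-- The dyadic annulus `2^j ≤ |ξ| < 2^{j+1}`. -/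
def annulus (j : ℤ) : Set R3 := {ξ | (2 : ℝ) ^ j ≤ ‖ξ‖ ∧ ‖ξ‖ < 2 ^ (j + 1)}

theorem measurableSet_annulus (j : ℤ) : MeasurableSet (annulus j) :=
  (measurableSet_le measurable_const measurable_norm).inter
    (measurableSet_lt measurable_norm measurable_const)

theorem exists_mem_annulus {ξ : R3} (hξ : ξ ≠ 0) : ∃ j, ξ ∈ annulus j := by
  obtain ⟨n, hn⟩ := exists_mem_Ico_zpow (norm_pos_iff.2 hξ) (one_lt_two : (1 : ℝ) < 2)
  exact ⟨n, hn.1, hn.2⟩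

theorem eq_of_mem_annulus {j k : ℤ} {ξ : R3} (hj : ξ ∈ annulus j) (hk : ξ ∈ annulus k) :
    j = k := by
  have h1 := (zpow_lt_zpow_iff_right₀ (one_lt_two : (1 : ℝ) < 2)).1 (hj.1.trans_lt hk.2)
  have h2 := (zpow_lt_zpow_iff_right₀ (one_lt_two : (1 : ℝ) < 2)).1 (hk.1.trans_lt hj.2)
  omega

theorem ae_ne_zero : ∀ᵐ ξ : R3, ξ ≠ 0 := by
  simp [ae_iff]

theorem ae_of_forall_annulus {P : R3 → Prop}
    (h : ∀ j, ∀ᵐ ξ ∂(volume.restrict (annulus j)), P ξ) : ∀ᵐ ξ : R3, P ξ := by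
  have h' : ∀ᵐ ξ : R3, ∀ j, ξ ∈ annulus j → P ξ :=
    ae_all_iff.2 fun j => (ae_restrict_iff' (measurableSet_annulus j)).1 (h j)
  filter_upwards [h', ae_ne_zero] with ξ hξ h0
  obtain ⟨j, hj⟩ := exists_mem_annulus h0
  exact hξ j hj

/-- The `L^p` norm over a dyadic annulus. -/
noncomputable def annNorm (p : ℝ≥0∞) (j : ℤ) (f : R3 → ℝ≥0∞) : ℝ≥0∞ :=
  eLpNorm f p (volume.restrict (annulus j))

theorem annNorm_mono {p : ℝ≥0∞} {j : ℤ} {f g : R3 → ℝ≥0∞}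
    (h : ∀ᵐ ξ ∂(volume.restrict (annulus j)), f ξ ≤ g ξ) : annNorm p j f ≤ annNorm p j g :=
  eLpNorm_mono_enorm_ae (by simpa using h)

theorem annNorm_indicator (p : ℝ≥0∞) (j : ℤ) (f : R3 → ℝ≥0∞) :
    eLpNorm ((annulus j).indicator f) p volume = annNorm p j f :=
  eLpNorm_indicator_eq_eLpNorm_restrict (measurableSet_annulus j)

theorem annNorm_const_mul {p : ℝ≥0∞} (hp : p ≠ 0) (j : ℤ) (c : ℝ≥0∞) {f : R3 → ℝ≥0∞}
    (hf : AEMeasurable f) : annNorm p j (fun ξ => c * f ξ) = c * annNorm p j f :=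
  eLpNorm_const_mul_ennreal _ _ hf.restrict hp

/-- The constant in Bernstein's inequality on annuli. -/
noncomputable def bernsteinConst (p : ℝ≥0∞) : ℝ≥0∞ :=
  (8 * volume (Metric.ball (0 : R3) 1)) ^ (1 - (p⁻¹).toReal)

theorem inv_toReal_le_one {p : ℝ≥0∞} (hp : 1 ≤ p) : (p⁻¹).toReal ≤ 1 := by
  rw [← ENNReal.toReal_one]
  exact ENNReal.toReal_mono ENNReal.one_ne_top (ENNReal.inv_le_one.2 hp)

theorem bernsteinConst_ne_top {p : ℝ≥0∞} (hp : 1 ≤ p) : bernsteinConst p ≠ ∞ :=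
  ENNReal.rpow_ne_top_of_nonneg (by linarith [inv_toReal_le_one hp])
    (ENNReal.mul_ne_top ENNReal.ofNat_ne_top measure_ball_lt_top.ne)

theorem volume_annulus_le (j : ℤ) :
    volume (annulus j) ≤ 2 ^ ((j : ℝ) * 3) * (8 * volume (Metric.ball (0 : R3) 1)) := by
  have h1 : annulus j ⊆ Metric.ball 0 (2 ^ (j + 1)) := fun ξ hξ => by simpa using hξ.2
  refine (measure_mono h1).trans_eq ?_
  rw [Measure.addHaar_ball _ _ (by positivity), finrank_euclideanSpace_fin, ← mul_assoc]
  congr 1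
  rw [ENNReal.ofReal_pow (by positivity), ofReal_two_zpow]
  push_cast
  rw [two_rpow_add, mul_pow, ENNReal.rpow_mul, ENNReal.rpow_one]
  norm_cast

/-- **Bernstein's inequality** on a dyadic annulus. -/
theorem lintegral_annulus_le {p : ℝ≥0∞} (hp : 1 ≤ p) (j : ℤ) {f : R3 → ℝ≥0∞}
    (hf : AEMeasurable f) :
    ∫⁻ ξ in annulus j, f ξ ≤ bernsteinConst p * 2 ^ ((j : ℝ) * (critIndex p + 1)) *
      annNorm p j f := by
  have h := eLpNorm_le_eLpNorm_mul_rpow_measure_univ (μ := volume.restrict (annulus j)) (f := f) hp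
    hf.aestronglyMeasurable.restrict
  rw [eLpNorm_one_eq_lintegral_enorm] at h
  simp only [enorm_eq_self, Measure.restrict_apply MeasurableSet.univ, univ_inter,
    ENNReal.toReal_one, div_one, one_div, ← ENNReal.toReal_inv] at h
  refine h.trans ?_
  rw [mul_comm, annNorm]
  gcongr
  -- Hölder's inequality costs the volume to the power `1 - 1/p`. The volume is of order `2^(3j)`,
  -- and `3 (1 - 1/p)` is `critIndex p + 1`.
  have hnn : 0 ≤ 1 - (p⁻¹).toReal := by linarith [inv_toReal_le_one hp]
  refine (ENNReal.rpow_le_rpow (volume_annulus_le j) hnn).trans_eq ?_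
  rw [ENNReal.mul_rpow_of_nonneg _ _ hnn, mul_comm, bernsteinConst, ← ENNReal.rpow_mul, critIndex]
  congr 2
  ring

/-- The strict inequality `1 < p` matters only here: the positivity makes the interactions of two
high frequencies summable in `productConst_lt_top`. -/
theorem critIndex_add_one_pos {p : ℝ≥0∞} (hp : 1 < p) : 0 < critIndex p + 1 := by
  have : (p⁻¹).toReal < 1 := by
    rw [← ENNReal.toReal_one]
    exact (ENNReal.toReal_lt_toReal (by simpa using (zero_lt_one.trans hp).ne')
      ENNReal.one_ne_top).2 (ENNReal.inv_lt_one.2 hp)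
  rw [critIndex]; linarith

/-! ### Norms over space and over space-time -/

/-- The weighted `ℓ^r(L^p)` norm over the dyadic annuli. -/
noncomputable def spaceNorm (p r : ℝ≥0∞) (s : ℝ) (f : R3 → ℝ≥0∞) : ℝ≥0∞ :=
  eLpNorm (fun j : ℤ => 2 ^ ((j : ℝ) * s) * annNorm p j f) r Measure.count

/-- The weighted `ℓ^r(L^δ(J; L^p))` norm over the dyadic annuli. -/
noncomputable def spaceTimeNorm (p r δ : ℝ≥0∞) (s : ℝ) (J : Set ℝ) (F : ℝ → R3 → ℝ≥0∞) : ℝ≥0∞ :=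
  eLpNorm (fun j : ℤ => 2 ^ ((j : ℝ) * s) *
    eLpNorm (fun t => annNorm p j (F t)) δ (volume.restrict J)) r Measure.count

theorem measurable_annNorm {F : ℝ → R3 → ℝ≥0∞} (hF : Measurable (Function.uncurry F))
    (p : ℝ≥0∞) (j : ℤ) : Measurable fun t => annNorm p j (F t) :=
  measurable_eLpNorm_section hF p _

variable {p r δ : ℝ≥0∞} {s : ℝ} {J : Set ℝ}

theorem spaceTimeNorm_mono {F G : ℝ → R3 → ℝ≥0∞}
    (h : ∀ᵐ t ∂(volume.restrict J), ∀ᵐ ξ, F t ξ ≤ G t ξ) :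
    spaceTimeNorm p r δ s J F ≤ spaceTimeNorm p r δ s J G := by
  refine eLpNorm_mono_enorm fun j => ?_
  simp only [enorm_eq_self]
  gcongr
  refine eLpNorm_mono_enorm_ae ?_
  filter_upwards [h] with t ht
  exact annNorm_mono (ae_restrict_of_ae ht)

theorem spaceTimeNorm_mono_set {I : Set ℝ} (h : I ⊆ J) (F : ℝ → R3 → ℝ≥0∞) :
    spaceTimeNorm p r δ s I F ≤ spaceTimeNorm p r δ s J F := by
  refine eLpNorm_mono_enorm fun j => ?_
  simp only [enorm_eq_self]
  exact mul_le_mul_right (eLpNorm_mono_measure _ (Measure.restrict_mono_set _ h)) _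

theorem eLpNorm_const_mul_count (hr : r ≠ 0) (c : ℝ≥0∞) (a : ℤ → ℝ≥0∞) :
    eLpNorm (fun j => c * a j) r Measure.count = c * eLpNorm a r Measure.count :=
  eLpNorm_const_mul_ennreal _ _ (measurable_of_countable _).aemeasurable hr

theorem spaceTimeNorm_const_mul (hp : p ≠ 0) (hδ : δ ≠ 0) (hr : r ≠ 0) (c : ℝ≥0∞)
    {F : ℝ → R3 → ℝ≥0∞} (hF : Measurable (Function.uncurry F)) :
    spaceTimeNorm p r δ s J (fun t ξ => c * F t ξ) = c * spaceTimeNorm p r δ s J F := by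
  rw [spaceTimeNorm, spaceTimeNorm, ← eLpNorm_const_mul_count hr]
  congr 1
  ext j
  have h : (fun t => annNorm p j fun ξ => c * F t ξ) = fun t => c * annNorm p j (F t) := by
    ext t
    exact annNorm_const_mul hp j c (f := F t) (hF.comp measurable_prodMk_left).aemeasurable
  rw [h]
  rw [eLpNorm_const_mul_ennreal _ _ (measurable_annNorm hF p j).aemeasurable hδ]
  ring

theorem spaceTimeNorm_tsum_le {ι : Type*} [Countable ι] (hp : 1 ≤ p) (hδ : 1 ≤ δ) (hr : 1 ≤ r)
    {F : ι → ℝ → R3 → ℝ≥0∞} (hF : ∀ i, Measurable (Function.uncurry (F i))) :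
    spaceTimeNorm p r δ s J (fun t ξ => ∑' i, F i t ξ) ≤ ∑' i, spaceTimeNorm p r δ s J (F i) := by
  refine le_trans ?_ (eLpNorm_tsum_le Measure.count (fun i => measurable_of_countable _) hr)
  refine eLpNorm_mono_enorm fun j => ?_
  simp only [enorm_eq_self]
  rw [ENNReal.tsum_mul_left]
  refine mul_le_mul_right (le_trans ?_
    (eLpNorm_tsum_le _ (fun i => measurable_annNorm (hF i) p j) hδ)) _
  refine eLpNorm_mono_enorm fun t => ?_
  simp only [enorm_eq_self]
  exact eLpNorm_tsum_le _ (fun i => (hF i).comp measurable_prodMk_left) hp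

theorem spaceTimeNorm_add_le (hp : 1 ≤ p) (hδ : 1 ≤ δ) (hr : 1 ≤ r)
    {F G : ℝ → R3 → ℝ≥0∞} (hF : Measurable (Function.uncurry F))
    (hG : Measurable (Function.uncurry G)) :
    spaceTimeNorm p r δ s J (fun t ξ => F t ξ + G t ξ) ≤
      spaceTimeNorm p r δ s J F + spaceTimeNorm p r δ s J G := by
  refine le_trans ?_ (eLpNorm_add_le (measurable_of_countable _).aestronglyMeasurable
    (measurable_of_countable _).aestronglyMeasurable hr)
  refine eLpNorm_mono_enorm fun j => ?_
  simp only [enorm_eq_self, Pi.add_apply]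
  rw [← mul_add]
  gcongr
  refine le_trans ?_ (eLpNorm_add_le (measurable_annNorm hF p j).aestronglyMeasurable
    (measurable_annNorm hG p j).aestronglyMeasurable hδ)
  refine eLpNorm_mono_enorm fun t => ?_
  simp only [enorm_eq_self, Pi.add_apply]
  exact eLpNorm_add_le (hF.comp measurable_prodMk_left).aestronglyMeasurable
    (hG.comp measurable_prodMk_left).aestronglyMeasurable hp

/-! ### The product estimate -/

/-- A substitute for the paraproduct decomposition. Since `2^j ≤ |x| + |y| < 2^(m+2)` for the larger
dyadic index `m`, one has `m ≥ j - 1`; hence `m = j + (q.1 - 1)` for a natural number `q.1`, and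
`q.2` is the gap down to the smaller index. -/
theorem mul_le_tsum_annuli (F G : R3 → ℝ≥0∞) (j : ℤ) {x y : R3} (hxy : x + y ∈ annulus j)
    (hx : x ≠ 0) (hy : y ≠ 0) :
    F x * G y ≤ ∑' q : ℕ × ℕ,
      ((annulus (j + (q.1 - 1))).indicator F x * (annulus (j + (q.1 - 1) - q.2)).indicator G y +
       (annulus (j + (q.1 - 1) - q.2)).indicator F x * (annulus (j + (q.1 - 1))).indicator G y) := by
  obtain ⟨k, hk⟩ := exists_mem_annulus hx
  obtain ⟨l, hl⟩ := exists_mem_annulus hy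
  have hjm : j < max k l + 2 := by
    refine (zpow_lt_zpow_iff_right₀ (one_lt_two : (1 : ℝ) < 2)).1 ?_
    have h1 : (2 : ℝ) ^ (k + 1) ≤ 2 ^ (max k l + 1) :=
      zpow_le_zpow_right₀ one_le_two (by omega)
    have h2 : (2 : ℝ) ^ (l + 1) ≤ 2 ^ (max k l + 1) :=
      zpow_le_zpow_right₀ one_le_two (by omega)
    have h3 : (2 : ℝ) ^ (max k l + 2) = 2 ^ (max k l + 1) + 2 ^ (max k l + 1) := by
      rw [← mul_two, ← zpow_add_one₀ two_ne_zero]; ring_nf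
    have := hxy.1.trans (norm_add_le x y)
    linarith [hk.2, hl.2]
  rcases le_total l k with hlk | hlk
  · have hq := ENNReal.le_tsum (f := fun q : ℕ × ℕ =>
      ((annulus (j + (q.1 - 1))).indicator F x * (annulus (j + (q.1 - 1) - q.2)).indicator G y +
       (annulus (j + (q.1 - 1) - q.2)).indicator F x * (annulus (j + (q.1 - 1))).indicator G y))
       ((k - j + 1).toNat, (k - l).toNat)
    refine le_trans ?_ hq
    have e1 : j + ((((k - j + 1).toNat : ℕ) : ℤ) - 1) = k := by omega
    have e2 : k - ((k - l).toNat : ℤ) = l := by omega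
    simp only [e1, e2]
    rw [indicator_of_mem hk, indicator_of_mem hl]
    exact le_self_add
  · have hq := ENNReal.le_tsum (f := fun q : ℕ × ℕ =>
      ((annulus (j + (q.1 - 1))).indicator F x * (annulus (j + (q.1 - 1) - q.2)).indicator G y +
       (annulus (j + (q.1 - 1) - q.2)).indicator F x * (annulus (j + (q.1 - 1))).indicator G y))
       ((l - j + 1).toNat, (l - k).toNat)
    refine le_trans ?_ hq
    have e1 : j + ((((l - j + 1).toNat : ℕ) : ℤ) - 1) = l := by omega
    have e2 : l - ((l - k).toNat : ℤ) = k := by omega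
    simp only [e1, e2]
    rw [indicator_of_mem hk, indicator_of_mem hl]
    exact le_add_self

/-- The convolution of nonnegative functions on `ℝ³`. -/
noncomputable def conv (F G : R3 → ℝ≥0∞) (ξ : R3) : ℝ≥0∞ := ∫⁻ η, F (ξ - η) * G η

theorem conv_comm (F G : R3 → ℝ≥0∞) : conv F G = conv G F := by
  ext ξ
  rw [conv, conv, ← lintegral_sub_left_eq_self _ ξ]
  simp [mul_comm]

theorem measurable_conv {T : Type*} [MeasurableSpace T] {F G : T → R3 → ℝ≥0∞}
    (hF : Measurable (Function.uncurry F)) (hG : Measurable (Function.uncurry G)) :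
    Measurable (Function.uncurry fun t => conv (F t) (G t)) := by
  refine Measurable.lintegral_prod_right (f := fun (z : T × R3) η => F z.1 (z.2 - η) * G z.1 η) ?_
  refine (hF.comp (f := fun z : (T × R3) × R3 => (z.1.1, z.1.2 - z.2)) ?_).mul
    (hG.comp (f := fun z : (T × R3) × R3 => (z.1.1, z.2)) ?_)
  · fun_prop
  · fun_prop

theorem measurable_conv_fixed {F G : R3 → ℝ≥0∞} (hF : Measurable F) (hG : Measurable G) :
    Measurable (conv F G) :=
  Measurable.lintegral_prod_right (f := fun ξ η => F (ξ - η) * G η)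
    ((hF.comp (measurable_fst.sub measurable_snd)).mul (hG.comp measurable_snd))

/-- Young's inequality with the second factor in `L^1`, where Bernstein's inequality loses a power
of `2^l`. In the application `l` is the smaller index, which makes the loss cheap. -/
theorem eLpNorm_conv_indicator_le (hp : 1 ≤ p) {F G : R3 → ℝ≥0∞} (hF : Measurable F)
    (hG : Measurable G) (k l : ℤ) :
    eLpNorm (conv ((annulus k).indicator F) ((annulus l).indicator G)) p volume ≤
      bernsteinConst p * 2 ^ ((l : ℝ) * (critIndex p + 1)) * (annNorm p k F * annNorm p l G) := by
  refine (eLpNorm_convolution_le volume volume (hF.indicator (measurableSet_annulus k))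
    (hG.indicator (measurableSet_annulus l)) hp).trans ?_
  rw [annNorm_indicator, lintegral_indicator (measurableSet_annulus l)]
  refine (mul_le_mul_right (lintegral_annulus_le hp l hG.aemeasurable) _).trans_eq ?_
  ring

theorem annNorm_conv_le (hp : 1 ≤ p) {F G : R3 → ℝ≥0∞} (hF : Measurable F) (hG : Measurable G)
    (j : ℤ) : annNorm p j (conv F G) ≤ ∑' q : ℕ × ℕ, bernsteinConst p *
      2 ^ (((j + (q.1 - 1) - q.2 : ℤ) : ℝ) * (critIndex p + 1)) *
      (annNorm p (j + (q.1 - 1)) F * annNorm p (j + (q.1 - 1) - q.2) G +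
       annNorm p (j + (q.1 - 1)) G * annNorm p (j + (q.1 - 1) - q.2) F) := by
  have hFk : ∀ k, Measurable ((annulus k).indicator F) :=
    fun k => hF.indicator (measurableSet_annulus k)
  have hGk : ∀ k, Measurable ((annulus k).indicator G) :=
    fun k => hG.indicator (measurableSet_annulus k)
  have hcm : ∀ k l, Measurable (conv ((annulus k).indicator F) ((annulus l).indicator G)) := by
    exact fun k l => measurable_conv_fixed (hFk k) (hGk l)
  have hpt : ∀ ξ ∈ annulus j, conv F G ξ ≤ ∑' q : ℕ × ℕ,
      (conv ((annulus (j + (q.1 - 1))).indicator F) ((annulus (j + (q.1 - 1) - q.2)).indicator G) ξ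
      + conv ((annulus (j + (q.1 - 1) - q.2)).indicator F) ((annulus (j + (q.1 - 1))).indicator G) ξ)
      := by
    intro ξ hξ
    have hm : ∀ k l, Measurable fun η => (annulus k).indicator F (ξ - η) *
        (annulus l).indicator G η := fun k l =>
      ((hFk k).comp (measurable_const.sub measurable_id)).mul (hGk l)
    simp only [conv]
    simp_rw [← fun k l k' l' => lintegral_add_left (μ := volume) (hm k l)
      (fun η => (annulus k').indicator F (ξ - η) * (annulus l').indicator G η)]
    refine le_of_le_of_eq ?_ (lintegral_tsum fun q : ℕ × ℕ =>
      ((hm (j + (q.1 - 1)) (j + (q.1 - 1) - q.2)).add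
        (hm (j + (q.1 - 1) - q.2) (j + (q.1 - 1)))).aemeasurable)
    refine lintegral_mono_ae ?_
    have h0 : ∀ᵐ η : R3, ξ - η ≠ 0 := by
      have : ∀ᵐ η : R3, η ≠ ξ := by simp [ae_iff]
      filter_upwards [this] with η hη h
      exact hη (sub_eq_zero.1 h).symm
    filter_upwards [h0, ae_ne_zero] with η h1 h2
    exact mul_le_tsum_annuli F G j (by simpa using hξ) h1 h2
  refine (annNorm_mono (p := p) ((ae_restrict_iff' (measurableSet_annulus j)).2
    (ae_of_all _ hpt))).trans ?_
  refine (eLpNorm_tsum_le _ (fun q => (hcm _ _).add (hcm _ _)) hp).trans ?_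
  refine ENNReal.tsum_le_tsum fun q => ?_
  refine (eLpNorm_add_le (hcm _ _).aestronglyMeasurable (hcm _ _).aestronglyMeasurable hp).trans ?_
  rw [mul_add]
  refine add_le_add ?_ ?_
  · exact (eLpNorm_mono_measure _ Measure.restrict_le_self).trans
      (eLpNorm_conv_indicator_le hp hF hG _ _)
  -- In this term `F` carries the low frequency; after the swap Bernstein's inequality again falls
  -- on the lower index.
  · rw [conv_comm]
    exact (eLpNorm_mono_measure _ Measure.restrict_le_self).trans
      (eLpNorm_conv_indicator_le hp hG hF _ _)

end PrimitiveEq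

/-! ### The product estimate in space-time -/

namespace PrimitiveEq

variable {p r : ℝ≥0∞}

theorem tsum_two_rpow_neg_lt_top {a : ℝ} (ha : 0 < a) :
    ∑' n : ℕ, (2 : ℝ≥0∞) ^ (-((n : ℝ) * a)) < ∞ := by
  have h : ∀ n : ℕ, (2 : ℝ≥0∞) ^ (-((n : ℝ) * a)) = (2 ^ (-a)) ^ n := fun n => by
    rw [← ENNReal.rpow_natCast, ← ENNReal.rpow_mul]; congr 1; ring
  simp_rw [h]
  rw [ENNReal.tsum_geometric, ENNReal.inv_lt_top]
  exact tsub_pos_of_lt (ENNReal.rpow_lt_one_of_one_lt_of_neg (by norm_num) (by linarith))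

/-- The norms of order `3 - 3/p ± α`. -/
noncomputable def plusNorm (p r : ℝ≥0∞) (α : ℝ) (J : Set ℝ) (F : ℝ → R3 → ℝ≥0∞) : ℝ≥0∞ :=
  spaceTimeNorm p r (ENNReal.ofReal (2 / (1 + α))) (critIndex p + 1 + α) J F

/-- The `L^1`-in-time norm of the forcing terms. -/
noncomputable def forceNorm (p r : ℝ≥0∞) (J : Set ℝ) (F : ℝ → R3 → ℝ≥0∞) : ℝ≥0∞ :=
  spaceTimeNorm p r 1 (critIndex p) J F

/-- The exponents are conjugate because `(1 + α)/2 + (1 - α)/2 = 1`. This is why a product of two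
elements of `X^α` is integrable in time. -/
theorem holder_time {α : ℝ} (hα : α ∈ Ioo (-1 : ℝ) 1) {μ : Measure ℝ} {f g : ℝ → ℝ≥0∞}
    (hf : AEMeasurable f μ) (hg : AEMeasurable g μ) :
    ∫⁻ t, f t * g t ∂μ ≤ eLpNorm f (ENNReal.ofReal (2 / (1 + α))) μ *
      eLpNorm g (ENNReal.ofReal (2 / (1 - α))) μ := by
  have h1 : 0 < 1 + α := by linarith [hα.1]
  have h2 : 0 < 1 - α := by linarith [hα.2]
  have h3 : (0 : ℝ) < 2 / (1 + α) := by positivity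
  have h4 : (0 : ℝ) < 2 / (1 - α) := by positivity
  rw [eLpNorm_eq_lintegral_rpow_enorm_toReal (by simpa using h3) ENNReal.ofReal_ne_top,
    eLpNorm_eq_lintegral_rpow_enorm_toReal (by simpa using h4) ENNReal.ofReal_ne_top,
    ENNReal.toReal_ofReal h3.le, ENNReal.toReal_ofReal h4.le]
  have hc : (2 / (1 + α)).HolderConjugate (2 / (1 - α)) := by
    rw [Real.holderConjugate_iff]
    refine ⟨?_, by field_simp; ring⟩
    rw [lt_div_iff₀ h1]; linarith [hα.2]
  simpa using ENNReal.lintegral_mul_le_Lp_mul_Lq μ hc hf hg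

/-- The constant of the product estimate. -/
noncomputable def productConst (p : ℝ≥0∞) (α : ℝ) : ℝ≥0∞ :=
  ∑' q : ℕ × ℕ, bernsteinConst p *
    (2 ^ (-(((q.1 : ℝ) - 1) * (critIndex p + 1))) * 2 ^ (-((q.2 : ℝ) * α)))

/-- The double series is a product of two geometric ones: the first has ratio `2^(-(critIndex p +
1))`, the second has ratio `2^(-α)`. -/
theorem productConst_lt_top (hp : 1 < p) {α : ℝ} (hα : 0 < α) : productConst p α < ∞ := by
  have h0 := critIndex_add_one_pos hp
  rw [productConst, ENNReal.tsum_mul_left, ENNReal.tsum_prod (f := fun m n : ℕ =>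
    (2 : ℝ≥0∞) ^ (-(((m : ℝ) - 1) * (critIndex p + 1))) * 2 ^ (-((n : ℝ) * α)))]
  simp_rw [ENNReal.tsum_mul_left]
  rw [ENNReal.tsum_mul_right]
  refine ENNReal.mul_lt_top (bernsteinConst_ne_top hp.le).lt_top
    (ENNReal.mul_lt_top ?_ (tsum_two_rpow_neg_lt_top hα))
  have h : ∀ n : ℕ, (2 : ℝ≥0∞) ^ (-(((n : ℝ) - 1) * (critIndex p + 1))) =
      2 ^ (critIndex p + 1) * 2 ^ (-((n : ℝ) * (critIndex p + 1))) := fun n => by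
    rw [← two_rpow_add]; congr 1; ring
  simp_rw [h]
  rw [ENNReal.tsum_mul_left]
  exact ENNReal.mul_lt_top (two_rpow_ne_top _).lt_top (tsum_two_rpow_neg_lt_top h0)

/-- The sequence that majorizes the dyadic blocks of a product. -/
noncomputable def crossSeq (p r : ℝ≥0∞) (α : ℝ) (J : Set ℝ) (F G : ℝ → R3 → ℝ≥0∞) (k : ℤ) :
    ℝ≥0∞ :=
  plusNorm p r (-α) J G * (2 ^ ((k : ℝ) * (critIndex p + 1 + α)) *
    eLpNorm (fun t => annNorm p k (F t)) (ENNReal.ofReal (2 / (1 + α))) (volume.restrict J)) +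
  plusNorm p r (-α) J F * (2 ^ ((k : ℝ) * (critIndex p + 1 + α)) *
    eLpNorm (fun t => annNorm p k (G t)) (ENNReal.ofReal (2 / (1 + α))) (volume.restrict J))

/-- The high-frequency factor is measured at order `+α` and the low-frequency one at order `-α`.
Each low block is bounded by its full norm, while the high block is kept as a shifted sequence, so
that Young's inequality for sequences can sum the result in `ℓ^r`. -/
theorem lintegral_annNorm_conv_le (hp : 1 ≤ p) (hr : r ≠ 0) {α : ℝ} (hα : α ∈ Ioo (-1 : ℝ) 1)
    {J : Set ℝ} {F G : ℝ → R3 → ℝ≥0∞} (hF : Measurable (Function.uncurry F))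
    (hG : Measurable (Function.uncurry G)) (j : ℤ) :
    2 ^ ((j : ℝ) * (critIndex p + 1)) * ∫⁻ t in J, annNorm p j (conv (F t) (G t)) ≤
      ∑' q : ℕ × ℕ, bernsteinConst p *
        (2 ^ (-(((q.1 : ℝ) - 1) * (critIndex p + 1))) * 2 ^ (-((q.2 : ℝ) * α))) *
        crossSeq p r α J F G (j + ((q.1 : ℤ) - 1)) := by
  have hmF := measurable_annNorm hF p
  have hmG := measurable_annNorm hG p
  have hfix : ∀ {F : ℝ → R3 → ℝ≥0∞}, Measurable (Function.uncurry F) → ∀ t, Measurable (F t) :=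
    fun h t => h.comp measurable_prodMk_left
  refine (mul_le_mul_right (lintegral_mono fun t =>
    annNorm_conv_le hp (hfix hF t) (hfix hG t) j) _).trans ?_
  rw [lintegral_tsum, ← ENNReal.tsum_mul_left]
  swap
  · intro q
    exact (((hmF _).mul (hmG _)).add ((hmG _).mul (hmF _))).const_mul _ |>.aemeasurable
  refine ENNReal.tsum_le_tsum fun q => ?_
  rw [lintegral_const_mul, lintegral_add_left]
  rotate_left
  · exact (hmF _).mul (hmG _)
  · exact ((hmF _).mul (hmG _)).add ((hmG _).mul (hmF _))
  set k : ℤ := j + ((q.1 : ℤ) - 1) with hk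
  set l : ℤ := k - q.2 with hl
  have hlow : ∀ {H : ℝ → R3 → ℝ≥0∞}, 2 ^ ((l : ℝ) * (critIndex p + 1 - α)) *
      eLpNorm (fun t => annNorm p l (H t)) (ENNReal.ofReal (2 / (1 - α))) (volume.restrict J) ≤
      plusNorm p r (-α) J H := by
    intro H
    have := le_eLpNorm_count (r := r) (fun j : ℤ => 2 ^ ((j : ℝ) * (critIndex p + 1 + -α)) *
      eLpNorm (fun t => annNorm p j (H t)) (ENNReal.ofReal (2 / (1 + -α))) (volume.restrict J)) hr l
    simpa only [plusNorm, spaceTimeNorm, ← sub_eq_add_neg] using this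
  -- Exponent balance with `j = k - (q.1 - 1)` and `l = k - q.2`: moving `α` derivatives from the
  -- low factor to the high one releases `2^(-(k - l) α)`.
  have hexp : (2 : ℝ≥0∞) ^ ((j : ℝ) * (critIndex p + 1)) * 2 ^ ((l : ℝ) * (critIndex p + 1)) =
      2 ^ (-(((q.1 : ℝ) - 1) * (critIndex p + 1))) * 2 ^ (-((q.2 : ℝ) * α)) *
      (2 ^ ((k : ℝ) * (critIndex p + 1 + α)) * 2 ^ ((l : ℝ) * (critIndex p + 1 - α))) := by
    simp only [← two_rpow_add]
    congr 1
    rw [hl, hk]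
    push_cast
    ring
  have hmain : ∀ {A B : ℝ≥0∞},
      2 ^ ((j : ℝ) * (critIndex p + 1)) * (bernsteinConst p * 2 ^ ((l : ℝ) * (critIndex p + 1)) *
      (A * B)) = bernsteinConst p *
        (2 ^ (-(((q.1 : ℝ) - 1) * (critIndex p + 1))) * 2 ^ (-((q.2 : ℝ) * α))) *
        ((2 ^ ((l : ℝ) * (critIndex p + 1 - α)) * B) *
          (2 ^ ((k : ℝ) * (critIndex p + 1 + α)) * A)) := by
    intro A B
    calc _ = bernsteinConst p * (2 ^ ((j : ℝ) * (critIndex p + 1)) *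
          2 ^ ((l : ℝ) * (critIndex p + 1))) * (A * B) := by ring
      _ = _ := by rw [hexp]; ring
  have e : ((j + ((q.1 : ℤ) - 1) - (q.2 : ℤ) : ℤ) : ℝ) = (l : ℝ) := by rw [hl, hk]
  rw [e]
  rw [crossSeq, mul_add (bernsteinConst p * _), mul_add (2 ^ _ : ℝ≥0∞), mul_add (_ * _ : ℝ≥0∞)]
  refine add_le_add ?_ ?_
  · refine (mul_le_mul_right (mul_le_mul_right (holder_time hα (hmF k).aemeasurable
      (hmG l).aemeasurable) _) _).trans ?_
    rw [hmain]
    exact mul_le_mul_right (mul_le_mul_left hlow _) _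
  · refine (mul_le_mul_right (mul_le_mul_right (holder_time hα (hmG k).aemeasurable
      (hmF l).aemeasurable) _) _).trans ?_
    rw [hmain]
    exact mul_le_mul_right (mul_le_mul_left hlow _) _

/-- **The product estimate**: the derivative of a product is controlled in `L^1` in time. -/
theorem forceNorm_conv_le (hp : 1 ≤ p) (hr : 1 ≤ r) {α : ℝ} (hα : α ∈ Ioo (-1 : ℝ) 1)
    {J : Set ℝ} {F G : ℝ → R3 → ℝ≥0∞} (hF : Measurable (Function.uncurry F))
    (hG : Measurable (Function.uncurry G)) :
    forceNorm p r J (fun t ξ => ‖ξ‖ₑ * conv (F t) (G t) ξ) ≤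
      2 * productConst p α * (plusNorm p r α J F * plusNorm p r (-α) J G +
        plusNorm p r α J G * plusNorm p r (-α) J F) := by
  have hr0 : r ≠ 0 := (zero_lt_one.trans_le hr).ne'
  have hp0 : p ≠ 0 := (zero_lt_one.trans_le hp).ne'
  have hfix : ∀ t, Measurable (conv (F t) (G t)) :=
    fun t => measurable_conv_fixed (hF.comp measurable_prodMk_left) (hG.comp measurable_prodMk_left)
  -- On the annulus `|ξ| < 2^(j+1)`: the derivative costs one order of regularity and the factor `2`
  -- in the final constant.
  have h1 : ∀ (j : ℤ) t, annNorm p j (fun ξ => ‖ξ‖ₑ * conv (F t) (G t) ξ) ≤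
      2 ^ ((j : ℝ) + 1) * annNorm p j (conv (F t) (G t)) := by
    intro j t
    rw [← annNorm_const_mul hp0 j _ (hfix t).aemeasurable]
    refine annNorm_mono ((ae_restrict_iff' (measurableSet_annulus j)).2 (ae_of_all _ fun ξ hξ => ?_))
    gcongr
    have := ofReal_two_zpow (j + 1)
    push_cast at this
    rw [← this, ← ofReal_norm]
    exact ENNReal.ofReal_le_ofReal hξ.2.le
  have h2 : ∀ j : ℤ, 2 ^ ((j : ℝ) * critIndex p) *
      eLpNorm (fun t => annNorm p j (fun ξ => ‖ξ‖ₑ * conv (F t) (G t) ξ)) 1 (volume.restrict J) ≤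
      2 * (2 ^ ((j : ℝ) * (critIndex p + 1)) * ∫⁻ t in J, annNorm p j (conv (F t) (G t))) := by
    intro j
    simp only [eLpNorm_one_eq_lintegral_enorm, enorm_eq_self]
    refine (mul_le_mul_right (lintegral_mono fun t => h1 j t) _).trans_eq ?_
    rw [lintegral_const_mul]
    swap
    · exact measurable_annNorm (measurable_conv hF hG) p j
    rw [← mul_assoc, ← mul_assoc, ← two_rpow_add]
    congr 1
    have : (j : ℝ) * critIndex p + (j + 1) = 1 + (j : ℝ) * (critIndex p + 1) := by ring
    rw [this, two_rpow_add, ENNReal.rpow_one]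
  have h3 : forceNorm p r J (fun t ξ => ‖ξ‖ₑ * conv (F t) (G t) ξ) ≤
      2 * eLpNorm (fun j : ℤ => 2 ^ ((j : ℝ) * (critIndex p + 1)) *
        ∫⁻ t in J, annNorm p j (conv (F t) (G t))) r Measure.count := by
    rw [← eLpNorm_const_mul_count hr0]
    refine eLpNorm_mono_enorm fun j => ?_
    simpa only [enorm_eq_self] using h2 j
  refine h3.trans ?_
  rw [mul_assoc]
  refine mul_le_mul_right ?_ _
  refine (eLpNorm_mono_enorm fun j => ?_).trans ((eLpNorm_count_tsum_shift_le hr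
    (fun q : ℕ × ℕ => bernsteinConst p *
        (2 ^ (-(((q.1 : ℝ) - 1) * (critIndex p + 1))) * 2 ^ (-((q.2 : ℝ) * α))))
    (fun q => (q.1 : ℤ) - 1) (crossSeq p r α J F G)).trans (mul_le_mul_right ?_ _))
  · simpa only [enorm_eq_self] using lintegral_annNorm_conv_le hp hr0 hα hF hG j
  · refine (eLpNorm_add_le (measurable_of_countable _).aestronglyMeasurable
      (measurable_of_countable _).aestronglyMeasurable hr).trans_eq ?_
    rw [eLpNorm_const_mul_count hr0, eLpNorm_const_mul_count hr0, mul_comm, add_comm, mul_comm,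
      add_comm]
    rfl

/-! ### The heat kernel and Duhamel's formula -/

/-- The multiplier `exp (-a t)` for `t ≥ 0`, extended by zero to negative times. -/
noncomputable def decay (a t : ℝ) : ℝ≥0∞ := (Ici (0 : ℝ)).indicator
  (fun t => ENNReal.ofReal (Real.exp (-(a * t)))) t

theorem measurable_decay : Measurable (Function.uncurry decay) := by
  have : Function.uncurry decay = (Prod.snd ⁻¹' Ici (0 : ℝ)).indicator
      (fun z : ℝ × ℝ => ENNReal.ofReal (Real.exp (-(z.1 * z.2)))) := by
    ext ⟨a, t⟩
    by_cases h : 0 ≤ t <;> simp [decay, h, indicator]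
  rw [this]
  refine Measurable.indicator ?_ (measurable_snd measurableSet_Ici)
  fun_prop

theorem measurable_decay_right (a : ℝ) : Measurable (decay a) :=
  measurable_decay.comp (measurable_prodMk_left (x := a))

theorem decay_le_one {a : ℝ} (ha : 0 ≤ a) (t : ℝ) : decay a t ≤ 1 := by
  by_cases h : 0 ≤ t
  · rw [decay, indicator_of_mem (mem_Ici.2 h), ENNReal.ofReal_le_one, Real.exp_le_one_iff]
    have := mul_nonneg ha h
    linarith
  · simp [decay, h]

theorem decay_anti {a b : ℝ} (h : a ≤ b) (t : ℝ) : decay b t ≤ decay a t := by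
  by_cases ht : 0 ≤ t
  · rw [decay, decay, indicator_of_mem (mem_Ici.2 ht), indicator_of_mem (mem_Ici.2 ht)]
    gcongr
  · simp [decay, ht]

theorem eLpNorm_decay {a δ : ℝ} (ha : 0 < a) (hδ : 0 < δ) :
    eLpNorm (decay a) (ENNReal.ofReal δ) volume = ENNReal.ofReal ((δ * a)⁻¹ ^ (1 / δ)) := by
  rw [eLpNorm_eq_lintegral_rpow_enorm_toReal (by simpa using hδ) ENNReal.ofReal_ne_top,
    ENNReal.toReal_ofReal hδ.le]
  have h1 : ∀ t, ‖decay a t‖ₑ ^ δ = (Ici (0 : ℝ)).indicator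
      (fun t => ENNReal.ofReal (Real.exp ((-(δ * a)) * t))) t := by
    intro t
    by_cases ht : 0 ≤ t
    · rw [decay, indicator_of_mem (mem_Ici.2 ht), indicator_of_mem (mem_Ici.2 ht), enorm_eq_self,
        ENNReal.ofReal_rpow_of_pos (Real.exp_pos _), ← Real.exp_mul]
      congr 2; ring
    · simp [decay, ht, hδ]
  simp_rw [h1]
  have hneg : -(δ * a) < 0 := by have := mul_pos hδ ha; linarith
  rw [lintegral_indicator measurableSet_Ici, Measure.restrict_congr_set Ioi_ae_eq_Ici.symm,
    ← ofReal_integral_eq_lintegral_ofReal (integrableOn_exp_mul_Ioi hneg 0)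
      (ae_of_all _ fun t => (Real.exp_pos _).le), integral_exp_mul_Ioi hneg,
    ENNReal.ofReal_rpow_of_nonneg (by simp; positivity) (by positivity)]
  congr 2
  simp

/-- At frequency `2^j` the heat factor lives for a time of order `4^(-j)`, so its `L^δ` norm in time
is worth `2 / δ` derivatives. -/
theorem eLpNorm_decay_annulus {c δ : ℝ} (hc : 0 < c) (hδ : 0 < δ) (j : ℤ) :
    eLpNorm (decay (c * (2 ^ j) ^ 2)) (ENNReal.ofReal δ) volume =
      ENNReal.ofReal ((δ * c)⁻¹ ^ (1 / δ)) * 2 ^ (-((j : ℝ) * (2 / δ))) := by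
  rw [eLpNorm_decay (by positivity) hδ]
  have h : ((δ * (c * ((2 : ℝ) ^ j) ^ 2))⁻¹ : ℝ) = (δ * c)⁻¹ * (2 : ℝ) ^ (-((j : ℝ) * 2)) := by
    rw [← mul_assoc, mul_inv, Real.rpow_neg two_pos.le, Real.rpow_mul two_pos.le, Real.rpow_intCast]
    norm_num
  rw [h, Real.mul_rpow (by positivity) (by positivity), ENNReal.ofReal_mul (by positivity),
    ← Real.rpow_mul two_pos.le, ← ENNReal.ofReal_rpow_of_pos two_pos, ENNReal.ofReal_ofNat]
  congr 2
  ring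

theorem decay_le_of_mem_annulus {c : ℝ} (hc : 0 ≤ c) {j : ℤ} {ξ : R3} (hξ : ξ ∈ annulus j)
    (t : ℝ) : decay (c * ‖ξ‖ ^ 2) t ≤ decay (c * (2 ^ j) ^ 2) t := by
  refine decay_anti ?_ t
  have := hξ.1
  gcongr

theorem annNorm_decay_mul_le (hp : p ≠ 0) {c : ℝ} (hc : 0 ≤ c) (j : ℤ) (t : ℝ) {f : R3 → ℝ≥0∞}
    (hf : AEMeasurable f) :
    annNorm p j (fun ξ => decay (c * ‖ξ‖ ^ 2) t * f ξ) ≤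
      decay (c * (2 ^ j) ^ 2) t * annNorm p j f := by
  rw [← annNorm_const_mul hp j _ hf]
  refine annNorm_mono ((ae_restrict_iff' (measurableSet_annulus j)).2 (ae_of_all _ fun ξ hξ => ?_))
  exact mul_le_mul_left (decay_le_of_mem_annulus hc hξ t) _

/-- The majorant of the Duhamel integral. -/
noncomputable def duhamel (c : ℝ) (J : Set ℝ) (H : ℝ → R3 → ℝ≥0∞) (t : ℝ) (ξ : R3) : ℝ≥0∞ :=
  ∫⁻ τ in J, decay (c * ‖ξ‖ ^ 2) (t - τ) * H τ ξ

theorem annNorm_duhamel_le (hp : 1 ≤ p) {c : ℝ} (hc : 0 ≤ c) (J : Set ℝ) {H : ℝ → R3 → ℝ≥0∞}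
    (hH : Measurable (Function.uncurry H)) (j : ℤ) (t : ℝ) :
    annNorm p j (duhamel c J H t) ≤
      ∫⁻ τ in J, decay (c * (2 ^ j) ^ 2) (t - τ) * annNorm p j (H τ) := by
  have hm : Measurable (Function.uncurry fun τ (ξ : R3) => decay (c * ‖ξ‖ ^ 2) (t - τ) * H τ ξ) :=
    (measurable_decay.comp (f := fun z : ℝ × R3 => (c * ‖z.2‖ ^ 2, t - z.1))
      (by fun_prop)).mul hH
  refine (eLpNorm_lintegral_le (volume.restrict J) _ hm hp).trans (lintegral_mono fun τ => ?_)
  exact annNorm_decay_mul_le (zero_lt_one.trans_le hp).ne' hc j _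
    (hH.comp measurable_prodMk_left).aemeasurable

theorem duhamel_le (c : ℝ) (hc : 0 ≤ c) (J : Set ℝ) (H : ℝ → R3 → ℝ≥0∞) (t : ℝ) (ξ : R3) :
    duhamel c J H t ξ ≤ ∫⁻ τ in J, H τ ξ :=
  lintegral_mono fun τ => mul_le_of_le_one_left zero_le (decay_le_one (by positivity) _)

theorem measurable_duhamel (c : ℝ) (J : Set ℝ) {H : ℝ → R3 → ℝ≥0∞}
    (hH : Measurable (Function.uncurry H)) : Measurable (Function.uncurry (duhamel c J H)) := by
  refine Measurable.lintegral_prod_right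
    (f := fun (z : ℝ × R3) τ => decay (c * ‖z.2‖ ^ 2) (z.1 - τ) * H τ z.2) ?_
  exact (measurable_decay.comp (f := fun z : (ℝ × R3) × ℝ => (c * ‖z.1.2‖ ^ 2, z.1.1 - z.2))
      (by fun_prop)).mul (hH.comp (f := fun z : (ℝ × R3) × ℝ => (z.2, z.1.2)) (by fun_prop))

/-- Young's inequality in time, annulus by annulus: the heat factor is taken in `L^δ` and the
forcing in `L^1`. -/
theorem spaceTimeNorm_duhamel_le (hp : 1 ≤ p) (hr : 1 ≤ r) {c δ : ℝ} (hc : 0 < c) (hδ : 1 ≤ δ)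
    (s : ℝ) (J : Set ℝ) {H : ℝ → R3 → ℝ≥0∞} (hH : Measurable (Function.uncurry H)) :
    spaceTimeNorm p r (ENNReal.ofReal δ) (s + 2 / δ) J (duhamel c J H) ≤
      ENNReal.ofReal ((δ * c)⁻¹ ^ (1 / δ)) * spaceTimeNorm p r 1 s J H := by
  rw [spaceTimeNorm, spaceTimeNorm, ← eLpNorm_const_mul_count (zero_lt_one.trans_le hr).ne']
  refine eLpNorm_mono_enorm fun j => ?_
  simp only [enorm_eq_self]
  have h1 : eLpNorm (fun t => annNorm p j (duhamel c J H t)) (ENNReal.ofReal δ)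
      (volume.restrict J) ≤ eLpNorm (decay (c * (2 ^ j) ^ 2)) (ENNReal.ofReal δ) volume *
        ∫⁻ τ in J, annNorm p j (H τ) := by
    -- The output may be taken on the whole time line: `decay` is extended by zero to negative
    -- times, so the Duhamel majorant is an honest convolution.
    refine (eLpNorm_mono_measure _ Measure.restrict_le_self).trans ?_
    refine le_trans (eLpNorm_mono_enorm fun t => ?_) (eLpNorm_convolution_le volume
      (volume.restrict J) (measurable_decay_right _)
      (measurable_annNorm hH p j) (by simpa using hδ))
    simpa only [enorm_eq_self] using annNorm_duhamel_le hp hc.le J hH j t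
  refine (mul_le_mul_right h1 _).trans_eq ?_
  rw [eLpNorm_decay_annulus hc (by linarith), eLpNorm_one_eq_lintegral_enorm]
  simp only [enorm_eq_self]
  have : (2 : ℝ≥0∞) ^ ((j : ℝ) * (s + 2 / δ)) * 2 ^ (-((j : ℝ) * (2 / δ))) = 2 ^ ((j : ℝ) * s) := by
    rw [← two_rpow_add]; congr 1; ring
  rw [← this]
  ring

theorem spaceTimeNorm_heat_le (hp : 1 ≤ p) (hr : 1 ≤ r) {c δ : ℝ} (hc : 0 < c) (hδ : 1 ≤ δ)
    (s : ℝ) (J : Set ℝ) {f : R3 → ℝ≥0∞} (hf : Measurable f) :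
    spaceTimeNorm p r (ENNReal.ofReal δ) (s + 2 / δ) J
      (fun t ξ => decay (c * ‖ξ‖ ^ 2) t * f ξ) ≤
      ENNReal.ofReal ((δ * c)⁻¹ ^ (1 / δ)) * spaceNorm p r s f := by
  rw [spaceTimeNorm, spaceNorm, ← eLpNorm_const_mul_count (zero_lt_one.trans_le hr).ne']
  refine eLpNorm_mono_enorm fun j => ?_
  simp only [enorm_eq_self]
  have h1 : eLpNorm (fun t => annNorm p j (fun ξ => decay (c * ‖ξ‖ ^ 2) t * f ξ))
      (ENNReal.ofReal δ) (volume.restrict J) ≤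
      annNorm p j f * eLpNorm (decay (c * (2 ^ j) ^ 2)) (ENNReal.ofReal δ) volume := by
    refine (eLpNorm_mono_measure _ Measure.restrict_le_self).trans ?_
    rw [← eLpNorm_const_mul_ennreal _ _ (measurable_decay_right _).aemeasurable
      (by simpa using zero_lt_one.trans_le hδ)]
    refine eLpNorm_mono_enorm fun t => ?_
    simp only [enorm_eq_self]
    rw [mul_comm (annNorm p j f)]
    exact annNorm_decay_mul_le (zero_lt_one.trans_le hp).ne' hc.le j t hf.aemeasurable
  refine (mul_le_mul_right h1 _).trans_eq ?_
  rw [eLpNorm_decay_annulus hc (by linarith)]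
  have : (2 : ℝ≥0∞) ^ ((j : ℝ) * (s + 2 / δ)) * 2 ^ (-((j : ℝ) * (2 / δ))) = 2 ^ ((j : ℝ) * s) := by
    rw [← two_rpow_add]; congr 1; ring
  rw [← this]
  ring

end PrimitiveEq

namespace PrimitiveEq

/-! ### The Littlewood-Paley multipliers -/

namespace LittlewoodPaley

variable (L : LittlewoodPaley)

theorem norm_bounds_of_mem_tsupport_hat {j : ℤ} {ξ : R3} (h : ξ ∈ tsupport (L.hat j)) :
    3 / 4 * 2 ^ j ≤ ‖ξ‖ ∧ ‖ξ‖ ≤ 8 / 3 * (2 : ℝ) ^ j := by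
  have hsub : tsupport (L.hat j) ⊆
      (fun ξ : R3 => (2 : ℝ) ^ (-j) • ξ) ⁻¹' {ξ | 3 / 4 ≤ ‖ξ‖ ∧ ‖ξ‖ ≤ 8 / 3} :=
    (tsupport_comp_subset_preimage (𝓕 L.ψ : 𝓢(R3, ℂ)) (by fun_prop)).trans
      (Set.preimage_mono L.supp)
  have h1 := hsub h
  have h2 : (0 : ℝ) < 2 ^ j := by positivity
  have h3 : ‖(2 : ℝ) ^ (-j) • ξ‖ = ‖ξ‖ / 2 ^ j := by
    rw [norm_smul, Real.norm_of_nonneg (by positivity), zpow_neg, div_eq_inv_mul]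
  simp only [mem_preimage, mem_ofPred_eq, h3, le_div_iff₀ h2, div_le_iff₀ h2] at h1
  exact h1

theorem contDiff_hat (j : ℤ) : ContDiff ℝ (⊤ : ℕ∞) (L.hat j) :=
  ((𝓕 L.ψ : 𝓢(R3, ℂ)).smooth ⊤).comp (contDiff_const_smul _)

theorem hasCompactSupport_hat (j : ℤ) : HasCompactSupport (L.hat j) := by
  refine HasCompactSupport.of_support_subset_isCompact
    (isCompact_closedBall (0 : R3) (8 / 3 * 2 ^ j)) fun x hx => ?_
  simpa using (L.norm_bounds_of_mem_tsupport_hat (subset_tsupport _ hx)).2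

theorem hasTemperateGrowth_hat (j : ℤ) : (L.hat j).HasTemperateGrowth :=
  (L.hasCompactSupport_hat j).hasTemperateGrowth (L.contDiff_hat j)

theorem zero_notMem_tsupport_hat (j : ℤ) : (0 : R3) ∉ tsupport (L.hat j) := fun h => by
  have h1 := (L.norm_bounds_of_mem_tsupport_hat h).1
  have h2 : (0 : ℝ) < 2 ^ j := by positivity
  rw [norm_zero] at h1
  linarith

/-- A bound for the symbols of all dyadic blocks. -/
noncomputable def hatBound : ℝ≥0∞ :=
  ENNReal.ofReal (SchwartzMap.seminorm ℂ 0 0 (𝓕 L.ψ : 𝓢(R3, ℂ)))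

theorem hatBound_ne_top : L.hatBound ≠ ∞ := ENNReal.ofReal_ne_top

theorem enorm_hat_le (j : ℤ) (ξ : R3) : ‖L.hat j ξ‖ₑ ≤ L.hatBound := by
  rw [← ofReal_norm]
  exact ENNReal.ofReal_le_ofReal (SchwartzMap.norm_le_seminorm ℂ _ _)

/-- Only neighbours interact, because `8/3 < 4` and `4/3 < 2`. Hence three terms suffice to compare
smooth and sharp decompositions. -/
theorem overlap {j k : ℤ} {ξ : R3} (hk : ξ ∈ annulus k) (h : L.hat j ξ ≠ 0) :
    k - 1 ≤ j ∧ j ≤ k + 1 := by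
  obtain ⟨h1, h2⟩ := L.norm_bounds_of_mem_tsupport_hat (subset_tsupport _ h)
  have hj : (0 : ℝ) < 2 ^ j := by positivity
  have e1 : (2 : ℝ) ^ (j + 2) = 2 ^ j * 4 := by rw [zpow_add₀ two_ne_zero]; norm_num
  have e2 : (2 : ℝ) ^ (k + 2) = 2 ^ (k + 1) * 2 := by
    rw [← zpow_add_one₀ two_ne_zero]; ring_nf
  have i1 : k < j + 2 := by
    refine (zpow_lt_zpow_iff_right₀ (one_lt_two : (1 : ℝ) < 2)).1 ?_
    rw [e1]; linarith [hk.1]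
  have i2 : j < k + 2 := by
    refine (zpow_lt_zpow_iff_right₀ (one_lt_two : (1 : ℝ) < 2)).1 ?_
    rw [e2]; linarith [hk.2]
  omega

theorem sum_hat_eq_one {k : ℤ} {ξ : R3} (hk : ξ ∈ annulus k) :
    ∑ i : Fin 3, L.hat (k + ((i : ℤ) - 1)) ξ = 1 := by
  have h0 : ξ ≠ 0 := by
    rintro rfl
    have := hk.1
    rw [norm_zero] at this
    exact absurd this (not_le.2 (by positivity))
  have h1 := L.partition ξ h0
  have h2 : HasSum (fun j : ℤ => L.hat j ξ) (∑ j ∈ Finset.Icc (k - 1) (k + 1), L.hat j ξ) := by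
    refine hasSum_sum_of_ne_finset_zero fun j hj => ?_
    by_contra hne
    exact hj (Finset.mem_Icc.2 (L.overlap hk hne))
  rw [← h2.unique h1]
  have : Finset.Icc (k - 1) (k + 1) = {k - 1, k, k + 1} := by
    ext j; simp only [Finset.mem_Icc, Finset.mem_insert, Finset.mem_singleton]; omega
  rw [this, Finset.sum_insert (by simp; omega), Finset.sum_insert (by simp), Finset.sum_singleton,
    Fin.sum_univ_three]
  simp [sub_eq_add_neg, add_assoc]

end LittlewoodPaley

/-! ### Fourier transforms of distributions modulo polynomials -/

theorem IsTestOffZero.integrable_mul {φ : 𝓢(R3, ℂ)} (hφ : IsTestOffZero φ) {f : R3 → ℂ}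
    (hf : LocallyIntegrableOn f {0}ᶜ volume) : Integrable (fun ξ => φ ξ * f ξ) := by
  have hsub : tsupport φ ⊆ {0}ᶜ := fun x hx h => hφ.2 (by rwa [← mem_singleton_iff.1 h])
  have h1 : IntegrableOn f (tsupport φ) := hf.integrableOn_compact_subset hsub hφ.1
  have h2 : IntegrableOn (fun ξ => φ ξ * f ξ) (tsupport φ) :=
    h1.continuousOn_mul φ.continuous.continuousOn hφ.1
  refine (integrableOn_iff_integrable_of_support_subset ?_).1 h2
  intro x hx
  exact subset_tsupport _ (left_ne_zero_of_mul hx)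

/-- A smooth compactly supported real function as a Schwartz function. -/
noncomputable def schwartzOfReal {g : R3 → ℝ} (hg : ContDiff ℝ (⊤ : ℕ∞) g)
    (hc : HasCompactSupport g) : 𝓢(R3, ℂ) :=
  (hc.comp_left (g := Complex.ofReal) rfl).toSchwartzMap (Complex.ofRealCLM.contDiff.comp hg)

theorem schwartzOfReal_apply {g : R3 → ℝ} (hg : ContDiff ℝ (⊤ : ℕ∞) g)
    (hc : HasCompactSupport g) (ξ : R3) : schwartzOfReal hg hc ξ = (g ξ : ℂ) := rfl

theorem tsupport_schwartzOfReal {g : R3 → ℝ} (hg : ContDiff ℝ (⊤ : ℕ∞) g)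
    (hc : HasCompactSupport g) : tsupport (schwartzOfReal hg hc) ⊆ tsupport g := by
  refine closure_mono fun x hx => ?_
  rw [Function.mem_support, schwartzOfReal_apply] at hx
  exact fun h => hx (by simp [h])

theorem isTestOffZero_schwartzOfReal {g : R3 → ℝ} (hg : ContDiff ℝ (⊤ : ℕ∞) g)
    (hc : HasCompactSupport g) (h0 : tsupport g ⊆ {0}ᶜ) :
    IsTestOffZero (schwartzOfReal hg hc) :=
  ⟨hc.of_isClosed_subset (isClosed_tsupport _) (tsupport_schwartzOfReal hg hc),
    fun h => h0 (tsupport_schwartzOfReal hg hc h) rfl⟩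

theorem fourier_eq_of_mk_eq {U U' : 𝓢'(R3, ℂ)} (h : Sh.mk U = Sh.mk U') {φ : 𝓢(R3, ℂ)}
    (hφ : IsTestOffZero φ) : (𝓕 U : 𝓢'(R3, ℂ)) φ = (𝓕 U' : 𝓢'(R3, ℂ)) φ := by
  have h1 := (Submodule.Quotient.eq polynomials).1 h φ hφ
  rw [TemperedDistribution.fourier_apply] at h1 ⊢
  rw [TemperedDistribution.fourier_apply]
  exact sub_eq_zero.1 h1

namespace IsFourierTransform

variable {u v : Sh} {f g : R3 → ℂ}

theorem apply_rep (h : IsFourierTransform u f) {U : 𝓢'(R3, ℂ)} (hU : Sh.mk U = u)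
    {φ : 𝓢(R3, ℂ)} (hφ : IsTestOffZero φ) : (𝓕 U : 𝓢'(R3, ℂ)) φ = ∫ ξ, φ ξ * f ξ := by
  obtain ⟨U', hU', h2⟩ := h.2
  rw [fourier_eq_of_mk_eq (hU.trans hU'.symm) hφ, h2 φ hφ]

theorem congr_ae (h : IsFourierTransform u f) (hfg : f =ᵐ[volume] g) : IsFourierTransform u g := by
  obtain ⟨U, hU, h2⟩ := h.2
  refine ⟨fun x hx => ?_, U, hU, fun φ hφ => ?_⟩
  · obtain ⟨s, hs, hi⟩ := h.1 x hx
    exact ⟨s, hs, hi.congr (ae_restrict_of_ae hfg)⟩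
  · rw [h2 φ hφ]
    refine integral_congr_ae ?_
    filter_upwards [hfg] with ξ hξ
    rw [hξ]

theorem sub (hu : IsFourierTransform u f) (hv : IsFourierTransform v g) :
    IsFourierTransform (u - v) (fun ξ => f ξ - g ξ) := by
  obtain ⟨U, rfl, h2⟩ := hu.2
  obtain ⟨V, rfl, h3⟩ := hv.2
  refine ⟨hu.1.sub hv.1, U - V, rfl, fun φ hφ => ?_⟩
  rw [TemperedDistribution.fourier_apply]
  change U (𝓕 φ) - V (𝓕 φ) = _
  rw [← TemperedDistribution.fourier_apply, ← TemperedDistribution.fourier_apply, h2 φ hφ,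
    h3 φ hφ, ← integral_sub (hφ.integrable_mul hu.1) (hφ.integrable_mul hv.1)]
  simp_rw [mul_sub]

theorem const_smul (hu : IsFourierTransform u f) (c : ℂ) :
    IsFourierTransform (c • u) (fun ξ => c * f ξ) := by
  obtain ⟨U, rfl, h2⟩ := hu.2
  refine ⟨hu.1.smul c, c • U, rfl, fun φ hφ => ?_⟩
  rw [TemperedDistribution.fourier_apply]
  change c • U (𝓕 φ) = _
  rw [← TemperedDistribution.fourier_apply, h2 φ hφ, smul_eq_mul, ← integral_const_mul]
  congr 1; ext ξ; ring

theorem zero : IsFourierTransform 0 (fun _ => 0) :=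
  ⟨locallyIntegrableOn_zero, 0, rfl, fun φ _ => by
    rw [TemperedDistribution.fourier_apply]
    simp⟩

theorem add (hu : IsFourierTransform u f) (hv : IsFourierTransform v g) :
    IsFourierTransform (u + v) (fun ξ => f ξ + g ξ) := by
  have h := hu.sub (zero.sub hv)
  simpa using h

theorem finset_sum {ι : Type*} (s : Finset ι) {u : ι → Sh} {f : ι → R3 → ℂ}
    (h : ∀ i ∈ s, IsFourierTransform (u i) (f i)) :
    IsFourierTransform (∑ i ∈ s, u i) (fun ξ => ∑ i ∈ s, f i ξ) := by
  classical
  induction s using Finset.induction_on with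
  | empty => simpa using zero
  | insert a s ha ih =>
    simp_rw [Finset.sum_insert ha]
    exact (h a (Finset.mem_insert_self _ _)).add
      (ih fun i hi => h i (Finset.mem_insert_of_mem hi))

theorem eq_of_ae_eq (hu : IsFourierTransform u f) (hv : IsFourierTransform v g)
    (hfg : f =ᵐ[volume] g) : u = v := by
  obtain ⟨U, rfl, h2⟩ := hu.2
  obtain ⟨V, rfl, h3⟩ := (hv.congr_ae hfg.symm).2
  refine (Submodule.Quotient.eq polynomials).2 fun φ hφ => ?_
  rw [TemperedDistribution.fourier_apply]
  change U (𝓕 φ) - V (𝓕 φ) = _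
  rw [← TemperedDistribution.fourier_apply, ← TemperedDistribution.fourier_apply, h2 φ hφ,
    h3 φ hφ, sub_self]

/-- Two transforms of one class agree against every test function supported off the origin, so they
agree almost everywhere there, and the origin is a null set. -/
theorem ae_eq (hf : IsFourierTransform u f) (hg : IsFourierTransform u g) : f =ᵐ[volume] g := by
  obtain ⟨U, rfl, -⟩ := hf.2
  have hopen : IsOpen ({0}ᶜ : Set R3) := isOpen_compl_singleton
  have h := hopen.ae_eq_zero_of_integral_contDiff_smul_eq_zero (hf.1.sub hg.1)
    (fun φ hφ hc hs => by
      have ht := isTestOffZero_schwartzOfReal hφ hc hs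
      have h1 := hf.apply_rep rfl ht
      rw [hg.apply_rep rfl ht] at h1
      have h2 := integral_sub (ht.integrable_mul hf.1) (ht.integrable_mul hg.1)
      rw [h1, sub_self] at h2
      rw [← h2]
      congr 1; ext ξ
      simp [schwartzOfReal_apply, mul_sub])
  filter_upwards [h, ae_ne_zero] with ξ h1 h2
  exact sub_eq_zero.1 (h1 h2)

theorem partialDeriv (hu : IsFourierTransform u f) (k : Fin 3) :
    IsFourierTransform (PrimitiveEq.partialDeriv k u)
      (fun ξ => 2 * Real.pi * Complex.I * (ξ k : ℂ) * f ξ) := by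
  obtain ⟨U, rfl, h2⟩ := hu.2
  refine ⟨?_, ∂_{EuclideanSpace.single k (1 : ℝ)} U, rfl, fun φ hφ => ?_⟩
  · exact hu.1.continuousOn_mul (by fun_prop) isOpen_compl_singleton.isLocallyClosed
  · rw [TemperedDistribution.fourier_lineDerivOp_eq]
    change (2 * Real.pi * Complex.I) • (TemperedDistribution.smulLeftCLM ℂ
      (fun x : R3 => ((inner ℝ x (EuclideanSpace.single k (1 : ℝ)) : ℝ) : ℂ)) (𝓕 U)) φ = _
    rw [TemperedDistribution.smulLeftCLM_apply_apply, hu.apply_rep rfl (hφ.smulLeft _),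
      smul_eq_mul, ← integral_const_mul]
    congr 1; ext ξ
    rw [SchwartzMap.smulLeftCLM_apply_apply (by fun_prop)]
    simp [EuclideanSpace.inner_single_right]
    ring

end IsFourierTransform

end PrimitiveEq

namespace PrimitiveEq

/-! ### Dyadic blocks of functions -/

variable {p r : ℝ≥0∞} {u v : Sh} {f g : R3 → ℂ}

theorem fourier_dyadicBlock_apply (L : LittlewoodPaley) (j : ℤ) (U : 𝓢'(R3, ℂ)) (φ : 𝓢(R3, ℂ)) :
    blockHat L j (Sh.mk U) φ =
      (𝓕 U : 𝓢'(R3, ℂ)) (SchwartzMap.smulLeftCLM ℂ (L.hat j) φ) := by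
  change (𝓕 (dyadicBlock L j U) : 𝓢'(R3, ℂ)) φ = _
  rw [dyadicBlock, TemperedDistribution.fourierMultiplierCLM_apply,
    FourierTransform.fourier_fourierInv_eq, TemperedDistribution.smulLeftCLM_apply_apply]

theorem IsFourierTransform.blockHat_apply (L : LittlewoodPaley) (h : IsFourierTransform u f)
    (j : ℤ) (φ : 𝓢(R3, ℂ)) : blockHat L j u φ = ∫ ξ, φ ξ * (L.hat j ξ * f ξ) := by
  obtain ⟨U, rfl, -⟩ := h.2
  rw [fourier_dyadicBlock_apply, h.apply_rep rfl (L.isTestOffZero j φ)]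
  congr 1; ext ξ
  rw [SchwartzMap.smulLeftCLM_apply_apply (L.hasTemperateGrowth_hat j), smul_eq_mul]
  ring

theorem integrable_hat_mul (L : LittlewoodPaley) (j : ℤ)
    (hf : LocallyIntegrableOn f {0}ᶜ volume) : Integrable (fun ξ => L.hat j ξ * f ξ) := by
  have := IsTestOffZero.integrable_mul (φ := (L.hasCompactSupport_hat j).toSchwartzMap
    (L.contDiff_hat j)) ⟨L.hasCompactSupport_hat j, L.zero_notMem_tsupport_hat j⟩ hf
  exact this

theorem ae_eq_of_forall_schwartz (hf : LocallyIntegrable f) (hg : LocallyIntegrable g)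
    (h : ∀ φ : 𝓢(R3, ℂ), ∫ ξ, φ ξ * f ξ = ∫ ξ, φ ξ * g ξ) : f =ᵐ[volume] g :=
  ae_eq_of_integral_contDiff_smul_eq hf hg fun φ hφ hc => by
    simpa only [schwartzOfReal_apply, Complex.real_smul] using h (schwartzOfReal hφ hc)

/-- The representing function is unique up to null sets, so all candidates in the infimum have the
same norm; if there is none in `L^p`, both sides are infinite. -/
theorem distLpNorm_eq (hp : 1 ≤ p) {U : 𝓢'(R3, ℂ)} (hf : LocallyIntegrable f)
    (hU : ∀ φ : 𝓢(R3, ℂ), U φ = ∫ ξ, φ ξ * f ξ) : distLpNorm p U = eLpNorm f p volume := by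
  refine le_antisymm ?_ ?_
  · by_cases hm : MemLp f p volume
    · exact iInf_le_of_le f (iInf_le_of_le hm (iInf_le_of_le hU le_rfl))
    · have : eLpNorm f p volume = ∞ := by
        by_contra hne
        exact hm ⟨hf.aestronglyMeasurable, lt_top_iff_ne_top.2 hne⟩
      rw [this]; exact le_top
  · refine le_iInf fun g => le_iInf fun hg => le_iInf fun hgU => ?_
    exact (eLpNorm_congr_ae (ae_eq_of_forall_schwartz hf (hg.locallyIntegrable hp)
      fun φ => by rw [← hU, hgU])).le

theorem IsFourierTransform.blockNorm_eq (L : LittlewoodPaley) (hp : 1 ≤ p)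
    (h : IsFourierTransform u f) (j : ℤ) :
    blockNorm L p j u = eLpNorm (fun ξ => L.hat j ξ * f ξ) p volume :=
  distLpNorm_eq hp (integrable_hat_mul L j h.1).locallyIntegrable (h.blockHat_apply L j)

theorem IsFourierTransform.aestronglyMeasurable (h : IsFourierTransform u f) :
    AEStronglyMeasurable f volume := by
  have h1 := h.1.aestronglyMeasurable
  have h2 : ({0}ᶜ : Set R3) =ᵐ[volume] univ := by
    rw [ae_eq_univ, compl_compl]; simp
  rwa [Measure.restrict_congr_set h2, Measure.restrict_univ] at h1

/-- By `overlap`, the support of a smooth block is covered by three annuli up to a null set. -/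
theorem eLpNorm_hat_mul_le (L : LittlewoodPaley) (hp : 1 ≤ p) (hf : AEMeasurable f) (j : ℤ) :
    eLpNorm (fun ξ => L.hat j ξ * f ξ) p volume ≤
      ∑' i : Fin 3, L.hatBound * annNorm p (j + ((i : ℤ) - 1)) (fun ξ => ‖f ξ‖ₑ) := by
  set f' : R3 → ℝ≥0∞ := hf.enorm.mk with hf'
  have hae : (fun ξ => ‖f ξ‖ₑ) =ᵐ[volume] f' := hf.enorm.ae_eq_mk
  have hm : ∀ k, Measurable ((annulus k).indicator f') := fun k =>
    hf.enorm.measurable_mk.indicator (measurableSet_annulus k)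
  have h1 : ∀ᵐ ξ : R3, ‖L.hat j ξ * f ξ‖ₑ ≤ ‖∑' i : Fin 3, L.hatBound *
      (annulus (j + ((i : ℤ) - 1))).indicator f' ξ‖ₑ := by
    filter_upwards [hae, ae_ne_zero] with ξ h1 h0
    rw [enorm_eq_self, enorm_mul, h1]
    by_cases h2 : L.hat j ξ = 0
    · simp [h2]
    obtain ⟨k, hk⟩ := exists_mem_annulus h0
    have h3 := L.overlap hk h2
    obtain ⟨i, hi⟩ : ∃ i : Fin 3, j + ((i : ℤ) - 1) = k := by
      obtain h | h | h : k = j - 1 ∨ k = j ∨ k = j + 1 := by omega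
      · exact ⟨0, by simp [h]; ring⟩
      · exact ⟨1, by simp [h]⟩
      · exact ⟨2, by simp [h]⟩
    refine le_trans ?_ (ENNReal.le_tsum i)
    rw [hi, indicator_of_mem hk]
    gcongr
    exact L.enorm_hat_le j ξ
  refine (eLpNorm_mono_enorm_ae h1).trans ((eLpNorm_tsum_le _ (fun i => (hm _).const_mul _)
    hp).trans_eq ?_)
  refine tsum_congr fun i => ?_
  rw [eLpNorm_const_mul_ennreal _ _ (hm _).aemeasurable (zero_lt_one.trans_le hp).ne',
    annNorm_indicator, annNorm, annNorm, eLpNorm_congr_ae (ae_restrict_of_ae hae)]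

/-- The converse comparison: on one annulus the partition of unity reduces to three blocks, by
`sum_hat_eq_one`. -/
theorem annNorm_le_sum_hat (L : LittlewoodPaley) (hp : 1 ≤ p) (hf : AEMeasurable f) (k : ℤ) :
    annNorm p k (fun ξ => ‖f ξ‖ₑ) ≤
      ∑' i : Fin 3, eLpNorm (fun ξ => L.hat (k + ((i : ℤ) - 1)) ξ * f ξ) p volume := by
  set f' : R3 → ℂ := hf.mk with hf'
  have hae : f =ᵐ[volume] f' := hf.ae_eq_mk
  have hm : ∀ j, Measurable fun ξ => ‖L.hat j ξ * f' ξ‖ₑ := fun j =>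
    (((L.contDiff_hat j).continuous.measurable).mul hf.measurable_mk).enorm
  have h1 : ∀ᵐ ξ ∂(volume.restrict (annulus k)), ‖‖f ξ‖ₑ‖ₑ ≤
      ‖∑' i : Fin 3, ‖L.hat (k + ((i : ℤ) - 1)) ξ * f' ξ‖ₑ‖ₑ := by
    filter_upwards [ae_restrict_of_ae hae, ae_restrict_mem (measurableSet_annulus k)] with ξ h1 hk
    rw [enorm_eq_self, enorm_eq_self, tsum_fintype, h1]
    calc ‖f' ξ‖ₑ = ‖∑ i : Fin 3, L.hat (k + ((i : ℤ) - 1)) ξ * f' ξ‖ₑ := by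
          rw [← Finset.sum_mul, L.sum_hat_eq_one hk, one_mul]
      _ ≤ _ := enorm_sum_le _ _
  refine (eLpNorm_mono_enorm_ae h1).trans ((eLpNorm_tsum_le _ (fun i => hm _) hp).trans ?_)
  refine ENNReal.tsum_le_tsum fun i => ?_
  rw [eLpNorm_enorm]
  refine (eLpNorm_mono_measure _ Measure.restrict_le_self).trans_eq (eLpNorm_congr_ae ?_)
  filter_upwards [hae] with ξ hξ
  rw [hξ]

/-- The constant in the comparison of smooth and sharp dyadic decompositions. -/
noncomputable def shiftConst (s : ℝ) : ℝ≥0∞ := ∑' i : Fin 3, 2 ^ (-(((i : ℝ) - 1) * s))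

theorem shiftConst_ne_top (s : ℝ) : shiftConst s ≠ ∞ := by
  rw [shiftConst, tsum_fintype]
  exact ENNReal.sum_ne_top.2 fun i _ => two_rpow_ne_top _

theorem weighted_shift_le (hr : 1 ≤ r) (s : ℝ) {a b : ℤ → ℝ≥0∞}
    (h : ∀ j, a j ≤ ∑' i : Fin 3, b (j + ((i : ℤ) - 1))) :
    eLpNorm (fun j : ℤ => 2 ^ ((j : ℝ) * s) * a j) r Measure.count ≤
      shiftConst s * eLpNorm (fun j : ℤ => 2 ^ ((j : ℝ) * s) * b j) r Measure.count := by
  refine le_trans (eLpNorm_mono_enorm fun j => ?_) (eLpNorm_count_tsum_shift_le hr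
    (fun i : Fin 3 => (2 : ℝ≥0∞) ^ (-(((i : ℝ) - 1) * s))) (fun i => (i : ℤ) - 1)
    (fun j : ℤ => 2 ^ ((j : ℝ) * s) * b j))
  simp only [enorm_eq_self]
  refine (mul_le_mul_right (h j) _).trans_eq ?_
  rw [← ENNReal.tsum_mul_left]
  refine tsum_congr fun i => ?_
  rw [← mul_assoc, ← two_rpow_add]
  congr 2
  push_cast
  ring

/-- Together with `IsFourierTransform.spaceNorm_le`, this allows all estimates to be made on sharp
annuli, at the price of constants that depend only on `s` and on the partition. -/
theorem IsFourierTransform.fbNorm_le (L : LittlewoodPaley) (hp : 1 ≤ p) (hr : 1 ≤ r) (s : ℝ)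
    (h : IsFourierTransform u f) :
    fbNorm L s p r u ≤ shiftConst s * L.hatBound * spaceNorm p r s (fun ξ => ‖f ξ‖ₑ) := by
  have h1 := weighted_shift_le (r := r) hr s (a := fun j => blockNorm L p j u)
    (b := fun j => L.hatBound * annNorm p j (fun ξ => ‖f ξ‖ₑ)) (fun j => by
      rw [h.blockNorm_eq L hp]
      exact eLpNorm_hat_mul_le L hp h.aestronglyMeasurable.aemeasurable j)
  refine h1.trans_eq ?_
  rw [mul_assoc, spaceNorm, ← eLpNorm_const_mul_count (zero_lt_one.trans_le hr).ne' L.hatBound]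
  congr 2
  ext j
  ring

theorem IsFourierTransform.spaceNorm_le (L : LittlewoodPaley) (hp : 1 ≤ p) (hr : 1 ≤ r) (s : ℝ)
    (h : IsFourierTransform u f) :
    spaceNorm p r s (fun ξ => ‖f ξ‖ₑ) ≤ shiftConst s * fbNorm L s p r u := by
  refine weighted_shift_le (r := r) hr s fun j => ?_
  simp only [h.blockNorm_eq L hp]
  exact annNorm_le_sum_hat L hp h.aestronglyMeasurable.aemeasurable j

theorem cheminLernerNorm_le (L : LittlewoodPaley) (hp : 1 ≤ p) (hr : 1 ≤ r) {δ : ℝ≥0∞}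
    (hδ : 1 ≤ δ) (s : ℝ) {J : Set ℝ} (hJ : MeasurableSet J) {u : ℝ → Sh} {V : ℝ → R3 → ℂ}
    (hV : Measurable (Function.uncurry V)) (h : ∀ t ∈ J, IsFourierTransform (u t) (V t)) :
    cheminLernerNorm L δ s p r J u ≤
      shiftConst s * L.hatBound * spaceTimeNorm p r δ s J (fun t ξ => ‖V t ξ‖ₑ) := by
  have hm := measurable_annNorm (F := fun t ξ => ‖V t ξ‖ₑ) hV.enorm p
  have h1 := weighted_shift_le (r := r) hr s
    (a := fun j => eLpNorm (fun t => blockNorm L p j (u t)) δ (volume.restrict J))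
    (b := fun j => L.hatBound * eLpNorm (fun t => annNorm p j (fun ξ => ‖V t ξ‖ₑ)) δ
      (volume.restrict J)) (fun j => by
      refine le_trans (eLpNorm_mono_enorm_ae (g := fun t => ∑' i : Fin 3, L.hatBound *
        annNorm p (j + ((i : ℤ) - 1)) (fun ξ => ‖V t ξ‖ₑ)) ?_) ((eLpNorm_tsum_le _
        (fun i => (hm _).const_mul _) hδ).trans_eq ?_)
      · filter_upwards [ae_restrict_mem hJ] with t ht
        rw [enorm_eq_self, enorm_eq_self, (h t ht).blockNorm_eq L hp]
        exact eLpNorm_hat_mul_le L hp (h t ht).aestronglyMeasurable.aemeasurable j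
      · refine tsum_congr fun i => ?_
        rw [eLpNorm_const_mul_ennreal _ _ (hm _).aemeasurable (zero_lt_one.trans_le hδ).ne'])
  refine h1.trans_eq ?_
  rw [mul_assoc, spaceTimeNorm, ← eLpNorm_const_mul_count (zero_lt_one.trans_le hr).ne' L.hatBound]
  congr 2
  ext j
  ring

theorem spaceTimeNorm_le_cheminLernerNorm (L : LittlewoodPaley) (hp : 1 ≤ p) (hr : 1 ≤ r)
    {δ : ℝ≥0∞} (hδ : 1 ≤ δ) (s : ℝ) {J : Set ℝ} (hJ : MeasurableSet J) {u : ℝ → Sh}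
    {V : ℝ → R3 → ℂ} (hV : Measurable (Function.uncurry V))
    (h : ∀ t ∈ J, IsFourierTransform (u t) (V t)) :
    spaceTimeNorm p r δ s J (fun t ξ => ‖V t ξ‖ₑ) ≤
      shiftConst s * cheminLernerNorm L δ s p r J u := by
  refine weighted_shift_le (r := r) hr s fun j => ?_
  -- Measurability in time of the block norms of `u` is not known a priori; on `J` they coincide
  -- with this expression in the jointly measurable `V`.
  have hm : ∀ k, Measurable fun t => eLpNorm (fun ξ => ‖L.hat k ξ * V t ξ‖ₑ) p volume := fun k =>
    measurable_eLpNorm_section (F := fun t ξ => ‖L.hat k ξ * V t ξ‖ₑ)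
      (((L.contDiff_hat k).continuous.measurable.comp measurable_snd).mul hV).enorm p volume
  have hae : ∀ k, (fun t => blockNorm L p k (u t)) =ᵐ[volume.restrict J]
      fun t => eLpNorm (fun ξ => ‖L.hat k ξ * V t ξ‖ₑ) p volume := fun k => by
    filter_upwards [ae_restrict_mem hJ] with t ht
    rw [(h t ht).blockNorm_eq L hp, eLpNorm_enorm]
  simp_rw [fun k => eLpNorm_congr_ae (p := δ) (hae k)]
  refine le_trans (eLpNorm_mono_enorm_ae ?_) (eLpNorm_tsum_le _ (fun i : Fin 3 => hm _) hδ)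
  filter_upwards [ae_restrict_mem hJ] with t ht
  simp only [enorm_eq_self, eLpNorm_enorm]
  exact annNorm_le_sum_hat L hp (h t ht).aestronglyMeasurable.aemeasurable j

end PrimitiveEq

namespace PrimitiveEq

variable {p r : ℝ≥0∞}

/-! ### Existence of Fourier transforms and of distributions -/

/-- The transform of a block gives zero on test functions that vanish on the support of the
multiplier. Representatives may thus be truncated to these shells, which makes their sum over `j`
locally finite off the origin. -/
theorem blockHat_rep_ae_eq_zero (L : LittlewoodPaley) (hp : 1 ≤ p) {u : Sh} {j : ℤ} {f : R3 → ℂ}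
    (hf : MemLp f p volume) (hu : ∀ φ : 𝓢(R3, ℂ), blockHat L j u φ = ∫ ξ, φ ξ * f ξ) :
    ∀ᵐ ξ : R3, ξ ∉ tsupport (L.hat j) → f ξ = 0 := by
  have hopen : IsOpen (tsupport (L.hat j))ᶜ := (isClosed_tsupport _).isOpen_compl
  refine hopen.ae_eq_zero_of_integral_contDiff_smul_eq_zero
    ((hf.locallyIntegrable hp).locallyIntegrableOn _) fun φ hφ hc hs => ?_
  obtain ⟨U, rfl⟩ := Submodule.Quotient.mk_surjective _ u
  have h1 := hu (schwartzOfReal hφ hc)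
  have h2 : SchwartzMap.smulLeftCLM ℂ (L.hat j) (schwartzOfReal hφ hc) = 0 := by
    ext ξ
    rw [SchwartzMap.smulLeftCLM_apply_apply (L.hasTemperateGrowth_hat j), schwartzOfReal_apply]
    by_cases h : ξ ∈ tsupport (L.hat j)
    · have : φ ξ = 0 := by
        by_contra hne
        exact hs (subset_tsupport _ hne) h
      simp [this]
    · simp [image_eq_zero_of_notMem_tsupport h]
  rw [fourier_dyadicBlock_apply, h2, map_zero] at h1
  simp only [schwartzOfReal_apply] at h1
  simpa only [Complex.real_smul] using h1.symm

theorem exists_finset_of_isCompact {K : Set R3} (hK : IsCompact K) (h0 : (0 : R3) ∉ K) :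
    ∃ S : Finset ℤ, ∀ ξ ∈ K, ∀ j ∉ S, ¬ (3 / 4 * 2 ^ j ≤ ‖ξ‖ ∧ ‖ξ‖ ≤ 8 / 3 * (2 : ℝ) ^ j) := by
  obtain ⟨b, hb⟩ := hK.isBounded.exists_norm_le
  obtain ⟨a, ha, haK⟩ := Metric.isOpen_iff.1 hK.isClosed.isOpen_compl 0 h0
  obtain ⟨n, hn⟩ := pow_unbounded_of_one_lt (4 / 3 * b) (one_lt_two : (1 : ℝ) < 2)
  obtain ⟨m, hm⟩ := exists_pow_lt_of_lt_one (show (0 : ℝ) < 3 / 8 * a by positivity)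
    (show (1 / 2 : ℝ) < 1 by norm_num)
  refine ⟨Finset.Icc (-m) n, fun ξ hξ j hj h => hj (Finset.mem_Icc.2 ⟨?_, ?_⟩)⟩
  · have h1 : a ≤ ‖ξ‖ := by
      by_contra hlt
      exact haK (by simpa using hlt) hξ
    have h2 : (2 : ℝ) ^ (-(m : ℤ)) < 2 ^ j := by
      rw [zpow_neg, zpow_natCast, ← one_div, ← one_div_pow]; linarith [h.2]
    exact ((zpow_lt_zpow_iff_right₀ (one_lt_two : (1 : ℝ) < 2)).1 h2).le
  · have h2 : (2 : ℝ) ^ j < 2 ^ (n : ℤ) := by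
      rw [zpow_natCast]; linarith [h.1, hb ξ hξ]
    exact ((zpow_lt_zpow_iff_right₀ (one_lt_two : (1 : ℝ) < 2)).1 h2).le

/-- Finiteness of the norm makes the transform of each block an `L^p` function. The sum of these
functions, truncated to their shells, is the transform of `u`, since near a compact set off the
origin only finitely many blocks contribute. -/
theorem exists_isFourierTransform_of_memFB (L : LittlewoodPaley) (hp : 1 ≤ p) (hr : r ≠ 0) {s : ℝ}
    {u : Sh} (hu : MemFB L s p r u) : ∃ f, IsFourierTransform u f := by
  have hblock : ∀ j, ∃ f, MemLp f p volume ∧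
      ∀ φ : 𝓢(R3, ℂ), blockHat L j u φ = ∫ ξ, φ ξ * f ξ := by
    intro j
    have h1 := (le_eLpNorm_count (fun j : ℤ => (2 : ℝ≥0∞) ^ ((j : ℝ) * s) * blockNorm L p j u)
      hr j).trans_lt hu
    have h2 : blockNorm L p j u < ∞ := by
      by_contra h
      rw [not_lt, top_le_iff] at h
      rw [h, ENNReal.mul_top (two_rpow_ne_zero _)] at h1
      exact h1.ne rfl
    simp only [blockNorm, distLpNorm, iInf_lt_iff] at h2
    obtain ⟨f, hf, hU, -⟩ := h2
    exact ⟨f, hf, hU⟩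
  choose F hF hFU using hblock
  set R : ℤ → Set R3 := fun j => tsupport (L.hat j) with hR
  have hRm : ∀ j, MeasurableSet (R j) := fun j => (isClosed_tsupport _).measurableSet
  have hFR : ∀ j, (R j).indicator (F j) =ᵐ[volume] F j := by
    intro j
    filter_upwards [blockHat_rep_ae_eq_zero L hp (hF j) (hFU j)] with ξ hξ
    by_cases h : ξ ∈ R j
    · rw [indicator_of_mem h]
    · rw [indicator_of_notMem h, hξ h]
  have hsum : ∀ K : Set R3, IsCompact K → (0 : R3) ∉ K → ∃ S : Finset ℤ, ∀ ξ ∈ K,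
      ∑' j, (R j).indicator (F j) ξ = ∑ j ∈ S, (R j).indicator (F j) ξ ∧
      ∀ j ∉ S, L.hat j ξ = 0 := by
    intro K hK h0
    obtain ⟨S, hS⟩ := exists_finset_of_isCompact hK h0
    have hS' : ∀ ξ ∈ K, ∀ j ∉ S, ξ ∉ R j := fun ξ hξ j hj h =>
      hS ξ hξ j hj (L.norm_bounds_of_mem_tsupport_hat h)
    refine ⟨S, fun ξ hξ => ⟨tsum_eq_sum fun j hj => ?_, fun j hj => ?_⟩⟩
    · exact indicator_of_notMem (hS' ξ hξ j hj) _
    · exact image_eq_zero_of_notMem_tsupport (hS' ξ hξ j hj)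
  have hloc : ∀ j, LocallyIntegrable ((R j).indicator (F j)) := fun j =>
    ((hF j).locallyIntegrable hp).indicator (hRm j)
  have hf : LocallyIntegrableOn (fun ξ => ∑' j, (R j).indicator (F j) ξ) {0}ᶜ volume := by
    rw [locallyIntegrableOn_iff isOpen_compl_singleton.isLocallyClosed]
    intro K hK0 hK
    obtain ⟨S, hS⟩ := hsum K hK (fun h => hK0 h rfl)
    have h1 : IntegrableOn (fun ξ => ∑ j ∈ S, (R j).indicator (F j) ξ) K :=
      integrable_finsetSum _ fun j _ => (hloc j).integrableOn_isCompact hK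
    exact h1.congr_fun (fun ξ hξ => (hS ξ hξ).1.symm) hK.measurableSet
  obtain ⟨U, rfl⟩ := Submodule.Quotient.mk_surjective _ u
  refine ⟨_, hf, U, rfl, fun φ hφ => ?_⟩
  obtain ⟨S, hS⟩ := hsum (tsupport φ) hφ.1 hφ.2
  have hzero : ∀ ξ ∉ tsupport φ, φ ξ = 0 := fun ξ => image_eq_zero_of_notMem_tsupport
  -- The partition of unity applied to the test function: on its support only the indices in `S` are
  -- active, so the identity is a finite sum and may be inserted into the distribution.
  have h1 : φ = ∑ j ∈ S, SchwartzMap.smulLeftCLM ℂ (L.hat j) φ := by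
    ext ξ
    rw [sum_apply]
    simp_rw [fun j => SchwartzMap.smulLeftCLM_apply_apply (L.hasTemperateGrowth_hat j) φ ξ,
      smul_eq_mul]
    by_cases h : ξ ∈ tsupport φ
    · have h0 : ξ ≠ 0 := fun h' => hφ.2 (h' ▸ h)
      have h2 : HasSum (fun j => L.hat j ξ) (∑ j ∈ S, L.hat j ξ) :=
        hasSum_sum_of_ne_finset_zero fun j hj => (hS ξ h).2 j hj
      rw [← Finset.sum_mul, h2.unique (L.partition ξ h0), one_mul]
    · simp [hzero ξ h]
  have h2 : ∀ ξ, φ ξ * ∑' j, (R j).indicator (F j) ξ = ∑ j ∈ S, φ ξ * (R j).indicator (F j) ξ := by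
    intro ξ
    by_cases h : ξ ∈ tsupport φ
    · rw [(hS ξ h).1, Finset.mul_sum]
    · simp [hzero ξ h]
  simp_rw [h2]
  rw [integral_finsetSum]
  swap
  · exact fun j _ => hφ.integrable_mul ((hloc j).locallyIntegrableOn _)
  nth_rw 1 [h1]
  rw [map_sum]
  refine Finset.sum_congr rfl fun j _ => ?_
  rw [← fourier_dyadicBlock_apply, hFU]
  refine integral_congr_ae ?_
  filter_upwards [hFR j] with ξ hξ
  rw [hξ]

theorem two_rpow_eq_ofReal (x : ℝ) : (2 : ℝ≥0∞) ^ x = ENNReal.ofReal (2 ^ x) := by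
  rw [← ENNReal.ofReal_rpow_of_pos two_pos, ENNReal.ofReal_ofNat]

theorem tsum_int_half_pow_lt_top : ∑' j : ℤ, (2 : ℝ≥0∞) ^ (-|(j : ℝ)|) < ∞ := by
  have h : Summable fun j : ℤ => (2 : ℝ) ^ (-|(j : ℝ)|) := by
    have h1 : Summable fun n : ℕ => (2 : ℝ) ^ (-(n : ℝ)) := by
      have : (fun n : ℕ => (2 : ℝ) ^ (-(n : ℝ))) = fun n : ℕ => (1 / 2 : ℝ) ^ n := by
        ext n
        rw [Real.rpow_neg two_pos.le, Real.rpow_natCast, one_div, inv_pow]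
      rw [this]
      exact summable_geometric_two
    refine Summable.of_nat_of_neg ?_ ?_ <;> simpa using h1
  have h2 := h.tsum_ofReal_lt_top
  refine lt_of_eq_of_lt (tsum_congr fun j => ?_) h2
  rw [two_rpow_eq_ofReal]

theorem lintegral_eq_tsum_annulus (f : R3 → ℝ≥0∞) :
    ∫⁻ ξ, f ξ = ∑' j, ∫⁻ ξ in annulus j, f ξ := by
  have h : (⋃ j, annulus j) =ᵐ[volume] univ := by
    rw [ae_eq_univ]
    refine measure_mono_null (t := {0}) (fun ξ hξ => ?_) (by simp)
    by_contra h0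
    obtain ⟨j, hj⟩ := exists_mem_annulus h0
    exact hξ (mem_iUnion.2 ⟨j, hj⟩)
  rw [← setLIntegral_univ, ← setLIntegral_congr h,
    lintegral_iUnion measurableSet_annulus]
  intro i j hij
  exact Set.disjoint_left.2 fun ξ hi hj => hij (eq_of_mem_annulus hi hj)

/-- At the critical order Bernstein's inequality bounds the integral over the annulus `j` by `2^j`
times the norm. The weight is at most `min (1, 4^(-j)) = 2^(-j-|j|)`, which leaves the summable
factor `2^(-|j|)`. -/
theorem lintegral_weight_le (hp : 1 ≤ p) (hr : r ≠ 0) {f : R3 → ℝ≥0∞} (hf : AEMeasurable f) :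
    ∫⁻ ξ, ENNReal.ofReal ((1 + ‖ξ‖ ^ 2)⁻¹) * f ξ ≤
      bernsteinConst p * (∑' j : ℤ, (2 : ℝ≥0∞) ^ (-|(j : ℝ)|)) * spaceNorm p r (critIndex p) f := by
  rw [lintegral_eq_tsum_annulus, mul_assoc, mul_comm (∑' j : ℤ, _), ← mul_assoc,
    ← ENNReal.tsum_mul_left]
  refine ENNReal.tsum_le_tsum fun j => ?_
  have hw : ∀ ξ ∈ annulus j, ENNReal.ofReal ((1 + ‖ξ‖ ^ 2)⁻¹) ≤ 2 ^ (-(j : ℝ) - |(j : ℝ)|) := by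
    intro ξ hξ
    rw [two_rpow_eq_ofReal]
    refine ENNReal.ofReal_le_ofReal ?_
    have hsq : 0 ≤ ‖ξ‖ ^ 2 := by positivity
    rcases le_total 0 (j : ℝ) with h | h
    · rw [abs_of_nonneg h]
      have e : -(j : ℝ) - j = -(j * 2) := by ring
      rw [e, Real.rpow_neg two_pos.le, Real.rpow_mul two_pos.le, Real.rpow_intCast]
      refine inv_anti₀ (by positivity) ?_
      have := pow_le_pow_left₀ (by positivity) hξ.1 2
      norm_num at this ⊢
      linarith
    · rw [abs_of_nonpos h, sub_neg_eq_add, neg_add_cancel, Real.rpow_zero]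
      exact inv_le_one_of_one_le₀ (by linarith)
  have h1 : ∫⁻ ξ in annulus j, ENNReal.ofReal ((1 + ‖ξ‖ ^ 2)⁻¹) * f ξ ≤
      2 ^ (-(j : ℝ) - |(j : ℝ)|) * ∫⁻ ξ in annulus j, f ξ := by
    rw [← lintegral_const_mul'' _ hf.restrict]
    refine setLIntegral_mono_ae' (measurableSet_annulus j) (ae_of_all _ fun ξ hξ => ?_)
    exact mul_le_mul_left (hw ξ hξ) _
  refine h1.trans ((mul_le_mul_right (lintegral_annulus_le hp j hf) _).trans ?_)
  have h2 := le_eLpNorm_count (fun j : ℤ => (2 : ℝ≥0∞) ^ ((j : ℝ) * critIndex p) * annNorm p j f)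
    hr j
  have h3 : (2 : ℝ≥0∞) ^ (-(j : ℝ) - |(j : ℝ)|) * 2 ^ ((j : ℝ) * (critIndex p + 1)) =
      2 ^ (-|(j : ℝ)|) * 2 ^ ((j : ℝ) * critIndex p) := by
    simp only [← two_rpow_add]; congr 1; ring
  calc _ = bernsteinConst p * ((2 : ℝ≥0∞) ^ (-(j : ℝ) - |(j : ℝ)|) *
        2 ^ ((j : ℝ) * (critIndex p + 1))) * annNorm p j f := by ring
    _ = bernsteinConst p * (2 ^ ((j : ℝ) * critIndex p) * annNorm p j f) * 2 ^ (-|(j : ℝ)|) := by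
        rw [h3]; ring
    _ ≤ _ := by
        refine mul_le_mul_left (mul_le_mul_right h2 _) _

/-- A function of finite critical norm is the Fourier transform of a tempered distribution. -/
theorem exists_sh_of_spaceNorm_lt_top (hp : 1 ≤ p) (hr : r ≠ 0) {f : R3 → ℂ}
    (hf : AEStronglyMeasurable f volume)
    (hfin : spaceNorm p r (critIndex p) (fun ξ => ‖f ξ‖ₑ) < ∞) :
    ∃ u : Sh, IsFourierTransform u f := by
  have hw0 : ∀ ξ : R3, (1 + ‖ξ‖ ^ 2 : ℝ) ≠ 0 := fun ξ => by positivity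
  -- Division by `1 + |ξ|²` makes `f` integrable. The tempered distribution is then the product of a
  -- polynomial and an `L^1` function, to which the inverse Fourier transform is applied.
  set g : R3 → ℂ := fun ξ => (((1 + ‖ξ‖ ^ 2)⁻¹ : ℝ) : ℂ) * f ξ with hg
  have hcont : Continuous fun ξ : R3 => (((1 + ‖ξ‖ ^ 2)⁻¹ : ℝ) : ℂ) :=
    Complex.continuous_ofReal.comp ((by fun_prop : Continuous fun ξ : R3 => 1 + ‖ξ‖ ^ 2).inv₀ hw0)
  have hgi : Integrable g := by
    refine ⟨hcont.aestronglyMeasurable.mul hf, ?_⟩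
    have h1 := lintegral_weight_le hp hr (f := fun ξ => ‖f ξ‖ₑ) hf.enorm
    refine lt_of_le_of_lt (le_of_eq_of_le (lintegral_congr fun ξ => ?_) h1)
      (ENNReal.mul_lt_top (ENNReal.mul_lt_top (bernsteinConst_ne_top hp).lt_top
        tsum_int_half_pow_lt_top) hfin)
    rw [hg, enorm_mul, ← ofReal_norm, Complex.norm_real, Real.norm_of_nonneg (by positivity)]
  have hfg : ∀ ξ, f ξ = ((1 + ‖ξ‖ ^ 2 : ℝ) : ℂ) * g ξ := fun ξ => by
    rw [hg, ← mul_assoc, ← Complex.ofReal_mul, mul_inv_cancel₀ (hw0 ξ), Complex.ofReal_one, one_mul]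
  have hloc : LocallyIntegrable f := by
    have := hgi.locallyIntegrable.continuous_mul (g := fun ξ : R3 => ((1 + ‖ξ‖ ^ 2 : ℝ) : ℂ))
      (by fun_prop)
    exact this.congr (ae_of_all _ fun ξ => (hfg ξ).symm)
  have hwt : (fun ξ : R3 => ((1 + ‖ξ‖ ^ 2 : ℝ) : ℂ)).HasTemperateGrowth := by fun_prop
  have hone : Fact ((1 : ℝ≥0∞) ≤ 1) := ⟨le_rfl⟩
  set W : 𝓢'(R3, ℂ) := TemperedDistribution.smulLeftCLM ℂ
    (fun ξ : R3 => ((1 + ‖ξ‖ ^ 2 : ℝ) : ℂ)) (Lp.toTemperedDistribution hgi.toL1) with hW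
  refine ⟨Sh.mk (𝓕⁻ W), hloc.locallyIntegrableOn _, 𝓕⁻ W, rfl, fun φ _ => ?_⟩
  rw [FourierTransform.fourier_fourierInv_eq, hW, TemperedDistribution.smulLeftCLM_apply_apply,
    Lp.toTemperedDistribution_apply]
  refine integral_congr_ae ?_
  filter_upwards [hgi.coeFn_toL1] with ξ hξ
  rw [hξ, SchwartzMap.smulLeftCLM_apply_apply hwt, hfg ξ]
  simp only [smul_eq_mul]
  ring

end PrimitiveEq

namespace PrimitiveEq

/-! ### Matrix exponentials -/

section MatrixExp

open scoped Matrix.Norms.Operator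

variable {n : Type*} [Fintype n] [DecidableEq n]

theorem norm_matrix_exp_le [Nonempty n] (A : Matrix n n ℂ) :
    ‖NormedSpace.exp A‖ ≤ Real.exp ‖A‖ := by
  have h1 := NormedSpace.exp_series_hasSum_exp' (𝕂 := ℂ) A
  have h2 := NormedSpace.exp_series_hasSum_exp' (𝕂 := ℝ) ‖A‖
  rw [← Real.exp_eq_exp_ℝ] at h2
  have h3 := tsum_of_norm_bounded (f := fun k : ℕ => ((k.factorial : ℂ)⁻¹) • A ^ k) h2 fun k => by
    rw [norm_smul, norm_inv, Complex.norm_natCast, smul_eq_mul]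
    gcongr
    exact norm_pow_le A k
  rw [h1.tsum_eq] at h3
  exact h3

theorem norm_matrix_exp_smul_sub_le [Nonempty n] (B : Matrix n n ℂ) {b R : ℝ} (hB : ‖B‖ ≤ b)
    {t t' : ℝ} (ht : t ∈ Icc 0 R) (ht' : t' ∈ Icc 0 R) :
    ‖NormedSpace.exp (-(t : ℂ) • B) - NormedSpace.exp (-(t' : ℂ) • B)‖ ≤
      Real.exp (R * b) * b * |t - t'| := by
  have hb : 0 ≤ b := (norm_nonneg _).trans hB
  have hder : ∀ s ∈ Icc (0 : ℝ) R, HasDerivWithinAt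
      (fun s : ℝ => NormedSpace.exp (s • (-B))) (NormedSpace.exp (s • (-B)) * (-B)) (Icc 0 R) s :=
    fun s _ => (hasDerivAt_exp_smul_const (𝕂 := ℝ) (-B) s).hasDerivWithinAt
  have hbound : ∀ s ∈ Icc (0 : ℝ) R, ‖NormedSpace.exp (s • (-B)) * (-B)‖ ≤ Real.exp (R * b) * b := by
    intro s hs
    refine (norm_mul_le _ _).trans ?_
    rw [norm_neg]
    gcongr
    refine (norm_matrix_exp_le _).trans (Real.exp_le_exp.2 ?_)
    rw [norm_smul, norm_neg, Real.norm_of_nonneg hs.1]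
    exact mul_le_mul hs.2 hB (norm_nonneg _) (hs.1.trans hs.2)
  have h := (convex_Icc (0 : ℝ) R).norm_image_sub_le_of_norm_hasDerivWithin_le hder hbound ht' ht
  have e : ∀ s : ℝ, -(s : ℂ) • B = s • (-B) := fun s => by
    ext i j; simp
  rw [e, e]
  simpa [Real.norm_eq_abs] using h

/-- Only the zeroth term of the exponential series survives. Applied to `x = ξ`, this gives
conservation of the divergence-free condition. -/
theorem vecMul_exp_of_vecMul_eq_zero (x : n → ℂ) (A : Matrix n n ℂ) (h : x ᵥ* A = 0) :
    x ᵥ* NormedSpace.exp A = x := by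
  have h1 := NormedSpace.exp_series_hasSum_exp' (𝕂 := ℂ) A
  have hc : Continuous fun M : Matrix n n ℂ => x ᵥ* M :=
    Continuous.matrix_vecMul continuous_const continuous_id
  have h2 := h1.map (g := (Matrix.vecMulBilin ℂ ℂ x : Matrix n n ℂ →ₗ[ℂ] n → ℂ)) hc
  have h3 : HasSum ((Matrix.vecMulBilin ℂ ℂ x : Matrix n n ℂ →ₗ[ℂ] n → ℂ) ∘
      fun k : ℕ => ((k.factorial : ℂ)⁻¹) • A ^ k) (x ᵥ* (((Nat.factorial 0 : ℂ)⁻¹) • A ^ 0)) := by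
    refine hasSum_single 0 fun k hk => ?_
    obtain ⟨m, rfl⟩ := Nat.exists_eq_succ_of_ne_zero hk
    change x ᵥ* (_ • A ^ (m + 1)) = 0
    rw [Matrix.vecMul_smul, pow_succ', ← Matrix.vecMul_vecMul, h, Matrix.zero_vecMul, smul_zero]
  have h4 := h2.unique h3
  exact h4.trans (by simp)

theorem measurable_matrix_exp_entry {Z : Type*} [MeasurableSpace Z] {f : Z → Matrix n n ℂ}
    (hf : ∀ i j, Measurable fun z => f z i j) (i j : n) :
    Measurable fun z => NormedSpace.exp (f z) i j := by
  have h1 : Measurable fun z => (fun i j => f z i j : n → n → ℂ) :=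
    measurable_pi_iff.2 fun i => measurable_pi_iff.2 fun j => hf i j
  have h2 : Continuous fun M : n → n → ℂ => NormedSpace.exp (Matrix.of M) i j :=
    (continuous_apply_apply i j).comp
      (NormedSpace.exp_continuous (𝔸 := Matrix n n ℂ))
  exact h2.measurable.comp h1

end MatrixExp

/-! ### The semigroup -/

theorem freq_castSucc (ξ : R3) (k : Fin 3) : freq ξ k.castSucc = ξ k := Fin.snoc_castSucc ..

theorem freq_last (ξ : R3) : freq ξ (Fin.last 3) = 0 := Fin.snoc_last ..

theorem sum_freq_mul_freq (ξ : R3) : ∑ a, freq ξ a * freq ξ a = ‖ξ‖ ^ 2 := by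
  rw [Fin.sum_univ_castSucc, freq_last, EuclideanSpace.norm_sq_eq]
  simp [freq_castSucc, sq]

theorem abs_freq_le (ξ : R3) (a : Fin 4) : |freq ξ a| ≤ ‖ξ‖ := by
  induction a using Fin.lastCases with
  | last => rw [freq_last, abs_zero]; positivity
  | cast k => rw [freq_castSucc]; exact PiLp.norm_apply_le ξ k

theorem measurable_freq (a : Fin 4) : Measurable fun ξ : R3 => freq ξ a := by
  induction a using Fin.lastCases with
  | last => simp only [freq_last]; exact measurable_const
  | cast k => simp only [freq_castSucc]; fun_prop

theorem norm_helmholtz_apply_le (ξ : R3) (a b : Fin 4) : ‖helmholtz ξ a b‖ ≤ 2 := by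
  rw [helmholtz, Matrix.of_apply]
  refine (norm_sub_le _ _).trans ?_
  have h1 : ‖(if a = b then 1 else 0 : ℂ)‖ ≤ 1 := by split_ifs <;> simp
  have h2 : ‖((freq ξ a * freq ξ b / ‖ξ‖ ^ 2 : ℝ) : ℂ)‖ ≤ 1 := by
    rw [Complex.norm_real, Real.norm_eq_abs, abs_div, abs_mul, abs_of_nonneg (sq_nonneg ‖ξ‖), sq]
    refine div_le_one_of_le₀ ?_ (by positivity)
    exact mul_le_mul (abs_freq_le ξ a) (abs_freq_le ξ b) (abs_nonneg _) (norm_nonneg _)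
  linarith

theorem measurable_helmholtz (a b : Fin 4) : Measurable fun ξ => helmholtz ξ a b := by
  simp only [helmholtz, Matrix.of_apply]
  have := measurable_freq
  fun_prop

theorem freq_vecMul_helmholtz (ξ : R3) : (fun a => (freq ξ a : ℂ)) ᵥ* helmholtz ξ = 0 := by
  ext b
  have h : ∑ a, freq ξ a * (freq ξ a * freq ξ b / ‖ξ‖ ^ 2) = freq ξ b := by
    have e : ∀ a, freq ξ a * (freq ξ a * freq ξ b / ‖ξ‖ ^ 2) =
        freq ξ a * freq ξ a * (freq ξ b / ‖ξ‖ ^ 2) := fun a => by ring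
    simp_rw [e]
    rw [← Finset.sum_mul, sum_freq_mul_freq]
    -- At the origin division by zero makes the projection the identity; the claim survives because
    -- the frequency vector vanishes there.
    rcases eq_or_ne ξ 0 with rfl | h0
    · have : freq 0 b = 0 := by simpa using abs_freq_le 0 b
      simp [this]
    · have : ‖ξ‖ ≠ 0 := norm_ne_zero_iff.2 h0
      field_simp
  have hC : ∑ a, (freq ξ a : ℂ) * ((freq ξ a * freq ξ b / ‖ξ‖ ^ 2 : ℝ) : ℂ) = freq ξ b := by
    exact_mod_cast congrArg (fun x : ℝ => (x : ℂ)) h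
  simp only [Matrix.vecMul, dotProduct, helmholtz, Matrix.of_apply, mul_sub, Finset.sum_sub_distrib,
    hC]
  simp

theorem conjTranspose_helmholtz (ξ : R3) : (helmholtz ξ)ᴴ = helmholtz ξ := by
  ext a b
  simp only [Matrix.conjTranspose_apply, helmholtz, Matrix.of_apply, star_sub]
  congr 1
  · simp [eq_comm, apply_ite]
  · rw [RCLike.star_def, Complex.conj_ofReal, mul_comm]

/-- The generator of the semigroup without the viscous part. -/
noncomputable def couplingSymbol (g Ω N : ℝ) (ξ : R3) : Matrix (Fin 4) (Fin 4) ℂ :=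
  helmholtz ξ * couplingMatrix g Ω N * helmholtz ξ

theorem diagonal_const (ν : ℂ) : Matrix.diagonal ![ν, ν, ν, ν] = ν • (1 : Matrix (Fin 4) (Fin 4) ℂ) := by
  ext i j
  fin_cases i <;> fin_cases j <;> simp

theorem semigroup_eq (ν g Ω N t : ℝ) (ξ : R3) :
    semigroup ν ν g Ω N t ξ = NormedSpace.exp (-(t : ℂ) •
      (((4 * Real.pi ^ 2 * ν * ‖ξ‖ ^ 2 : ℝ) : ℂ) • (1 : Matrix (Fin 4) (Fin 4) ℂ) +
        couplingSymbol g Ω N ξ)) := by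
  rw [semigroup, diagonal_const, smul_smul, couplingSymbol]
  congr 5
  push_cast
  ring

/-- With Prandtl number one the viscous part is a scalar matrix and commutes with the coupling, so
the exponential factors into heat decay and a part independent of the viscosity. -/
theorem semigroup_eq_smul (ν g Ω N t : ℝ) (ξ : R3) :
    semigroup ν ν g Ω N t ξ = ((Real.exp (-(4 * Real.pi ^ 2 * ν * ‖ξ‖ ^ 2 * t)) : ℝ) : ℂ) •
      NormedSpace.exp (-(t : ℂ) • couplingSymbol g Ω N ξ) := by
  rw [semigroup_eq, smul_add, smul_smul, Matrix.exp_add_of_commute]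
  swap
  · exact (Commute.one_left _).smul_left _ |>.smul_right _
  have h : NormedSpace.exp ((-(t : ℂ) * ((4 * Real.pi ^ 2 * ν * ‖ξ‖ ^ 2 : ℝ) : ℂ)) •
      (1 : Matrix (Fin 4) (Fin 4) ℂ)) =
      ((Real.exp (-(4 * Real.pi ^ 2 * ν * ‖ξ‖ ^ 2 * t)) : ℝ) : ℂ) • 1 := by
    rw [Matrix.smul_one_eq_diagonal, Matrix.exp_diagonal, Matrix.smul_one_eq_diagonal]
    congr 1
    ext i
    rw [Pi.coe_exp, ← Complex.exp_eq_exp_ℂ]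
    push_cast
    congr 1
    ring
  rw [h, smul_mul_assoc, one_mul]

theorem freq_vecMul_couplingSymbol (g Ω N : ℝ) (ξ : R3) :
    (fun a => (freq ξ a : ℂ)) ᵥ* couplingSymbol g Ω N ξ = 0 := by
  rw [couplingSymbol, ← Matrix.vecMul_vecMul, ← Matrix.vecMul_vecMul, freq_vecMul_helmholtz,
    Matrix.zero_vecMul, Matrix.zero_vecMul]

/-- The semigroup preserves divergence-free vector fields. -/
theorem freq_dotProduct_semigroup (ν g Ω N t : ℝ) (ξ : R3) (x : Fin 4 → ℂ)
    (hx : (fun a => (freq ξ a : ℂ)) ⬝ᵥ x = 0) :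
    (fun a => (freq ξ a : ℂ)) ⬝ᵥ (semigroup ν ν g Ω N t ξ *ᵥ x) = 0 := by
  rw [Matrix.dotProduct_mulVec, semigroup_eq_smul, Matrix.vecMul_smul,
    vecMul_exp_of_vecMul_eq_zero, smul_dotProduct, hx, smul_zero]
  rw [Matrix.vecMul_smul, freq_vecMul_couplingSymbol, smul_zero]

theorem measurable_semigroup (ν g Ω N : ℝ) (a b : Fin 4) :
    Measurable fun z : ℝ × R3 => semigroup ν ν g Ω N z.1 z.2 a b := by
  simp only [semigroup_eq]
  refine measurable_matrix_exp_entry (f := fun z : ℝ × R3 => -(z.1 : ℂ) •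
    (((4 * Real.pi ^ 2 * ν * ‖z.2‖ ^ 2 : ℝ) : ℂ) • (1 : Matrix (Fin 4) (Fin 4) ℂ) +
      couplingSymbol g Ω N z.2)) (fun i j => ?_) a b
  have h : Measurable fun ξ => couplingSymbol g Ω N ξ i j := by
    simp only [couplingSymbol, Matrix.mul_apply]
    have := measurable_helmholtz
    fun_prop
  simp only [Matrix.smul_apply, Matrix.add_apply, smul_eq_mul]
  have h' : Measurable fun z : ℝ × R3 => couplingSymbol g Ω N z.2 i j := h.comp measurable_snd
  fun_prop

section Norms

open scoped Matrix.Norms.Operator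

theorem linfty_opNorm_le_of_entries {A : Matrix (Fin 4) (Fin 4) ℂ} {c : ℝ}
    (h : ∀ a b, ‖A a b‖ ≤ c) : ‖A‖ ≤ 4 * c := by
  have hc : 0 ≤ c := (norm_nonneg _).trans (h 0 0)
  rw [Matrix.linfty_opNorm_def, ← Real.coe_toNNReal (4 * c) (by positivity), NNReal.coe_le_coe]
  refine Finset.sup_le fun i _ => ?_
  rw [← NNReal.coe_le_coe, Real.coe_toNNReal (4 * c) (by positivity)]
  push_cast
  refine (Finset.sum_le_card_nsmul _ _ c fun b _ => h i b).trans_eq ?_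
  simp

theorem norm_helmholtz_le (ξ : R3) : ‖helmholtz ξ‖ ≤ 8 :=
  (linfty_opNorm_le_of_entries (norm_helmholtz_apply_le ξ)).trans (by norm_num)

theorem norm_couplingSymbol_le (g Ω N : ℝ) (ξ : R3) :
    ‖couplingSymbol g Ω N ξ‖ ≤ 64 * ‖couplingMatrix g Ω N‖ := by
  have h := norm_helmholtz_le ξ
  calc ‖couplingSymbol g Ω N ξ‖ ≤ ‖helmholtz ξ‖ * ‖couplingMatrix g Ω N‖ * ‖helmholtz ξ‖ :=
        (norm_mul_le _ _).trans (mul_le_mul_of_nonneg_right (norm_mul_le _ _) (norm_nonneg _))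
    _ ≤ 8 * ‖couplingMatrix g Ω N‖ * 8 := by gcongr
    _ = _ := by ring

/-- On dyadic annuli the semigroup is Lipschitz continuous in time. -/
theorem exists_semigroup_lipschitz (ν g Ω N : ℝ) (hν : 0 ≤ ν) (j : ℤ) (R : ℝ) :
    ∃ C : ℝ, 0 ≤ C ∧ ∀ ξ ∈ annulus j, ∀ t ∈ Icc 0 R, ∀ t' ∈ Icc 0 R, ∀ x : Fin 4 → ℂ,
      ‖semigroup ν ν g Ω N t ξ *ᵥ x - semigroup ν ν g Ω N t' ξ *ᵥ x‖ ≤ C * |t - t'| * ‖x‖ := by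
  set b : ℝ := 4 * Real.pi ^ 2 * ν * (2 ^ (j + 1)) ^ 2 + 64 * ‖couplingMatrix g Ω N‖ with hb
  have hb0 : 0 ≤ b := by positivity
  refine ⟨Real.exp (R * b) * b, by positivity, fun ξ hξ t ht t' ht' x => ?_⟩
  rw [← Matrix.sub_mulVec]
  refine (Matrix.linfty_opNorm_mulVec _ _).trans ?_
  gcongr
  rw [semigroup_eq, semigroup_eq]
  refine norm_matrix_exp_smul_sub_le _ ?_ ht ht'
  refine (norm_add_le _ _).trans (add_le_add ?_ (norm_couplingSymbol_le g Ω N ξ))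
  rw [norm_smul, norm_one, mul_one, Complex.norm_real, Real.norm_of_nonneg (by positivity)]
  have := hξ.2.le
  gcongr

end Norms

end PrimitiveEq

namespace PrimitiveEq

/-! ### The weighted norm of the unknowns -/

/-- The weights `(1, 1, 1, c)`. -/
def weight (c : ℝ) : Fin 4 → ℝ := Fin.snoc (α := fun _ => ℝ) (fun _ : Fin 3 => 1) c

theorem weight_castSucc (c : ℝ) (k : Fin 3) : weight c k.castSucc = 1 := Fin.snoc_castSucc ..

theorem weight_last (c : ℝ) : weight c (Fin.last 3) = c := Fin.snoc_last ..

theorem weight_three (c : ℝ) : weight c 3 = c := weight_last c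

theorem freq_three (ξ : R3) : freq ξ 3 = 0 := freq_last ξ

theorem weight_pos {c : ℝ} (hc : 0 < c) (a : Fin 4) : 0 < weight c a := by
  induction a using Fin.lastCases with
  | last => rwa [weight_last]
  | cast k => rw [weight_castSucc]; exact one_pos

/-- Multiplication by the weights. -/
noncomputable def weightMap (c : ℝ) : (Fin 4 → ℂ) →L[ℂ] (Fin 4 → ℂ) :=
  ContinuousLinearMap.pi fun a => (weight c a : ℂ) • ContinuousLinearMap.proj a

theorem weightMap_apply (c : ℝ) (x : Fin 4 → ℂ) (a : Fin 4) :
    weightMap c x a = (weight c a : ℂ) * x a := rfl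

/-- The norm of `(u₁, u₂, u₃, c θ)`. -/
noncomputable def wn (c : ℝ) (x : Fin 4 → ℂ) : ℝ≥0∞ := ‖weightMap c x‖ₑ

theorem continuous_wn (c : ℝ) : Continuous (wn c) := (weightMap c).continuous.enorm

theorem wn_zero (c : ℝ) : wn c 0 = 0 := by simp [wn]

theorem wn_ne_top (c : ℝ) (x : Fin 4 → ℂ) : wn c x ≠ ∞ := enorm_ne_top

theorem wn_add_le (c : ℝ) (x y : Fin 4 → ℂ) : wn c (x + y) ≤ wn c x + wn c y := by
  rw [wn, map_add]; exact enorm_add_le _ _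

theorem wn_neg (c : ℝ) (x : Fin 4 → ℂ) : wn c (-x) = wn c x := by rw [wn, map_neg, enorm_neg, wn]

theorem wn_sub_le (c : ℝ) (x y : Fin 4 → ℂ) : wn c (x - y) ≤ wn c x + wn c y := by
  rw [sub_eq_add_neg, ← wn_neg c y]; exact wn_add_le c x _

theorem wn_integral_le {T : Type*} [MeasurableSpace T] (μ : Measure T) (c : ℝ)
    (f : T → Fin 4 → ℂ) : wn c (∫ t, f t ∂μ) ≤ ∫⁻ t, wn c (f t) ∂μ := by
  by_cases h : Integrable f μ
  · rw [wn, ← ContinuousLinearMap.integral_comp_comm _ h]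
    exact enorm_integral_le_lintegral_enorm _
  · rw [integral_undef h, wn_zero]; exact zero_le

theorem enorm_weight_mul_le (c : ℝ) (x : Fin 4 → ℂ) (a : Fin 4) :
    ‖(weight c a : ℂ) * x a‖ₑ ≤ wn c x := by
  rw [← weightMap_apply, wn, ← ofReal_norm, ← ofReal_norm]
  exact ENNReal.ofReal_le_ofReal (norm_le_pi_norm _ a)

theorem wn_le_iff (c : ℝ) (x : Fin 4 → ℂ) (K : ℝ≥0∞) :
    wn c x ≤ K ↔ ∀ a, ‖(weight c a : ℂ) * x a‖ₑ ≤ K := by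
  refine ⟨fun h a => (enorm_weight_mul_le c x a).trans h, fun h => ?_⟩
  rcases eq_or_ne K ∞ with rfl | hK
  · exact le_top
  rw [wn, ← ofReal_norm, ENNReal.ofReal_le_iff_le_toReal hK,
    pi_norm_le_iff_of_nonneg ENNReal.toReal_nonneg]
  intro a
  rw [← ENNReal.ofReal_le_iff_le_toReal hK, ofReal_norm]
  exact h a

theorem wn_le_sum (c : ℝ) (x : Fin 4 → ℂ) :
    wn c x ≤ (∑ k : Fin 3, ‖x k.castSucc‖ₑ) + ‖(c : ℂ) * x (Fin.last 3)‖ₑ := by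
  rw [wn_le_iff]
  intro a
  have h : ∀ a, ‖(weight c a : ℂ) * x a‖ₑ ≤ ∑ a, ‖(weight c a : ℂ) * x a‖ₑ :=
    fun a => Finset.single_le_sum (f := fun a => ‖(weight c a : ℂ) * x a‖ₑ)
      (fun _ _ => zero_le) (Finset.mem_univ a)
  refine (h a).trans_eq ?_
  rw [Fin.sum_univ_castSucc]
  simp [weight_castSucc, weight_three]

theorem enorm_apply_le_wn {c : ℝ} (hc : 0 < c) (x : Fin 4 → ℂ) (a : Fin 4) :
    ‖x a‖ₑ ≤ ENNReal.ofReal (1 + c⁻¹) * wn c x := by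
  have hw := weight_pos hc a
  have h1 : x a = ((weight c a)⁻¹ : ℝ) * ((weight c a : ℂ) * x a) := by
    rw [← mul_assoc, ← Complex.ofReal_mul, inv_mul_cancel₀ hw.ne', Complex.ofReal_one, one_mul]
  rw [h1, enorm_mul]
  refine mul_le_mul' ?_ (enorm_weight_mul_le c x a)
  rw [← ofReal_norm, Complex.norm_real, Real.norm_of_nonneg (by positivity)]
  refine ENNReal.ofReal_le_ofReal ?_
  have : 0 < c⁻¹ := by positivity
  induction a using Fin.lastCases with
  | last => rw [weight_last]; linarith
  | cast k => rw [weight_castSucc]; simp [this.le]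

theorem eq_zero_of_wn_eq_zero {c : ℝ} (hc : 0 < c) {x : Fin 4 → ℂ} (h : wn c x = 0) : x = 0 := by
  ext a
  have := enorm_apply_le_wn hc x a
  rw [h, mul_zero, nonpos_iff_eq_zero, enorm_eq_zero] at this
  exact this

/-! ### Decay of the semigroup -/

/-- The semigroup decays like the heat semigroup for times in `J`. -/
def DecayBound (ν g Ω N c : ℝ) (M : ℝ≥0∞) (J : Set ℝ) : Prop :=
  ∀ t ∈ J, ∀ (ξ : R3) (x : Fin 4 → ℂ), wn c (semigroup ν ν g Ω N t ξ *ᵥ x) ≤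
    M * (decay (4 * Real.pi ^ 2 * ν * ‖ξ‖ ^ 2) t * wn c x)

section Norms

open scoped Matrix.Norms.Operator

theorem enorm_real_exp_smul {a t : ℝ} (ht : 0 ≤ t) (x : Fin 4 → ℂ) :
    ‖((Real.exp (-(a * t)) : ℝ) : ℂ) • x‖ₑ = decay a t * ‖x‖ₑ := by
  rw [enorm_smul, decay, indicator_of_mem (mem_Ici.2 ht), ← ofReal_norm, Complex.norm_real,
    Real.norm_of_nonneg (Real.exp_pos _).le]

/-- On bounded times the exponential of the norm of the coupling is good enough. No symmetrization
is needed, so `N = 0` is allowed; the constant depends on `g`, `Ω` and `N`, which only shortens the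
local existence time. -/
theorem decayBound_Icc (ν g Ω N : ℝ) : DecayBound ν g Ω N 1
    (ENNReal.ofReal (Real.exp (64 * ‖couplingMatrix g Ω N‖))) (Icc 0 1) := by
  intro t ht ξ x
  have hw : ∀ y : Fin 4 → ℂ, weightMap 1 y = y := fun y => by
    ext a
    induction a using Fin.lastCases with
    | last => simp [weightMap_apply, weight_three]
    | cast k => simp [weightMap_apply, weight_castSucc]
  rw [wn, wn, hw, hw, semigroup_eq_smul, Matrix.smul_mulVec, enorm_real_exp_smul ht.1,
    mul_left_comm]
  refine mul_le_mul_right ?_ _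
  rw [← ofReal_norm, ← ofReal_norm, ← ENNReal.ofReal_mul (by positivity)]
  refine ENNReal.ofReal_le_ofReal ((Matrix.linfty_opNorm_mulVec _ _).trans ?_)
  gcongr
  refine (norm_matrix_exp_le _).trans (Real.exp_le_exp.2 ?_)
  rw [norm_smul, norm_neg, Complex.norm_real, Real.norm_of_nonneg ht.1]
  calc t * ‖couplingSymbol g Ω N ξ‖ ≤ 1 * ‖couplingSymbol g Ω N ξ‖ := by gcongr; exact ht.2
    _ ≤ _ := by rw [one_mul]; exact norm_couplingSymbol_le g Ω N ξ

/-- The projection is block diagonal: it mixes only the velocity components, whose weights are all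
`1`, and it is the identity on the temperature. -/
theorem weight_diagonal_mul_helmholtz (c : ℝ) (ξ : R3) :
    Matrix.diagonal (fun a => (weight c a : ℂ)) * helmholtz ξ =
      helmholtz ξ * Matrix.diagonal (fun a => (weight c a : ℂ)) := by
  ext a b
  rw [Matrix.diagonal_mul, Matrix.mul_diagonal]
  induction a using Fin.lastCases with
  | last =>
    induction b using Fin.lastCases with
    | last => rw [mul_comm]
    | cast k => simp [helmholtz, freq_three, show (3 : Fin 4) ≠ k.castSucc from (Fin.castSucc_lt_last k).ne']
  | cast l =>
    induction b using Fin.lastCases with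
    | last => simp [helmholtz, freq_three, show l.castSucc ≠ (3 : Fin 4) from (Fin.castSucc_lt_last l).ne]
    | cast k => rw [weight_castSucc, weight_castSucc, mul_comm]

/-- The symmetrized coupling matrix. -/
noncomputable def skewCoupling (g Ω N : ℝ) : Matrix (Fin 4) (Fin 4) ℂ :=
  !![0, -(Ω : ℂ), 0, 0;
     (Ω : ℂ), 0, 0, 0;
     0, 0, 0, -((Real.sqrt g * N : ℝ) : ℂ);
     0, 0, ((Real.sqrt g * N : ℝ) : ℂ), 0]

theorem conjTranspose_skewCoupling (g Ω N : ℝ) :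
    (skewCoupling g Ω N)ᴴ = -skewCoupling g Ω N := by
  ext i j
  fin_cases i <;> fin_cases j <;> simp [skewCoupling]

theorem weight_eq (c : ℝ) : (fun a => (weight c a : ℂ)) = ![1, 1, 1, (c : ℂ)] := by
  ext a
  fin_cases a
  · exact congrArg Complex.ofReal (weight_castSucc c 0) |>.trans Complex.ofReal_one
  · exact congrArg Complex.ofReal (weight_castSucc c 1) |>.trans Complex.ofReal_one
  · exact congrArg Complex.ofReal (weight_castSucc c 2) |>.trans Complex.ofReal_one
  · exact congrArg Complex.ofReal (weight_last c)

/-- Rescaling the temperature by `√g / N` balances buoyancy and stratification: both couplings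
acquire strength `√g N`, with opposite signs. -/
theorem weight_diagonal_mul_coupling {g N : ℝ} (Ω : ℝ) (hg : 0 < g) (hN : 0 < N) :
    Matrix.diagonal (fun a => (weight (Real.sqrt g / N) a : ℂ)) * couplingMatrix g Ω N =
      skewCoupling g Ω N * Matrix.diagonal (fun a => (weight (Real.sqrt g / N) a : ℂ)) := by
  have h1 : ((Real.sqrt g / N : ℝ) : ℂ) * (N : ℂ) ^ 2 = ((Real.sqrt g * N : ℝ) : ℂ) := by
    rw [← Complex.ofReal_pow, ← Complex.ofReal_mul]
    congr 1; field_simp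
  have h2 : ((Real.sqrt g * N : ℝ) : ℂ) * ((Real.sqrt g / N : ℝ) : ℂ) = (g : ℂ) := by
    rw [← Complex.ofReal_mul]
    congr 1
    have := Real.mul_self_sqrt hg.le
    field_simp
    nlinarith
  rw [weight_eq]
  ext i j
  rw [Matrix.diagonal_mul, Matrix.mul_diagonal]
  fin_cases i <;> fin_cases j <;> simp [couplingMatrix, skewCoupling]
  · simpa using h2.symm
  · simpa using h1

/-- In the weighted unknowns the generator of the coupling is `P S P` with `P` Hermitian and `S`
skew-Hermitian, so its exponential is unitary. The entries of a unitary matrix are at most `1` in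
modulus, whence the constant `4` for the supremum norm on four components, whatever the parameters.
-/
theorem decayBound_Ici (ν : ℝ) {g N : ℝ} (Ω : ℝ) (hg : 0 < g) (hN : 0 < N) :
    DecayBound ν g Ω N (Real.sqrt g / N) 4 (Ici 0) := by
  intro t ht ξ x
  set c := Real.sqrt g / N with hc
  have hc0 : 0 < c := div_pos (Real.sqrt_pos.2 hg) hN
  set D : Matrix (Fin 4) (Fin 4) ℂ := Matrix.diagonal (fun a => (weight c a : ℂ)) with hD
  have hDw : ∀ y, weightMap c y = D *ᵥ y := fun y => by
    ext a; rw [weightMap_apply, hD, Matrix.mulVec_diagonal]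
  have hDu : IsUnit D := by
    rw [hD, Matrix.isUnit_diagonal, Pi.isUnit_iff]
    intro a
    exact isUnit_iff_ne_zero.2 (by exact_mod_cast (weight_pos hc0 a).ne')
  set A' : Matrix (Fin 4) (Fin 4) ℂ := helmholtz ξ * skewCoupling g Ω N * helmholtz ξ with hA'
  have hDA : D * couplingSymbol g Ω N ξ = A' * D := by
    rw [couplingSymbol, ← mul_assoc, ← mul_assoc, weight_diagonal_mul_helmholtz,
      mul_assoc (helmholtz ξ), weight_diagonal_mul_coupling Ω hg hN, hA', mul_assoc, mul_assoc,
      weight_diagonal_mul_helmholtz, mul_assoc, mul_assoc]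
  have hDE : D * NormedSpace.exp (-(t : ℂ) • couplingSymbol g Ω N ξ) =
      NormedSpace.exp (-(t : ℂ) • A') * D := by
    have h1 := Matrix.exp_conj D (-(t : ℂ) • couplingSymbol g Ω N ξ) hDu
    have hdet : IsUnit D.det := (Matrix.isUnit_iff_isUnit_det D).1 hDu
    rw [mul_smul_comm, hDA, smul_mul_assoc, mul_assoc, Matrix.mul_nonsing_inv _ hdet, mul_one] at h1
    rw [h1, mul_assoc, Matrix.nonsing_inv_mul _ hdet, mul_one]
  have hskew : (-(t : ℂ) • A')ᴴ = -(-(t : ℂ) • A') := by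
    rw [Matrix.conjTranspose_smul, hA',
      Matrix.conjTranspose_mul, Matrix.conjTranspose_mul, conjTranspose_helmholtz,
      conjTranspose_skewCoupling]
    simp [mul_assoc]
  have hU : NormedSpace.exp (-(t : ℂ) • A') ∈ Matrix.unitaryGroup (Fin 4) ℂ := by
    rw [Matrix.mem_unitaryGroup_iff, Matrix.star_eq_conjTranspose, ← Matrix.exp_conjTranspose,
      hskew, Matrix.exp_neg]
    exact Matrix.mul_nonsing_inv _ ((Matrix.isUnit_iff_isUnit_det _).1 (Matrix.isUnit_exp _))
  have hnorm : ‖NormedSpace.exp (-(t : ℂ) • A')‖ ≤ 4 := by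
    have := linfty_opNorm_le_of_entries (A := NormedSpace.exp (-(t : ℂ) • A')) (c := 1)
      (fun a b => entry_norm_bound_of_unitary hU a b)
    simpa using this
  rw [wn, wn, semigroup_eq_smul, Matrix.smul_mulVec, map_smul, enorm_real_exp_smul ht,
    mul_left_comm, hDw, hDw, Matrix.mulVec_mulVec, hDE, ← Matrix.mulVec_mulVec]
  refine mul_le_mul_right ?_ _
  rw [← ofReal_norm, ← ofReal_norm, ← ENNReal.ofReal_ofNat, ← ENNReal.ofReal_mul (by norm_num)]
  refine ENNReal.ofReal_le_ofReal ((Matrix.linfty_opNorm_mulVec _ _).trans ?_)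
  gcongr

end Norms

/-! ### The bilinear term -/

/-- The Fourier transform of `P ∇·(v ⊗ w)`. -/
noncomputable def bilinearTerm (V W : R3 → Fin 4 → ℂ) (ξ : R3) : Fin 4 → ℂ :=
  helmholtz ξ *ᵥ fun b => ∑ a, (2 * Real.pi * Complex.I * (freq ξ a : ℂ)) *
    ∫ η, V (ξ - η) a * W η b

theorem freq_dotProduct_bilinearTerm (V W : R3 → Fin 4 → ℂ) (ξ : R3) :
    (fun a => (freq ξ a : ℂ)) ⬝ᵥ bilinearTerm V W ξ = 0 := by
  rw [bilinearTerm, Matrix.dotProduct_mulVec, freq_vecMul_helmholtz, zero_dotProduct]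

/-- The constant in the pointwise bound of the bilinear term. -/
noncomputable def bilinearConst : ℝ≥0∞ := ENNReal.ofReal (64 * Real.pi)

-- The weights commute with the projection, and only the vector field on the right carries an
-- effective weight. The constant `64 π` is `8` from the projection, `4` from the sum over `a`, and
-- `2π` from the derivative.
open scoped Matrix.Norms.Operator in
theorem wn_bilinearTerm_le (c : ℝ) (V W : R3 → Fin 4 → ℂ) (ξ : R3) :
    wn c (bilinearTerm V W ξ) ≤
      bilinearConst * (‖ξ‖ₑ * conv (fun η => wn c (V η)) (fun η => wn c (W η)) ξ) := by
  set G : Fin 4 → ℂ := fun b => ∑ a, (2 * Real.pi * Complex.I * (freq ξ a : ℂ)) *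
    ∫ η, V (ξ - η) a * W η b with hG
  have h1 : weightMap c (bilinearTerm V W ξ) = helmholtz ξ *ᵥ weightMap c G := by
    have hDw : ∀ y, weightMap c y = Matrix.diagonal (fun a => (weight c a : ℂ)) *ᵥ y := fun y => by
      ext a; rw [weightMap_apply, Matrix.mulVec_diagonal]
    rw [hDw, hDw, bilinearTerm, Matrix.mulVec_mulVec, Matrix.mulVec_mulVec,
      weight_diagonal_mul_helmholtz]
  have h2 : ∀ y : Fin 4 → ℂ, ‖helmholtz ξ *ᵥ y‖ₑ ≤ 8 * ‖y‖ₑ := fun y => by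
    rw [← ofReal_norm, ← ofReal_norm, ← ENNReal.ofReal_ofNat, ← ENNReal.ofReal_mul (by norm_num)]
    refine ENNReal.ofReal_le_ofReal ((Matrix.linfty_opNorm_mulVec _ _).trans ?_)
    gcongr
    exact norm_helmholtz_le ξ
  rw [wn, h1]
  refine (h2 _).trans ?_
  have h3 : wn c G ≤ ENNReal.ofReal (8 * Real.pi) *
      (‖ξ‖ₑ * conv (fun η => wn c (V η)) (fun η => wn c (W η)) ξ) := by
    rw [wn_le_iff]
    intro b
    rw [hG, Finset.mul_sum]
    have hterm : ∀ a, ‖(weight c b : ℂ) * ((2 * Real.pi * Complex.I * (freq ξ a : ℂ)) *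
        ∫ η, V (ξ - η) a * W η b)‖ₑ ≤ ENNReal.ofReal (2 * Real.pi) *
        (‖ξ‖ₑ * conv (fun η => wn c (V η)) (fun η => wn c (W η)) ξ) := by
      intro a
      induction a using Fin.lastCases with
      -- Only velocity components transport, and their weight is `1`. Hence no product of two
      -- temperatures occurs and a single factor `c` has to be absorbed.
      | last => simp [freq_three]
      | cast k =>
        have e : (weight c b : ℂ) * ((2 * Real.pi * Complex.I * (freq ξ k.castSucc : ℂ)) *
            ∫ η, V (ξ - η) k.castSucc * W η b) = (2 * Real.pi * Complex.I) *
            (freq ξ k.castSucc : ℂ) * ∫ η, V (ξ - η) k.castSucc * ((weight c b : ℂ) * W η b) := by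
          have : ∀ η, V (ξ - η) k.castSucc * ((weight c b : ℂ) * W η b) =
            (weight c b : ℂ) * (V (ξ - η) k.castSucc * W η b) := fun η => by ring
          simp_rw [this]
          rw [integral_const_mul]
          ring
        rw [e, enorm_mul, enorm_mul, mul_assoc]
        refine mul_le_mul' ?_ (mul_le_mul' ?_ ?_)
        · rw [← ofReal_norm]
          refine ENNReal.ofReal_le_ofReal ?_
          simp [abs_of_pos Real.pi_pos]
        · rw [← ofReal_norm, ← ofReal_norm, Complex.norm_real]
          exact ENNReal.ofReal_le_ofReal (abs_freq_le ξ _)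
        · refine (enorm_integral_le_lintegral_enorm _).trans (lintegral_mono fun η => ?_)
          rw [enorm_mul]
          refine mul_le_mul' ?_ (enorm_weight_mul_le c _ b)
          simpa [weight_castSucc] using enorm_weight_mul_le c (V (ξ - η)) k.castSucc
    refine (enorm_sum_le _ _).trans ((Finset.sum_le_card_nsmul _ _ _ fun a _ => hterm a).trans_eq ?_)
    rw [Finset.card_univ, Fintype.card_fin, nsmul_eq_mul, ← mul_assoc, Nat.cast_ofNat,
      ← ENNReal.ofReal_ofNat, ← ENNReal.ofReal_mul (by norm_num)]
    congr 2
    ring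
  refine (mul_le_mul_right h3 _).trans_eq ?_
  rw [← mul_assoc, bilinearConst, ← ENNReal.ofReal_ofNat, ← ENNReal.ofReal_mul (by norm_num)]
  congr 2
  ring

theorem bilinearTerm_sub_self {V W : R3 → Fin 4 → ℂ} {ξ : R3}
    (h1 : ∀ a b, Integrable fun η => V (ξ - η) a * V η b)
    (h2 : ∀ a b, Integrable fun η => W (ξ - η) a * V η b)
    (h3 : ∀ a b, Integrable fun η => W (ξ - η) a * W η b) :
    bilinearTerm V V ξ - bilinearTerm W W ξ =
      bilinearTerm (V - W) V ξ + bilinearTerm W (V - W) ξ := by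
  simp only [bilinearTerm]
  rw [← Matrix.mulVec_sub, ← Matrix.mulVec_add]
  congr 1
  ext b
  simp only [Pi.sub_apply, Pi.add_apply]
  rw [← Finset.sum_sub_distrib, ← Finset.sum_add_distrib]
  refine Finset.sum_congr rfl fun a _ => ?_
  simp_rw [sub_mul, mul_sub]
  rw [integral_sub (h1 a b) (h2 a b), integral_sub (h2 a b) (h3 a b)]
  ring

theorem measurable_bilinearTerm {V W : ℝ → R3 → Fin 4 → ℂ} (hV : Measurable (Function.uncurry V))
    (hW : Measurable (Function.uncurry W)) :
    Measurable (Function.uncurry fun t => bilinearTerm (V t) (W t)) := by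
  refine measurable_pi_iff.2 fun i => ?_
  have h1 : ∀ a b, Measurable fun z : ℝ × R3 => ∫ η, V z.1 (z.2 - η) a * W z.1 η b := by
    intro a b
    refine (StronglyMeasurable.integral_prod_right
      (f := fun (z : ℝ × R3) (η : R3) => V z.1 (z.2 - η) a * W z.1 η b) ?_).measurable
    refine Measurable.stronglyMeasurable ?_
    refine Measurable.mul ?_ ?_
    · exact (measurable_pi_apply a).comp (hV.comp
        (f := fun z : (ℝ × R3) × R3 => (z.1.1, z.1.2 - z.2)) (by fun_prop))
    · exact (measurable_pi_apply b).comp (hW.comp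
        (f := fun z : (ℝ × R3) × R3 => (z.1.1, z.2)) (by fun_prop))
  simp only [Function.uncurry, bilinearTerm, Matrix.mulVec, dotProduct]
  have h2 : ∀ a b, Measurable fun z : ℝ × R3 => helmholtz z.2 a b :=
    fun a b => (measurable_helmholtz a b).comp measurable_snd
  have h3 : ∀ a, Measurable fun z : ℝ × R3 => (freq z.2 a : ℂ) :=
    fun a => Complex.measurable_ofReal.comp ((measurable_freq a).comp measurable_snd)
  fun_prop

theorem bilinearTerm_congr {V V' W W' : R3 → Fin 4 → ℂ} (hV : V =ᵐ[volume] V')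
    (hW : W =ᵐ[volume] W') : bilinearTerm V W = bilinearTerm V' W' := by
  ext1 ξ
  simp only [bilinearTerm]
  congr 1
  ext b
  refine Finset.sum_congr rfl fun a _ => ?_
  congr 1
  refine integral_congr_ae ?_
  have h := (Measure.measurePreserving_sub_left volume ξ).quasiMeasurePreserving.ae_eq_comp hV
  filter_upwards [h, hW] with η h1 h2
  simp only [Function.comp_apply] at h1
  rw [h1, h2]

end PrimitiveEq

namespace PrimitiveEq

/-! ### The norm of the solution space -/

variable {p r : ℝ≥0∞} {α κ : ℝ} {J : Set ℝ}

theorem ae_lt_top_of_eLpNorm_lt_top {X : Type*} [MeasurableSpace X] {μ : Measure X}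
    {f : X → ℝ≥0∞} (hf : AEMeasurable f μ) {q : ℝ≥0∞} (hq : q ≠ 0) (h : eLpNorm f q μ < ∞) :
    ∀ᵐ x ∂μ, f x < ∞ := by
  rcases eq_or_ne q ∞ with rfl | hq'
  · filter_upwards [ENNReal.ae_le_essSup (μ := μ) f] with x hx
    exact hx.trans_lt (by simpa [eLpNorm_exponent_top, eLpNormEssSup] using h)
  · have h1 := lintegral_rpow_enorm_lt_top_of_eLpNorm_lt_top hq hq' h
    filter_upwards [ae_lt_top' (hf.enorm.pow_const _) h1.ne] with x hx
    rw [enorm_eq_self] at hx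
    exact (ENNReal.rpow_lt_top_iff_of_pos (ENNReal.toReal_pos hq hq')).1 hx

theorem finite_of_spaceTimeNorm {δ : ℝ≥0∞} {s : ℝ} (hp : p ≠ 0) (hr : r ≠ 0) (hδ : δ ≠ 0)
    {F : ℝ → R3 → ℝ≥0∞} (hF : Measurable (Function.uncurry F))
    (h : spaceTimeNorm p r δ s J F < ∞) :
    ∀ᵐ t ∂(volume.restrict J), ∀ᵐ ξ, F t ξ < ∞ := by
  have h1 : ∀ j : ℤ, ∀ᵐ t ∂(volume.restrict J), annNorm p j (F t) < ∞ := by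
    intro j
    refine ae_lt_top_of_eLpNorm_lt_top (measurable_annNorm hF p j).aemeasurable hδ ?_
    have h2 := (le_eLpNorm_count (fun j : ℤ => (2 : ℝ≥0∞) ^ ((j : ℝ) * s) *
      eLpNorm (fun t => annNorm p j (F t)) δ (volume.restrict J)) hr j).trans_lt h
    exact ENNReal.lt_top_of_mul_ne_top_right h2.ne (two_rpow_ne_zero _)
  filter_upwards [ae_all_iff.2 h1] with t ht
  exact ae_of_forall_annulus fun j => ae_lt_top_of_eLpNorm_lt_top
    (hF.comp measurable_prodMk_left).aemeasurable hp (ht j)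

theorem ae_zero_of_spaceTimeNorm {δ : ℝ≥0∞} {s : ℝ} (hp : p ≠ 0) (hr : r ≠ 0) (hδ : δ ≠ 0)
    {F : ℝ → R3 → ℝ≥0∞} (hF : Measurable (Function.uncurry F))
    (h : spaceTimeNorm p r δ s J F = 0) :
    ∀ᵐ t ∂(volume.restrict J), ∀ᵐ ξ, F t ξ = 0 := by
  have h1 : ∀ j : ℤ, ∀ᵐ t ∂(volume.restrict J), annNorm p j (F t) = 0 := by
    intro j
    have h2 := (le_eLpNorm_count (fun j : ℤ => (2 : ℝ≥0∞) ^ ((j : ℝ) * s) *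
      eLpNorm (fun t => annNorm p j (F t)) δ (volume.restrict J)) hr j).trans h.le
    have h3 := (mul_eq_zero.1 (nonpos_iff_eq_zero.1 h2)).resolve_left (two_rpow_ne_zero _)
    exact (eLpNorm_eq_zero_iff (measurable_annNorm hF p j).aestronglyMeasurable hδ).1 h3
  filter_upwards [ae_all_iff.2 h1] with t ht
  exact ae_of_forall_annulus fun j => (eLpNorm_eq_zero_iff
    (hF.comp measurable_prodMk_left).aestronglyMeasurable hp).1 (ht j)

/-- Tonelli and Bernstein's inequality on each annulus. The exceptional null set of frequencies does
not depend on time, so all Duhamel integrals converge together. -/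
theorem lintegral_lt_top_of_forceNorm (hp : 1 ≤ p) (hr : r ≠ 0) {H : ℝ → R3 → ℝ≥0∞}
    (hH : Measurable (Function.uncurry H)) (h : forceNorm p r J H < ∞) :
    ∀ᵐ ξ, ∫⁻ τ in J, H τ ξ < ∞ := by
  refine ae_of_forall_annulus fun j => ?_
  refine ae_lt_top (Measurable.lintegral_prod_left (f := H) hH) ?_
  have h1 : ∫⁻ τ in J, annNorm p j (H τ) < ∞ := by
    have h2 := (le_eLpNorm_count (fun j : ℤ => (2 : ℝ≥0∞) ^ ((j : ℝ) * critIndex p) *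
      eLpNorm (fun t => annNorm p j (H t)) 1 (volume.restrict J)) hr j).trans_lt h
    have h3 := ENNReal.lt_top_of_mul_ne_top_right h2.ne (two_rpow_ne_zero _)
    simpa [eLpNorm_one_eq_lintegral_enorm] using h3
  rw [← lintegral_lintegral_swap hH.aemeasurable]
  refine ((lintegral_mono fun τ => lintegral_annulus_le hp j
    (f := H τ) (hH.comp measurable_prodMk_left).aemeasurable).trans_lt ?_).ne
  rw [lintegral_const_mul _ (measurable_annNorm hH p j)]
  exact ENNReal.mul_lt_top (ENNReal.mul_lt_top (bernsteinConst_ne_top hp).lt_top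
    (two_rpow_ne_top _).lt_top) h1

/-- The constant of the smoothing effect in the solution norms. -/
noncomputable def timeConst (κ α : ℝ) : ℝ≥0∞ :=
  ENNReal.ofReal ((2 / (1 + α) * κ)⁻¹ ^ (1 / (2 / (1 + α))))

theorem timeConst_ne_zero (hκ : 0 < κ) (hα : -1 < α) : timeConst κ α ≠ 0 := by
  have : 0 < 1 + α := by linarith
  have : 0 < (2 / (1 + α) * κ)⁻¹ ^ (1 / (2 / (1 + α))) := by positivity
  simpa [timeConst] using this

theorem timeConst_ne_top : timeConst κ α ≠ ∞ := ENNReal.ofReal_ne_top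

/-- The norm of the space `X^α`, normalized by the viscosity. -/
noncomputable def solNorm (p r : ℝ≥0∞) (α κ : ℝ) (J : Set ℝ) (F : ℝ → R3 → ℝ≥0∞) : ℝ≥0∞ :=
  (timeConst κ α)⁻¹ * plusNorm p r α J F + (timeConst κ (-α))⁻¹ * plusNorm p r (-α) J F

theorem plusNorm_le_solNorm (hκ : 0 < κ) (hα : α ∈ Ioo (-1 : ℝ) 1) (F : ℝ → R3 → ℝ≥0∞) :
    plusNorm p r α J F ≤ timeConst κ α * solNorm p r α κ J F := by
  rw [solNorm, mul_add, ← mul_assoc, ENNReal.mul_inv_cancel (timeConst_ne_zero hκ hα.1)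
    timeConst_ne_top, one_mul]
  exact le_self_add

theorem solNorm_neg (F : ℝ → R3 → ℝ≥0∞) : solNorm p r (-α) κ J F = solNorm p r α κ J F := by
  rw [solNorm, solNorm, neg_neg, add_comm]

theorem neg_mem_Ioo (hα : α ∈ Ioo (-1 : ℝ) 1) : -α ∈ Ioo (-1 : ℝ) 1 :=
  ⟨by linarith [hα.2], by linarith [hα.1]⟩

theorem one_le_two_div (hα : α ∈ Ioo (-1 : ℝ) 1) : 1 ≤ 2 / (1 + α) := by
  rw [le_div_iff₀ (by linarith [hα.1])]; linarith [hα.2]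

theorem one_le_ofReal_two_div (hα : α ∈ Ioo (-1 : ℝ) 1) : 1 ≤ ENNReal.ofReal (2 / (1 + α)) := by
  simpa using one_le_two_div hα

theorem plusNorm_lt_top (hκ : 0 < κ) (hα : α ∈ Ioo (-1 : ℝ) 1) {F : ℝ → R3 → ℝ≥0∞}
    (h : solNorm p r α κ J F < ∞) : plusNorm p r α J F < ∞ :=
  (plusNorm_le_solNorm hκ hα F).trans_lt (ENNReal.mul_lt_top timeConst_ne_top.lt_top h)

theorem solNorm_lt_top (hκ : 0 < κ) (hα : α ∈ Ioo (-1 : ℝ) 1) {F : ℝ → R3 → ℝ≥0∞}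
    (h1 : plusNorm p r α J F < ∞) (h2 : plusNorm p r (-α) J F < ∞) :
    solNorm p r α κ J F < ∞ :=
  ENNReal.add_lt_top.2
    ⟨ENNReal.mul_lt_top (ENNReal.inv_lt_top.2 (timeConst_ne_zero hκ hα.1).bot_lt) h1,
      ENNReal.mul_lt_top (ENNReal.inv_lt_top.2
        (timeConst_ne_zero hκ (neg_mem_Ioo hα).1).bot_lt) h2⟩

theorem solNorm_mono {F G : ℝ → R3 → ℝ≥0∞}
    (h : ∀ᵐ t ∂(volume.restrict J), ∀ᵐ ξ, F t ξ ≤ G t ξ) :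
    solNorm p r α κ J F ≤ solNorm p r α κ J G :=
  add_le_add (mul_le_mul_right (spaceTimeNorm_mono h) _)
    (mul_le_mul_right (spaceTimeNorm_mono h) _)

theorem solNorm_mono_set {I : Set ℝ} (h : I ⊆ J) (F : ℝ → R3 → ℝ≥0∞) :
    solNorm p r α κ I F ≤ solNorm p r α κ J F :=
  add_le_add (mul_le_mul_right (spaceTimeNorm_mono_set h F) _)
    (mul_le_mul_right (spaceTimeNorm_mono_set h F) _)

theorem solNorm_const_mul (hp : p ≠ 0) (hr : r ≠ 0) (hα : α ∈ Ioo (-1 : ℝ) 1) (c : ℝ≥0∞)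
    {F : ℝ → R3 → ℝ≥0∞} (hF : Measurable (Function.uncurry F)) :
    solNorm p r α κ J (fun t ξ => c * F t ξ) = c * solNorm p r α κ J F := by
  have h1 := (zero_lt_one.trans_le (one_le_ofReal_two_div hα)).ne'
  have h2 := (zero_lt_one.trans_le (one_le_ofReal_two_div (neg_mem_Ioo hα))).ne'
  rw [solNorm, solNorm, plusNorm, plusNorm, spaceTimeNorm_const_mul hp h1 hr c hF,
    spaceTimeNorm_const_mul hp h2 hr c hF, plusNorm, plusNorm]
  ring

theorem solNorm_tsum_le {ι : Type*} [Countable ι] (hp : 1 ≤ p) (hr : 1 ≤ r)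
    (hα : α ∈ Ioo (-1 : ℝ) 1) {F : ι → ℝ → R3 → ℝ≥0∞}
    (hF : ∀ i, Measurable (Function.uncurry (F i))) :
    solNorm p r α κ J (fun t ξ => ∑' i, F i t ξ) ≤ ∑' i, solNorm p r α κ J (F i) := by
  simp only [solNorm]
  rw [ENNReal.tsum_add, ENNReal.tsum_mul_left, ENNReal.tsum_mul_left]
  exact add_le_add
    (mul_le_mul_right (spaceTimeNorm_tsum_le hp (one_le_ofReal_two_div hα) hr hF) _)
    (mul_le_mul_right (spaceTimeNorm_tsum_le hp (one_le_ofReal_two_div (neg_mem_Ioo hα)) hr hF) _)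

theorem solNorm_add_le (hp : 1 ≤ p) (hr : 1 ≤ r) (hα : α ∈ Ioo (-1 : ℝ) 1)
    {F G : ℝ → R3 → ℝ≥0∞} (hF : Measurable (Function.uncurry F))
    (hG : Measurable (Function.uncurry G)) :
    solNorm p r α κ J (fun t ξ => F t ξ + G t ξ) ≤
      solNorm p r α κ J F + solNorm p r α κ J G := by
  simp only [solNorm]
  have h1 := spaceTimeNorm_add_le (s := critIndex p + 1 + α) (J := J) hp
    (one_le_ofReal_two_div hα) hr hF hG
  have h2 := spaceTimeNorm_add_le (s := critIndex p + 1 + -α) (J := J) hp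
    (one_le_ofReal_two_div (neg_mem_Ioo hα)) hr hF hG
  refine (add_le_add (mul_le_mul_right h1 _) (mul_le_mul_right h2 _)).trans_eq ?_
  simp only [plusNorm]
  ring

theorem ae_zero_of_solNorm (hp : p ≠ 0) (hr : r ≠ 0) (hα : α ∈ Ioo (-1 : ℝ) 1)
    {F : ℝ → R3 → ℝ≥0∞} (hF : Measurable (Function.uncurry F)) (h : solNorm p r α κ J F = 0) :
    ∀ᵐ t ∂(volume.restrict J), ∀ᵐ ξ, F t ξ = 0 := by
  refine ae_zero_of_spaceTimeNorm hp hr (zero_lt_one.trans_le (one_le_ofReal_two_div hα)).ne' hF ?_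
    (s := critIndex p + 1 + α)
  exact (mul_eq_zero.1 (add_eq_zero.1 h).1).resolve_left
    (ENNReal.inv_ne_zero.2 timeConst_ne_top)

theorem finite_of_solNorm (hp : p ≠ 0) (hr : r ≠ 0) (hκ : 0 < κ) (hα : α ∈ Ioo (-1 : ℝ) 1)
    {F : ℝ → R3 → ℝ≥0∞} (hF : Measurable (Function.uncurry F)) (h : solNorm p r α κ J F < ∞) :
    ∀ᵐ t ∂(volume.restrict J), ∀ᵐ ξ, F t ξ < ∞ :=
  finite_of_spaceTimeNorm hp hr (zero_lt_one.trans_le (one_le_ofReal_two_div hα)).ne' hF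
    (plusNorm_lt_top hκ hα h)

theorem plusNorm_duhamel_le (hp : 1 ≤ p) (hr : 1 ≤ r) (hκ : 0 < κ) (hα : α ∈ Ioo (-1 : ℝ) 1)
    {H : ℝ → R3 → ℝ≥0∞} (hH : Measurable (Function.uncurry H)) :
    (timeConst κ α)⁻¹ * plusNorm p r α J (duhamel κ J H) ≤ forceNorm p r J H := by
  have h1 := spaceTimeNorm_duhamel_le hp hr hκ (one_le_two_div hα) (critIndex p) J hH
  -- The exponent `2 / (1 + α)` is chosen so that the smoothing gain `2 / δ` is exactly `1 + α`.
  have e : critIndex p + 2 / (2 / (1 + α)) = critIndex p + 1 + α := by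
    rw [div_div_cancel₀ two_ne_zero]; ring
  rw [e] at h1
  refine (mul_le_mul_right h1 _).trans_eq ?_
  rw [← mul_assoc]
  change (timeConst κ α)⁻¹ * timeConst κ α * _ = _
  rw [ENNReal.inv_mul_cancel (timeConst_ne_zero hκ hα.1) timeConst_ne_top, one_mul, forceNorm]

theorem solNorm_duhamel_le (hp : 1 ≤ p) (hr : 1 ≤ r) (hκ : 0 < κ) (hα : α ∈ Ioo (-1 : ℝ) 1)
    {H : ℝ → R3 → ℝ≥0∞} (hH : Measurable (Function.uncurry H)) :
    solNorm p r α κ J (duhamel κ J H) ≤ 2 * forceNorm p r J H := by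
  rw [two_mul]
  exact add_le_add (plusNorm_duhamel_le hp hr hκ hα hH)
    (plusNorm_duhamel_le hp hr hκ (neg_mem_Ioo hα) hH)

theorem plusNorm_heat_le (hp : 1 ≤ p) (hr : 1 ≤ r) (hκ : 0 < κ) (hα : α ∈ Ioo (-1 : ℝ) 1)
    {f : R3 → ℝ≥0∞} (hf : Measurable f) :
    (timeConst κ α)⁻¹ * plusNorm p r α J (fun t ξ => decay (κ * ‖ξ‖ ^ 2) t * f ξ) ≤
      spaceNorm p r (critIndex p) f := by
  have h1 := spaceTimeNorm_heat_le hp hr hκ (one_le_two_div hα) (critIndex p) J hf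
  have e : critIndex p + 2 / (2 / (1 + α)) = critIndex p + 1 + α := by
    rw [div_div_cancel₀ two_ne_zero]; ring
  rw [e] at h1
  refine (mul_le_mul_right h1 _).trans_eq ?_
  rw [← mul_assoc]
  change (timeConst κ α)⁻¹ * timeConst κ α * _ = _
  rw [ENNReal.inv_mul_cancel (timeConst_ne_zero hκ hα.1) timeConst_ne_top, one_mul]

theorem solNorm_heat_le (hp : 1 ≤ p) (hr : 1 ≤ r) (hκ : 0 < κ) (hα : α ∈ Ioo (-1 : ℝ) 1)
    {f : R3 → ℝ≥0∞} (hf : Measurable f) :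
    solNorm p r α κ J (fun t ξ => decay (κ * ‖ξ‖ ^ 2) t * f ξ) ≤
      2 * spaceNorm p r (critIndex p) f := by
  rw [two_mul]
  exact add_le_add (plusNorm_heat_le hp hr hκ hα hf)
    (plusNorm_heat_le hp hr hκ (neg_mem_Ioo hα) hf)

/-- The constant in the bilinear estimate. -/
noncomputable def forceConst (p : ℝ≥0∞) (α κ : ℝ) : ℝ≥0∞ :=
  2 * productConst p α * (timeConst κ α * timeConst κ (-α))

theorem forceConst_lt_top (hp : 1 < p) (hα : 0 < α) : forceConst p α κ < ∞ :=
  ENNReal.mul_lt_top (ENNReal.mul_lt_top ENNReal.ofNat_lt_top (productConst_lt_top hp hα))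
    (ENNReal.mul_lt_top timeConst_ne_top.lt_top timeConst_ne_top.lt_top)

/-- The factors scale as `κ` to the powers `-(1 + α)/2` and `-(1 - α)/2`. The exponents add up to
`-1`, and this produces a smallness condition linear in the viscosity. -/
theorem timeConst_mul_timeConst (hκ : 0 < κ) (hα : α ∈ Ioo (-1 : ℝ) 1) :
    timeConst κ α * timeConst κ (-α) = ENNReal.ofReal κ⁻¹ * (timeConst 1 α * timeConst 1 (-α)) := by
  have h1 : 0 < 1 + α := by linarith [hα.1]
  have h2 : 0 < 1 + -α := by linarith [hα.2]
  simp only [timeConst]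
  rw [← ENNReal.ofReal_mul (by positivity), ← ENNReal.ofReal_mul (by positivity),
    ← ENNReal.ofReal_mul (by positivity)]
  congr 1
  have e : ∀ a : ℝ, 0 < 1 + a → (2 / (1 + a) * κ)⁻¹ ^ (1 / (2 / (1 + a))) =
      (2 / (1 + a) * 1)⁻¹ ^ (1 / (2 / (1 + a))) * κ⁻¹ ^ ((1 + a) / 2) := by
    intro a ha
    rw [mul_one, mul_inv, Real.mul_rpow (by positivity) (by positivity), one_div_div]
  rw [e α h1, e (-α) h2]
  have e2 : κ⁻¹ ^ ((1 + α) / 2) * κ⁻¹ ^ ((1 + -α) / 2) = κ⁻¹ := by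
    rw [← Real.rpow_add (by positivity)]
    have : (1 + α) / 2 + (1 + -α) / 2 = 1 := by ring
    rw [this, Real.rpow_one]
  calc _ = (κ⁻¹ ^ ((1 + α) / 2) * κ⁻¹ ^ ((1 + -α) / 2)) * ((2 / (1 + α) * 1)⁻¹ ^ (1 / (2 / (1 + α))) *
      (2 / (1 + -α) * 1)⁻¹ ^ (1 / (2 / (1 + -α)))) := by ring
    _ = _ := by rw [e2]

/-- **The bilinear estimate** in the solution norm. -/
theorem forceNorm_conv_le_solNorm (hp : 1 ≤ p) (hr : 1 ≤ r) (hκ : 0 < κ)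
    (hα : α ∈ Ioo (-1 : ℝ) 1) {F G : ℝ → R3 → ℝ≥0∞} (hF : Measurable (Function.uncurry F))
    (hG : Measurable (Function.uncurry G)) :
    forceNorm p r J (fun t ξ => ‖ξ‖ₑ * conv (F t) (G t) ξ) ≤
      forceConst p α κ * (solNorm p r α κ J F * solNorm p r α κ J G) := by
  refine (forceNorm_conv_le hp hr hα hF hG).trans ?_
  rw [forceConst, mul_assoc (2 * productConst p α)]
  refine mul_le_mul_right ?_ _
  have h1 := timeConst_ne_zero hκ hα.1
  have h2 := timeConst_ne_zero hκ (neg_mem_Ioo hα).1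
  have e : ∀ H : ℝ → R3 → ℝ≥0∞, ∀ b, timeConst κ b ≠ 0 → plusNorm p r b J H =
      timeConst κ b * ((timeConst κ b)⁻¹ * plusNorm p r b J H) := fun H b hb => by
    rw [← mul_assoc, ENNReal.mul_inv_cancel hb timeConst_ne_top, one_mul]
  rw [e F α h1, e G α h1, e F (-α) h2, e G (-α) h2, solNorm, solNorm]
  set a := timeConst κ α
  set b := timeConst κ (-α)
  set x := a⁻¹ * plusNorm p r α J F
  set y := b⁻¹ * plusNorm p r (-α) J F
  set z := a⁻¹ * plusNorm p r α J G
  set w := b⁻¹ * plusNorm p r (-α) J G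
  calc a * x * (b * w) + a * z * (b * y) = a * b * (x * w + y * z) := by ring
    _ ≤ a * b * ((x + y) * (z + w)) := by
        refine mul_le_mul_right ?_ _
        have : (x + y) * (z + w) = (x * w + y * z) + (x * z + y * w) := by ring
        rw [this]
        exact le_self_add

end PrimitiveEq

namespace PrimitiveEq

/-! ### A parabolic weight -/

/-- The weight `1 + b t |ξ|²`, which measures the parabolic smoothing. -/
noncomputable def growth (b t : ℝ) (ξ : R3) : ℝ≥0∞ := 1 + ENNReal.ofReal (b * t * ‖ξ‖ ^ 2)

theorem one_le_growth (b t : ℝ) (ξ : R3) : 1 ≤ growth b t ξ := le_self_add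

theorem growth_ne_top (b t : ℝ) (ξ : R3) : growth b t ξ ≠ ∞ :=
  ENNReal.add_ne_top.2 ⟨ENNReal.one_ne_top, ENNReal.ofReal_ne_top⟩

theorem growth_zero_left (t : ℝ) (ξ : R3) : growth 0 t ξ = 1 := by simp [growth]

theorem growth_zero_right (b : ℝ) (ξ : R3) : growth b 0 ξ = 1 := by simp [growth]

theorem growth_eq_ofReal {b t : ℝ} (hb : 0 ≤ b) (ht : 0 ≤ t) (ξ : R3) :
    growth b t ξ = ENNReal.ofReal (1 + b * t * ‖ξ‖ ^ 2) := by
  rw [growth, ENNReal.ofReal_add zero_le_one (by positivity), ENNReal.ofReal_one]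

theorem measurable_growth (b : ℝ) : Measurable (Function.uncurry (growth b)) := by
  unfold growth Function.uncurry
  fun_prop

/-- With `x = κ |ξ|² (t - τ)` the weight grows from time `τ` to time `t` by at most the factor `1 +
x`, and `(1 + x) e^(-x) ≤ 1`. One half of the decay pays for this; the other half remains for the
estimates. -/
theorem growth_mul_decay_le {b κ t τ : ℝ} (hb : 0 ≤ b) (hbκ : b ≤ κ) (hτ : 0 ≤ τ) (ξ : R3) :
    growth b t ξ * decay (2 * κ * ‖ξ‖ ^ 2) (t - τ) ≤
      decay (κ * ‖ξ‖ ^ 2) (t - τ) * growth b τ ξ := by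
  by_cases h : 0 ≤ t - τ
  · have ht : 0 ≤ t := by linarith
    have hκ : 0 ≤ κ := hb.trans hbκ
    rw [growth_eq_ofReal hb ht, growth_eq_ofReal hb hτ, decay, decay,
      indicator_of_mem (mem_Ici.2 h), indicator_of_mem (mem_Ici.2 h),
      ← ENNReal.ofReal_mul (by positivity), ← ENNReal.ofReal_mul (Real.exp_pos _).le]
    refine ENNReal.ofReal_le_ofReal ?_
    set x := κ * ‖ξ‖ ^ 2 * (t - τ) with hx
    have hx0 : 0 ≤ x := by positivity
    have e : Real.exp (-(2 * κ * ‖ξ‖ ^ 2 * (t - τ))) = Real.exp (-x) * Real.exp (-x) := by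
      rw [← Real.exp_add]; congr 1; rw [hx]; ring
    have h1 : 1 + b * t * ‖ξ‖ ^ 2 ≤ (1 + x) * (1 + b * τ * ‖ξ‖ ^ 2) := by
      have h3 : b * (t - τ) * ‖ξ‖ ^ 2 ≤ x := by
        rw [hx]
        calc b * (t - τ) * ‖ξ‖ ^ 2 ≤ κ * (t - τ) * ‖ξ‖ ^ 2 := by gcongr
          _ = _ := by ring
      have h4 : 0 ≤ x * (b * τ * ‖ξ‖ ^ 2) := by positivity
      nlinarith
    have h2 : (1 + x) * Real.exp (-x) ≤ 1 := by
      rw [Real.exp_neg, ← div_eq_mul_inv, div_le_one (Real.exp_pos _)]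
      linarith [Real.add_one_le_exp x]
    have h5 : 0 ≤ 1 + b * τ * ‖ξ‖ ^ 2 := by positivity
    rw [e]
    calc (1 + b * t * ‖ξ‖ ^ 2) * (Real.exp (-x) * Real.exp (-x))
        ≤ ((1 + x) * (1 + b * τ * ‖ξ‖ ^ 2)) * (Real.exp (-x) * Real.exp (-x)) := by gcongr
      _ = ((1 + x) * Real.exp (-x)) * (Real.exp (-x) * (1 + b * τ * ‖ξ‖ ^ 2)) := by ring
      _ ≤ 1 * (Real.exp (-x) * (1 + b * τ * ‖ξ‖ ^ 2)) := by gcongr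
      _ = _ := one_mul _
  · simp [decay, h]

/-- The weight is submultiplicative up to `2`, since `|ξ|² ≤ 2 (|ξ - η|² + |η|²)`; it can therefore
be distributed over the factors of a convolution. -/
theorem growth_le_mul {b t : ℝ} (hb : 0 ≤ b) (ht : 0 ≤ t) (ξ η : R3) :
    growth b t ξ ≤ 2 * (growth b t (ξ - η) * growth b t η) := by
  rw [growth_eq_ofReal hb ht, growth_eq_ofReal hb ht, growth_eq_ofReal hb ht,
    ← ENNReal.ofReal_mul (by positivity), two_mul,
    ← ENNReal.ofReal_add (by positivity) (by positivity)]
  refine ENNReal.ofReal_le_ofReal ?_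
  have h1 : ‖ξ‖ ≤ ‖ξ - η‖ + ‖η‖ := by simpa using norm_add_le (ξ - η) η
  have h2 : ‖ξ‖ ^ 2 ≤ 2 * (‖ξ - η‖ ^ 2 + ‖η‖ ^ 2) := by
    nlinarith [norm_nonneg ξ, sq_nonneg (‖ξ - η‖ - ‖η‖), norm_nonneg (ξ - η), norm_nonneg η]
  have h3 : 0 ≤ b * t := by positivity
  have h4 : 0 ≤ (b * t * ‖ξ - η‖ ^ 2) * (b * t * ‖η‖ ^ 2) := by positivity
  nlinarith [mul_le_mul_of_nonneg_left h2 h3]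

/-- The pointwise size of a vector field, with the parabolic weight. -/
noncomputable def size (b c : ℝ) (V : ℝ → R3 → Fin 4 → ℂ) (t : ℝ) (ξ : R3) : ℝ≥0∞ :=
  growth b t ξ * wn c (V t ξ)

variable {b c : ℝ}

theorem measurable_size {V : ℝ → R3 → Fin 4 → ℂ} (hV : Measurable (Function.uncurry V)) :
    Measurable (Function.uncurry (size b c V)) :=
  (measurable_growth b).mul ((continuous_wn c).measurable.comp hV)

theorem wn_le_size (V : ℝ → R3 → Fin 4 → ℂ) (t : ℝ) (ξ : R3) : wn c (V t ξ) ≤ size b c V t ξ :=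
  le_mul_of_one_le_left zero_le (one_le_growth b t ξ)

theorem size_zero_left (V : ℝ → R3 → Fin 4 → ℂ) :
    size 0 c V = fun t ξ => wn c (V t ξ) := by
  ext t ξ; rw [size, growth_zero_left, one_mul]

theorem size_sub_le (V W : ℝ → R3 → Fin 4 → ℂ) (t : ℝ) (ξ : R3) :
    size b c (V - W) t ξ ≤ size b c V t ξ + size b c W t ξ := by
  rw [size, size, size, ← mul_add]
  exact mul_le_mul_right (wn_sub_le c _ _) _

theorem growth_mul_conv_le {t : ℝ} (hb : 0 ≤ b) (ht : 0 ≤ t) (V W : ℝ → R3 → Fin 4 → ℂ) (ξ : R3) :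
    growth b t ξ * conv (fun η => wn c (V t η)) (fun η => wn c (W t η)) ξ ≤
      2 * conv (size b c V t) (size b c W t) ξ := by
  rw [conv, conv, ← lintegral_const_mul' _ _ (growth_ne_top b t ξ),
    ← lintegral_const_mul' _ _ ENNReal.ofNat_ne_top]
  refine lintegral_mono fun η => ?_
  simp only [size]
  calc growth b t ξ * (wn c (V t (ξ - η)) * wn c (W t η))
      ≤ (2 * (growth b t (ξ - η) * growth b t η)) * (wn c (V t (ξ - η)) * wn c (W t η)) :=
        mul_le_mul_left (growth_le_mul hb ht ξ η) _
    _ = _ := by ring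

/-! ### The Duhamel integral -/

/-- The Duhamel integral `∫₀ᵗ T(t - τ) A(τ) dτ` in Fourier variables. -/
noncomputable def forced (ν g Ω N : ℝ) (A : ℝ → R3 → Fin 4 → ℂ) (t : ℝ) (ξ : R3) : Fin 4 → ℂ :=
  ∫ τ in Ioc 0 t, semigroup ν ν g Ω N (t - τ) ξ *ᵥ A τ ξ

/-- A time interval starting at `0`. -/
structure IsTimeInterval (J : Set ℝ) : Prop where
  measurableSet : MeasurableSet J
  nonneg : ∀ t ∈ J, 0 ≤ t
  Icc_subset : ∀ t ∈ J, Icc 0 t ⊆ J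

theorem IsTimeInterval.Ioc_subset {J : Set ℝ} (hJ : IsTimeInterval J) {t : ℝ} (ht : t ∈ J) :
    Ioc 0 t ⊆ J := Ioc_subset_Icc_self.trans (hJ.Icc_subset t ht)

variable {ν g Ω N κ α : ℝ} {M p r : ℝ≥0∞} {J : Set ℝ}

theorem measurable_semigroup_mulVec {X : Type*} [MeasurableSpace X] {f : X → ℝ} {h : X → R3}
    {A : X → Fin 4 → ℂ} (hf : Measurable f) (hh : Measurable h) (hA : Measurable A) :
    Measurable fun x => semigroup ν ν g Ω N (f x) (h x) *ᵥ A x := by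
  refine measurable_pi_iff.2 fun a => ?_
  simp only [Matrix.mulVec, dotProduct]
  refine Finset.measurable_sum _ fun i _ => ?_
  exact ((measurable_semigroup ν g Ω N a i).comp (hf.prodMk hh)).mul
    ((measurable_pi_apply i).comp hA)

theorem measurable_forced {A : ℝ → R3 → Fin 4 → ℂ} (hA : Measurable (Function.uncurry A)) :
    Measurable (Function.uncurry (forced ν g Ω N A)) := by
  have h : Function.uncurry (forced ν g Ω N A) = fun z : ℝ × R3 => ∫ τ,
      ({q : (ℝ × R3) × ℝ | q.2 ∈ Ioc 0 q.1.1}.indicator (fun q : (ℝ × R3) × ℝ =>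
        semigroup ν ν g Ω N (q.1.1 - q.2) q.1.2 *ᵥ A q.2 q.1.2)) (z, τ) := by
    ext1 z
    rw [Function.uncurry, forced, ← integral_indicator measurableSet_Ioc]
    congr 1
  rw [h]
  refine (StronglyMeasurable.integral_prod_right' ?_).measurable
  refine Measurable.stronglyMeasurable (Measurable.indicator ?_ ?_)
  · exact measurable_semigroup_mulVec (by fun_prop) (by fun_prop)
      (hA.comp (f := fun q : (ℝ × R3) × ℝ => (q.2, q.1.2)) (by fun_prop))
  · exact (measurableSet_lt (f := fun _ : (ℝ × R3) × ℝ => (0 : ℝ)) measurable_const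
      measurable_snd).inter
      (measurableSet_le (f := fun q : (ℝ × R3) × ℝ => q.2) (g := fun q => q.1.1)
        measurable_snd (by fun_prop))

theorem enorm_le_wn (hc : 0 < c) (x : Fin 4 → ℂ) : ‖x‖ₑ ≤ ENNReal.ofReal (1 + c⁻¹) * wn c x := by
  have hK : ENNReal.ofReal (1 + c⁻¹) * wn c x ≠ ∞ :=
    ENNReal.mul_ne_top ENNReal.ofReal_ne_top (wn_ne_top c x)
  rw [← ofReal_norm, ENNReal.ofReal_le_iff_le_toReal hK,
    pi_norm_le_iff_of_nonneg ENNReal.toReal_nonneg]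
  intro a
  rw [← ENNReal.ofReal_le_iff_le_toReal hK, ofReal_norm]
  exact enorm_apply_le_wn hc x a

theorem wn_semigroup_le (hD : DecayBound ν g Ω N c M J) (hν : 0 ≤ ν) {t : ℝ} (ht : t ∈ J)
    (ξ : R3) (x : Fin 4 → ℂ) : wn c (semigroup ν ν g Ω N t ξ *ᵥ x) ≤ M * wn c x :=
  (hD t ht ξ x).trans (mul_le_mul_right
    (mul_le_of_le_one_left zero_le (decay_le_one (by positivity) t)) _)

theorem integrableOn_semigroup_mulVec (hJ : IsTimeInterval J) (hc : 0 < c) (hν : 0 ≤ ν)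
    (hM : M ≠ ∞) (hD : DecayBound ν g Ω N c M J) {A : ℝ → R3 → Fin 4 → ℂ}
    (hA : Measurable (Function.uncurry A)) {ξ : R3} (h : ∫⁻ τ in J, wn c (A τ ξ) < ∞) {t : ℝ}
    (ht : t ∈ J) :
    IntegrableOn (fun τ => semigroup ν ν g Ω N (t - τ) ξ *ᵥ A τ ξ) (Ioc 0 t) := by
  refine ⟨(measurable_semigroup_mulVec (by fun_prop) measurable_const
    (hA.comp (measurable_prodMk_right (y := ξ)))).aestronglyMeasurable, ?_⟩
  have hb : ∀ τ ∈ Ioc 0 t, ‖semigroup ν ν g Ω N (t - τ) ξ *ᵥ A τ ξ‖ₑ ≤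
      ENNReal.ofReal (1 + c⁻¹) * M * wn c (A τ ξ) := fun τ hτ => by
    rw [mul_assoc]
    refine (enorm_le_wn hc _).trans (mul_le_mul_right (wn_semigroup_le hD hν ?_ ξ _) _)
    exact hJ.Icc_subset t ht ⟨by linarith [hτ.2], by linarith [hτ.1]⟩
  refine (setLIntegral_mono' measurableSet_Ioc hb).trans_lt ?_
  refine (lintegral_mono_set (hJ.Ioc_subset ht)).trans_lt ?_
  rw [lintegral_const_mul' _ _ (ENNReal.mul_ne_top ENNReal.ofReal_ne_top hM)]
  exact ENNReal.mul_lt_top (ENNReal.mul_lt_top ENNReal.ofReal_lt_top hM.lt_top) h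

theorem size_forced_le (hJ : IsTimeInterval J) (hM : M ≠ ∞) (hD : DecayBound ν g Ω N c M J)
    (hκ : 2 * Real.pi ^ 2 * ν = κ) (hb : 0 ≤ b) (hbκ : b ≤ κ) (A : ℝ → R3 → Fin 4 → ℂ) {t : ℝ}
    (ht : t ∈ J) (ξ : R3) :
    size b c (forced ν g Ω N A) t ξ ≤ M * duhamel κ J (size b c A) t ξ := by
  rw [size, forced]
  refine (mul_le_mul_right (wn_integral_le _ c _) _).trans ?_
  rw [← lintegral_const_mul' _ _ (growth_ne_top b t ξ), duhamel, ← lintegral_const_mul' _ _ hM]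
  refine le_trans ?_ (lintegral_mono_set (hJ.Ioc_subset ht))
  refine setLIntegral_mono' measurableSet_Ioc fun τ hτ => ?_
  have h1 := hD (t - τ) (hJ.Icc_subset t ht ⟨by linarith [hτ.2], by linarith [hτ.1]⟩) ξ (A τ ξ)
  have e : 4 * Real.pi ^ 2 * ν * ‖ξ‖ ^ 2 = 2 * κ * ‖ξ‖ ^ 2 := by rw [← hκ]; ring
  rw [e] at h1
  calc growth b t ξ * wn c (semigroup ν ν g Ω N (t - τ) ξ *ᵥ A τ ξ)
      ≤ growth b t ξ * (M * (decay (2 * κ * ‖ξ‖ ^ 2) (t - τ) * wn c (A τ ξ))) :=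
        mul_le_mul_right h1 _
    _ = M * ((growth b t ξ * decay (2 * κ * ‖ξ‖ ^ 2) (t - τ)) * wn c (A τ ξ)) := by ring
    _ ≤ M * ((decay (κ * ‖ξ‖ ^ 2) (t - τ) * growth b τ ξ) * wn c (A τ ξ)) := by
        exact mul_le_mul_right (mul_le_mul_left (growth_mul_decay_le hb hbκ hτ.1.le ξ) _) _
    _ = _ := by rw [size]; ring

theorem size_heat_le (hD : DecayBound ν g Ω N c M J)
    (hκ : 2 * Real.pi ^ 2 * ν = κ) (hb : 0 ≤ b) (hbκ : b ≤ κ) (V₀ : R3 → Fin 4 → ℂ) {t : ℝ}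
    (ht : t ∈ J) (ξ : R3) :
    size b c (fun t ξ => semigroup ν ν g Ω N t ξ *ᵥ V₀ ξ) t ξ ≤
      M * (decay (κ * ‖ξ‖ ^ 2) t * wn c (V₀ ξ)) := by
  have h1 := hD t ht ξ (V₀ ξ)
  have e : 4 * Real.pi ^ 2 * ν * ‖ξ‖ ^ 2 = 2 * κ * ‖ξ‖ ^ 2 := by rw [← hκ]; ring
  have h2 := growth_mul_decay_le (t := t) hb hbκ le_rfl ξ
  rw [sub_zero, growth_zero_right, mul_one] at h2
  rw [e] at h1
  calc growth b t ξ * wn c (semigroup ν ν g Ω N t ξ *ᵥ V₀ ξ)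
      ≤ growth b t ξ * (M * (decay (2 * κ * ‖ξ‖ ^ 2) t * wn c (V₀ ξ))) := mul_le_mul_right h1 _
    _ = M * ((growth b t ξ * decay (2 * κ * ‖ξ‖ ^ 2) t) * wn c (V₀ ξ)) := by ring
    _ ≤ _ := by gcongr

/-! ### The quadratic forcing -/

/-- The constant in the estimate of the quadratic forcing. -/
noncomputable def quadConst (p : ℝ≥0∞) (α κ : ℝ) : ℝ≥0∞ := 2 * bilinearConst * forceConst p α κ

theorem quadConst_lt_top (hp : 1 < p) (hα : 0 < α) : quadConst p α κ < ∞ :=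
  ENNReal.mul_lt_top (ENNReal.mul_lt_top ENNReal.ofNat_lt_top ENNReal.ofReal_lt_top)
    (forceConst_lt_top hp hα)

theorem size_bilinearTerm_le (hb : 0 ≤ b) {t : ℝ} (ht : 0 ≤ t) (V W : ℝ → R3 → Fin 4 → ℂ)
    (ξ : R3) : size b c (fun t => bilinearTerm (V t) (W t)) t ξ ≤
      2 * bilinearConst * (‖ξ‖ₑ * conv (size b c V t) (size b c W t) ξ) := by
  calc size b c (fun t => bilinearTerm (V t) (W t)) t ξ
      ≤ growth b t ξ * (bilinearConst *
          (‖ξ‖ₑ * conv (fun η => wn c (V t η)) (fun η => wn c (W t η)) ξ)) :=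
        mul_le_mul_right (wn_bilinearTerm_le c _ _ ξ) _
    _ = bilinearConst * (‖ξ‖ₑ *
          (growth b t ξ * conv (fun η => wn c (V t η)) (fun η => wn c (W t η)) ξ)) := by ring
    _ ≤ bilinearConst * (‖ξ‖ₑ * (2 * conv (size b c V t) (size b c W t) ξ)) := by
        exact mul_le_mul_right (mul_le_mul_right (growth_mul_conv_le hb ht V W ξ) _) _
    _ = _ := by ring

theorem measurable_enorm_mul_conv {F G : ℝ → R3 → ℝ≥0∞} (hF : Measurable (Function.uncurry F))
    (hG : Measurable (Function.uncurry G)) :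
    Measurable (Function.uncurry fun t ξ => ‖ξ‖ₑ * conv (F t) (G t) ξ) :=
  (measurable_snd.enorm).mul (measurable_conv hF hG)

/-- The product estimate makes `|ξ|` times the convolution of the sizes finite almost everywhere,
and `|ξ|` can be divided out off the origin. This supplies the absolute convergence demanded of a
mild solution and justifies the splitting of quadratic differences. -/
theorem ae_integrable_conv (hp : 1 < p) (hr : 1 ≤ r) (hκ : 0 < κ) (hα : α ∈ Ioo (0 : ℝ) 1)
    (hc : 0 < c) {V W : ℝ → R3 → Fin 4 → ℂ} (hV : Measurable (Function.uncurry V))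
    (hW : Measurable (Function.uncurry W)) (h1 : solNorm p r α κ J (size b c V) < ∞)
    (h2 : solNorm p r α κ J (size b c W) < ∞) :
    ∀ᵐ τ ∂(volume.restrict J), ∀ᵐ ξ : R3, ∀ a d,
      Integrable (fun η => V τ (ξ - η) a * W τ η d) := by
  have hα' : α ∈ Ioo (-1 : ℝ) 1 := ⟨by linarith [hα.1], hα.2⟩
  have h3 := forceNorm_conv_le_solNorm (J := J) hp.le hr hκ hα' (measurable_size hV)
    (measurable_size hW) (F := size b c V) (G := size b c W)
  have h4 := finite_of_spaceTimeNorm (zero_lt_one.trans hp).ne' (zero_lt_one.trans_le hr).ne'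
    one_ne_zero (measurable_enorm_mul_conv (measurable_size hV) (measurable_size hW))
    (h3.trans_lt (ENNReal.mul_lt_top (forceConst_lt_top hp hα.1) (ENNReal.mul_lt_top h1 h2)))
  filter_upwards [h4] with τ hτ
  filter_upwards [hτ, ae_ne_zero] with ξ hξ hξ0 a d
  have h5 : conv (size b c V τ) (size b c W τ) ξ < ∞ :=
    ENNReal.lt_top_of_mul_ne_top_right hξ.ne (enorm_ne_zero.2 hξ0)
  refine ⟨?_, ?_⟩
  · refine Measurable.aestronglyMeasurable (Measurable.mul ?_ ?_)
    · exact (measurable_pi_apply a).comp (hV.comp (f := fun η : R3 => (τ, ξ - η)) (by fun_prop))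
    · exact (measurable_pi_apply d).comp (hW.comp (f := fun η : R3 => (τ, η)) (by fun_prop))
  · set K := ENNReal.ofReal (1 + c⁻¹)
    have hK : K * K ≠ ∞ := ENNReal.mul_ne_top ENNReal.ofReal_ne_top ENNReal.ofReal_ne_top
    have hle : ∀ η, ‖V τ (ξ - η) a * W τ η d‖ₑ ≤
        K * K * (size b c V τ (ξ - η) * size b c W τ η) := fun η => by
      rw [enorm_mul]
      calc _ ≤ (K * size b c V τ (ξ - η)) * (K * size b c W τ η) := mul_le_mul'
            ((enorm_apply_le_wn hc _ a).trans (mul_le_mul_right (wn_le_size V _ _) _))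
            ((enorm_apply_le_wn hc _ d).trans (mul_le_mul_right (wn_le_size W _ _) _))
        _ = _ := by ring
    refine (lintegral_mono hle).trans_lt ?_
    rw [lintegral_const_mul' _ _ hK]
    exact ENNReal.mul_lt_top hK.lt_top h5

theorem forceNorm_size_bilinearTerm_le (hJ : IsTimeInterval J) (hp : 1 ≤ p) (hr : 1 ≤ r)
    (hκ : 0 < κ) (hα : α ∈ Ioo (-1 : ℝ) 1) (hb : 0 ≤ b) {V W : ℝ → R3 → Fin 4 → ℂ}
    (hV : Measurable (Function.uncurry V)) (hW : Measurable (Function.uncurry W)) :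
    forceNorm p r J (size b c fun t => bilinearTerm (V t) (W t)) ≤
      quadConst p α κ * (solNorm p r α κ J (size b c V) * solNorm p r α κ J (size b c W)) := by
  have hm := measurable_enorm_mul_conv (measurable_size (b := b) (c := c) hV)
    (measurable_size (b := b) (c := c) hW)
  have h1 : forceNorm p r J (size b c fun t => bilinearTerm (V t) (W t)) ≤
      forceNorm p r J (fun t ξ => 2 * bilinearConst *
        (‖ξ‖ₑ * conv (size b c V t) (size b c W t) ξ)) := by
    refine spaceTimeNorm_mono ?_
    filter_upwards [ae_restrict_mem hJ.measurableSet] with t ht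
    exact ae_of_all _ fun ξ => size_bilinearTerm_le hb (hJ.nonneg t ht) V W ξ
  refine h1.trans ?_
  rw [forceNorm, spaceTimeNorm_const_mul (zero_lt_one.trans_le hp).ne' one_ne_zero
    (zero_lt_one.trans_le hr).ne' _ hm, quadConst, mul_assoc (2 * bilinearConst)]
  exact mul_le_mul_right (forceNorm_conv_le_solNorm hp hr hκ hα (measurable_size hV)
    (measurable_size hW)) _

/-- The quadratic forcing `P ∇·(v ⊗ v)` as a function of time and frequency. -/
noncomputable def quad (V : ℝ → R3 → Fin 4 → ℂ) (t : ℝ) : R3 → Fin 4 → ℂ :=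
  bilinearTerm (V t) (V t)

theorem measurable_quad {V : ℝ → R3 → Fin 4 → ℂ} (hV : Measurable (Function.uncurry V)) :
    Measurable (Function.uncurry (quad V)) := measurable_bilinearTerm hV hV

theorem measurable_uncurry_sub {V W : ℝ → R3 → Fin 4 → ℂ} (hV : Measurable (Function.uncurry V))
    (hW : Measurable (Function.uncurry W)) : Measurable (Function.uncurry (V - W)) := hV.sub hW

/-- The difference of the squares is `B(V - W, V) + B(W, V - W)`. Global finiteness on `J` is used
only to make this splitting legitimate, while the bound itself is local to `I`, as marching in time
requires. -/
theorem forceNorm_size_quad_sub_le (hJ : IsTimeInterval J) (hp : 1 < p) (hr : 1 ≤ r) (hκ : 0 < κ)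
    (hα : α ∈ Ioo (0 : ℝ) 1) (hb : 0 ≤ b) (hc : 0 < c) {I : Set ℝ} (hI : MeasurableSet I)
    (hIJ : I ⊆ J) {V W : ℝ → R3 → Fin 4 → ℂ}
    (hV : Measurable (Function.uncurry V)) (hW : Measurable (Function.uncurry W))
    (h1 : solNorm p r α κ J (size b c V) < ∞) (h2 : solNorm p r α κ J (size b c W) < ∞) :
    forceNorm p r I (size b c (quad V - quad W)) ≤ quadConst p α κ *
      ((solNorm p r α κ I (size b c V) + solNorm p r α κ I (size b c W)) *
        solNorm p r α κ I (size b c (V - W))) := by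
  have hα' : α ∈ Ioo (-1 : ℝ) 1 := ⟨by linarith [hα.1], hα.2⟩
  have hz := measurable_uncurry_sub hV hW
  have hmV := measurable_size (b := b) (c := c) hV
  have hmW := measurable_size (b := b) (c := c) hW
  have hmz := measurable_size (b := b) (c := c) hz
  have hm1 := measurable_enorm_mul_conv hmz hmV
  have hm2 := measurable_enorm_mul_conv hmW hmz
  have hle : forceNorm p r I (size b c (quad V - quad W)) ≤ forceNorm p r I (fun t ξ =>
      2 * bilinearConst * (‖ξ‖ₑ * conv (size b c (V - W) t) (size b c V t) ξ +
        ‖ξ‖ₑ * conv (size b c W t) (size b c (V - W) t) ξ)) := by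
    refine spaceTimeNorm_mono ?_
    filter_upwards [ae_restrict_mem hI,
      ae_restrict_of_ae_restrict_of_subset hIJ (ae_integrable_conv hp hr hκ hα hc hV hV h1 h1),
      ae_restrict_of_ae_restrict_of_subset hIJ (ae_integrable_conv hp hr hκ hα hc hW hV h2 h1),
      ae_restrict_of_ae_restrict_of_subset hIJ (ae_integrable_conv hp hr hκ hα hc hW hW h2 h2)]
      with t ht a1 a2 a3
    filter_upwards [a1, a2, a3] with ξ b1 b2 b3
    have ht0 := hJ.nonneg t (hIJ ht)
    rw [mul_add]
    refine le_trans ?_ (add_le_add (size_bilinearTerm_le hb ht0 (V - W) V ξ)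
      (size_bilinearTerm_le hb ht0 W (V - W) ξ))
    rw [size, size, size, ← mul_add]
    refine mul_le_mul_right ?_ _
    have e : (quad V - quad W) t ξ = bilinearTerm (V t - W t) (V t) ξ +
        bilinearTerm (W t) (V t - W t) ξ := bilinearTerm_sub_self b1 b2 b3
    rw [e]
    exact wn_add_le c _ _
  refine hle.trans ?_
  have hp0 := (zero_lt_one.trans hp).ne'
  have hr0 := (zero_lt_one.trans_le hr).ne'
  rw [forceNorm, spaceTimeNorm_const_mul hp0 one_ne_zero hr0 _
    (F := fun t ξ => ‖ξ‖ₑ * conv (size b c (V - W) t) (size b c V t) ξ +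
        ‖ξ‖ₑ * conv (size b c W t) (size b c (V - W) t) ξ) (hm1.add hm2), quadConst,
    mul_assoc (2 * bilinearConst)]
  refine mul_le_mul_right ?_ _
  refine (spaceTimeNorm_add_le hp.le le_rfl hr hm1 hm2).trans ?_
  refine (add_le_add (forceNorm_conv_le_solNorm hp.le hr hκ hα' hmz hmV)
    (forceNorm_conv_le_solNorm hp.le hr hκ hα' hmW hmz)).trans_eq ?_
  ring

end PrimitiveEq

namespace PrimitiveEq

/-! ### The fixed point argument -/

/-- The standing assumptions of the fixed point argument. -/
structure IsSetting (p r : ℝ≥0∞) (α ν g Ω N c b : ℝ) (M : ℝ≥0∞) (J : Set ℝ) : Prop where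
  one_lt_p : 1 < p
  one_le_r : 1 ≤ r
  alpha_mem : α ∈ Ioo (0 : ℝ) 1
  nu_pos : 0 < ν
  c_pos : 0 < c
  b_nonneg : 0 ≤ b
  b_le : b ≤ 2 * Real.pi ^ 2 * ν
  M_ne_top : M ≠ ∞
  interval : IsTimeInterval J
  decay : DecayBound ν g Ω N c M J

/-- Half of the rate of decay of the semigroup. -/
noncomputable def rate (ν : ℝ) : ℝ := 2 * Real.pi ^ 2 * ν

variable {p r M : ℝ≥0∞} {α ν g Ω N c b : ℝ} {J I : Set ℝ}

namespace IsSetting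

variable (h : IsSetting p r α ν g Ω N c b M J)
include h

theorem rate_pos : 0 < rate ν := by have := h.nu_pos; unfold rate; positivity
theorem alpha_mem' : α ∈ Ioo (-1 : ℝ) 1 := ⟨by linarith [h.alpha_mem.1], h.alpha_mem.2⟩
theorem p_ne_zero : p ≠ 0 := (zero_lt_one.trans h.one_lt_p).ne'
theorem r_ne_zero : r ≠ 0 := (zero_lt_one.trans_le h.one_le_r).ne'

end IsSetting

/-- The right-hand side of the integral equation. -/
noncomputable def mild (ν g Ω N : ℝ) (V₀ : R3 → Fin 4 → ℂ) (V : ℝ → R3 → Fin 4 → ℂ) (t : ℝ)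
    (ξ : R3) : Fin 4 → ℂ :=
  semigroup ν ν g Ω N t ξ *ᵥ V₀ ξ - forced ν g Ω N (quad V) t ξ

theorem measurable_heat {V₀ : R3 → Fin 4 → ℂ} (hV₀ : Measurable V₀) :
    Measurable (Function.uncurry fun t ξ => semigroup ν ν g Ω N t ξ *ᵥ V₀ ξ) :=
  measurable_semigroup_mulVec measurable_fst measurable_snd (hV₀.comp measurable_snd)

theorem measurable_mild {V₀ : R3 → Fin 4 → ℂ} (hV₀ : Measurable V₀) {V : ℝ → R3 → Fin 4 → ℂ}
    (hV : Measurable (Function.uncurry V)) :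
    Measurable (Function.uncurry (mild ν g Ω N V₀ V)) :=
  (measurable_heat hV₀).sub (measurable_forced (measurable_quad hV))

theorem lintegral_wn_lt_top (h : IsSetting p r α ν g Ω N c b M J) {A : ℝ → R3 → Fin 4 → ℂ}
    (hA : Measurable (Function.uncurry A)) (hf : forceNorm p r J (size b c A) < ∞) :
    ∀ᵐ ξ, ∫⁻ τ in J, wn c (A τ ξ) < ∞ := by
  filter_upwards [lintegral_lt_top_of_forceNorm h.one_lt_p.le h.r_ne_zero (measurable_size hA) hf]
    with ξ hξ
  exact (lintegral_mono fun τ => wn_le_size A τ ξ).trans_lt hξ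

theorem forced_sub (h : IsSetting p r α ν g Ω N c b M J) {A B : ℝ → R3 → Fin 4 → ℂ}
    (hA : Measurable (Function.uncurry A)) (hB : Measurable (Function.uncurry B))
    (hfA : forceNorm p r J (size b c A) < ∞) (hfB : forceNorm p r J (size b c B) < ∞) :
    ∀ᵐ ξ, ∀ t ∈ J, forced ν g Ω N A t ξ - forced ν g Ω N B t ξ =
      forced ν g Ω N (A - B) t ξ := by
  filter_upwards [lintegral_wn_lt_top h hA hfA, lintegral_wn_lt_top h hB hfB] with ξ h1 h2 t ht
  rw [forced, forced, forced, ← integral_sub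
    (integrableOn_semigroup_mulVec h.interval h.c_pos h.nu_pos.le h.M_ne_top h.decay hA h1 ht)
    (integrableOn_semigroup_mulVec h.interval h.c_pos h.nu_pos.le h.M_ne_top h.decay hB h2 ht)]
  simp only [Pi.sub_apply, Matrix.mulVec_sub]

/-- If the forcing vanishes before `I`, the Duhamel integral does not see the past and the estimate
closes on `I` alone. For `I = J` the condition is void; for slabs it is the induction hypothesis in
`mild_unique`. -/
theorem solNorm_size_forced_le (h : IsSetting p r α ν g Ω N c b M J) (hI : MeasurableSet I)
    (hIJ : I ⊆ J) {A : ℝ → R3 → Fin 4 → ℂ} (hA : Measurable (Function.uncurry A))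
    (h0 : ∀ t ∈ I, ∀ᵐ ξ, ∀ᵐ τ ∂(volume.restrict (J \ I)), τ ≤ t → A τ ξ = 0) :
    solNorm p r α (rate ν) I (size b c (forced ν g Ω N A)) ≤
      2 * M * forceNorm p r I (size b c A) := by
  have hm := measurable_size (b := b) (c := c) hA
  have h1 : solNorm p r α (rate ν) I (size b c (forced ν g Ω N A)) ≤
      solNorm p r α (rate ν) I (fun t ξ => M * duhamel (rate ν) I (size b c A) t ξ) := by
    refine solNorm_mono ?_
    filter_upwards [ae_restrict_mem hI] with t ht
    filter_upwards [h0 t ht] with ξ hξ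
    refine (size_forced_le h.interval h.M_ne_top h.decay rfl h.b_nonneg h.b_le A (hIJ ht) ξ).trans
      (mul_le_mul_right ?_ M)
    -- Times outside `I` contribute nothing: for `τ ≤ t` the forcing is zero by `h0`, for `τ > t`
    -- the factor `decay` is zero.
    rw [duhamel, duhamel, ← Set.sdiff_union_of_subset hIJ,
      lintegral_union hI disjoint_sdiff_left]
    refine (add_le_add_left (le_of_eq ?_) _).trans_eq (zero_add _)
    rw [lintegral_congr_ae (g := fun _ => 0), lintegral_zero]
    filter_upwards [hξ] with τ hτ
    by_cases hle : τ ≤ t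
    · rw [size, hτ hle, wn_zero, mul_zero, mul_zero]
    · rw [PrimitiveEq.decay, indicator_of_notMem, zero_mul]
      simp only [mem_Ici, sub_nonneg]
      exact hle
  refine h1.trans ?_
  rw [solNorm_const_mul h.p_ne_zero h.r_ne_zero h.alpha_mem' M (measurable_duhamel _ _ hm),
    mul_comm 2 M, mul_assoc]
  exact mul_le_mul_right (solNorm_duhamel_le h.one_lt_p.le h.one_le_r h.rate_pos h.alpha_mem' hm) M

/-- The Lipschitz constant of the fixed point map. -/
noncomputable def lipConst (p M : ℝ≥0∞) (α κ : ℝ) : ℝ≥0∞ := 2 * M * quadConst p α κ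

theorem forceNorm_size_quad_lt_top (h : IsSetting p r α ν g Ω N c b M J)
    {V : ℝ → R3 → Fin 4 → ℂ} (hV : Measurable (Function.uncurry V))
    (h1 : solNorm p r α (rate ν) J (size b c V) < ∞) :
    forceNorm p r J (size b c (quad V)) < ∞ :=
  (forceNorm_size_bilinearTerm_le h.interval h.one_lt_p.le h.one_le_r h.rate_pos h.alpha_mem'
    h.b_nonneg hV hV).trans_lt (ENNReal.mul_lt_top (quadConst_lt_top h.one_lt_p h.alpha_mem.1)
      (ENNReal.mul_lt_top h1 h1))

theorem solNorm_size_mild_sub_le (h : IsSetting p r α ν g Ω N c b M J) (hI : MeasurableSet I)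
    (hIJ : I ⊆ J) (V₀ : R3 → Fin 4 → ℂ) {V W : ℝ → R3 → Fin 4 → ℂ}
    (hV : Measurable (Function.uncurry V)) (hW : Measurable (Function.uncurry W))
    (h1 : solNorm p r α (rate ν) J (size b c V) < ∞)
    (h2 : solNorm p r α (rate ν) J (size b c W) < ∞)
    (h0 : ∀ t ∈ I, ∀ᵐ ξ, ∀ᵐ τ ∂(volume.restrict (J \ I)), τ ≤ t → quad V τ ξ = quad W τ ξ) :
    solNorm p r α (rate ν) I (size b c (mild ν g Ω N V₀ V - mild ν g Ω N V₀ W)) ≤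
      lipConst p M α (rate ν) * ((solNorm p r α (rate ν) I (size b c V) +
        solNorm p r α (rate ν) I (size b c W)) * solNorm p r α (rate ν) I (size b c (V - W))) := by
  have hqV := measurable_quad hV
  have hqW := measurable_quad hW
  have e := forced_sub h hqV hqW (forceNorm_size_quad_lt_top h hV h1)
    (forceNorm_size_quad_lt_top h hW h2)
  have h3 : solNorm p r α (rate ν) I (size b c (mild ν g Ω N V₀ V - mild ν g Ω N V₀ W)) ≤
      solNorm p r α (rate ν) I (size b c (forced ν g Ω N (quad V - quad W))) := by
    refine solNorm_mono ?_
    filter_upwards [ae_restrict_mem hI] with t ht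
    filter_upwards [e] with ξ hξ
    have e1 : (mild ν g Ω N V₀ V - mild ν g Ω N V₀ W) t ξ =
        -forced ν g Ω N (quad V - quad W) t ξ := by
      rw [← hξ t (hIJ ht)]
      simp only [Pi.sub_apply, mild]
      abel
    rw [size, e1, wn_neg, size]
  refine h3.trans ((solNorm_size_forced_le h hI hIJ (measurable_uncurry_sub hqV hqW) ?_).trans ?_)
  · intro t ht
    filter_upwards [h0 t ht] with ξ hξ
    filter_upwards [hξ] with τ hτ hle
    simp only [Pi.sub_apply]
    rw [hτ hle, sub_self]
  · rw [lipConst, mul_assoc (2 * M)]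
    exact mul_le_mul_right (forceNorm_size_quad_sub_le h.interval h.one_lt_p h.one_le_r h.rate_pos
      h.alpha_mem h.b_nonneg h.c_pos hI hIJ hV hW h1 h2) _

theorem quad_zero : quad 0 = 0 := by
  ext t ξ a
  simp only [quad, bilinearTerm, Pi.zero_apply, mul_zero, integral_zero, Finset.sum_const_zero]
  exact congrFun (Matrix.mulVec_zero _) a

theorem size_zero : size b c 0 = fun _ _ => 0 := by
  ext t ξ
  simp [size, wn_zero]

theorem solNorm_zero (h : IsSetting p r α ν g Ω N c b M J) :
    solNorm p r α (rate ν) J (fun _ _ => 0) = 0 := by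
  have := solNorm_const_mul (J := J) (κ := rate ν) h.p_ne_zero h.r_ne_zero h.alpha_mem' 0
    (F := fun _ _ => 0) measurable_const
  simpa using this

/-- On the ball of radius `2 e` the Lipschitz constant is `Λ (2 e + 2 e)`, which `8 Λ e ≤ 1` bounds
by one half. -/
theorem solNorm_size_mild_sub_le_self (h : IsSetting p r α ν g Ω N c b M J)
    (V₀ : R3 → Fin 4 → ℂ) {V W : ℝ → R3 → Fin 4 → ℂ}
    (hV : Measurable (Function.uncurry V)) (hW : Measurable (Function.uncurry W)) {e : ℝ≥0∞}
    (he : e < ∞) (h1 : solNorm p r α (rate ν) J (size b c V) ≤ 2 * e)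
    (h2 : solNorm p r α (rate ν) J (size b c W) ≤ 2 * e)
    (hs : 8 * (lipConst p M α (rate ν) * e) ≤ 1) :
    solNorm p r α (rate ν) J (size b c (mild ν g Ω N V₀ V - mild ν g Ω N V₀ W)) ≤
      2⁻¹ * solNorm p r α (rate ν) J (size b c (V - W)) := by
  have h2e : 2 * e < ∞ := ENNReal.mul_lt_top ENNReal.ofNat_lt_top he
  refine (solNorm_size_mild_sub_le h h.interval.measurableSet subset_rfl V₀ hV hW
    (h1.trans_lt h2e) (h2.trans_lt h2e) ?_).trans ?_
  · intro t _
    simp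
  · rw [← mul_assoc]
    refine mul_le_mul_left ?_ _
    calc lipConst p M α (rate ν) * (_ + _) ≤ lipConst p M α (rate ν) * (2 * e + 2 * e) := by gcongr
      _ = 2⁻¹ * (8 * (lipConst p M α (rate ν) * e)) := by
          rw [show (8 : ℝ≥0∞) = 2 * 4 by norm_num, mul_assoc 2 4, ← mul_assoc 2⁻¹ 2,
            ENNReal.inv_mul_cancel two_ne_zero ENNReal.ofNat_ne_top]
          ring
      _ ≤ 2⁻¹ * 1 := by gcongr
      _ = _ := mul_one _

/-- The Picard iterates. -/
noncomputable def picard (ν g Ω N : ℝ) (V₀ : R3 → Fin 4 → ℂ) : ℕ → ℝ → R3 → Fin 4 → ℂ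
  | 0 => 0
  | n + 1 => mild ν g Ω N V₀ (picard ν g Ω N V₀ n)

theorem measurable_picard {V₀ : R3 → Fin 4 → ℂ} (hV₀ : Measurable V₀) (n : ℕ) :
    Measurable (Function.uncurry (picard ν g Ω N V₀ n)) := by
  induction n with
  | zero => exact measurable_const
  | succ n ih => exact measurable_mild hV₀ ih

theorem solNorm_size_le_add (h : IsSetting p r α ν g Ω N c b M J) {V W : ℝ → R3 → Fin 4 → ℂ}
    (hV : Measurable (Function.uncurry V)) (hW : Measurable (Function.uncurry W)) :
    solNorm p r α (rate ν) J (size b c V) ≤ solNorm p r α (rate ν) J (size b c (V - W)) +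
      solNorm p r α (rate ν) J (size b c W) := by
  refine le_trans (solNorm_mono (ae_of_all _ fun t => ae_of_all _ fun ξ => ?_))
    (solNorm_add_le h.one_lt_p.le h.one_le_r h.alpha_mem'
      (measurable_size (measurable_uncurry_sub hV hW)) (measurable_size hW))
  rw [size, size, size, ← mul_add]
  refine mul_le_mul_right ?_ _
  simpa using wn_add_le c (V t ξ - W t ξ) (W t ξ)

theorem size_sub_comm (V W : ℝ → R3 → Fin 4 → ℂ) : size b c (V - W) = size b c (W - V) := by
  ext t ξ
  rw [size, size, ← wn_neg]
  congr 2
  simp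

variable {V₀ : R3 → Fin 4 → ℂ} {e : ℝ≥0∞}

/-- The map sends `0` to the linear evolution, of norm at most `e`, and the contraction adds at most
half of `2 e`: the ball of radius `2 e` is preserved. -/
theorem solNorm_picard_le (h : IsSetting p r α ν g Ω N c b M J) (hV₀ : Measurable V₀)
    (he : e < ∞)
    (hlin : solNorm p r α (rate ν) J (size b c fun t ξ => semigroup ν ν g Ω N t ξ *ᵥ V₀ ξ) ≤ e)
    (hs : 8 * (lipConst p M α (rate ν) * e) ≤ 1) (n : ℕ) :
    solNorm p r α (rate ν) J (size b c (picard ν g Ω N V₀ n)) ≤ 2 * e := by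
  have hz : solNorm p r α (rate ν) J (size b c 0) = 0 := by rw [size_zero, solNorm_zero h]
  induction n with
  | zero => exact (hz.trans_le zero_le)
  | succ n ih =>
    have h1 := solNorm_size_mild_sub_le_self h V₀ (measurable_picard hV₀ n)
      (W := 0) measurable_const he ih (hz.trans_le zero_le) hs
    have e1 : mild ν g Ω N V₀ 0 = fun t ξ => semigroup ν ν g Ω N t ξ *ᵥ V₀ ξ := by
      ext1 t; ext1 ξ
      simp [mild, quad_zero, forced]
    refine (solNorm_size_le_add h (measurable_picard hV₀ (n + 1))
      (W := mild ν g Ω N V₀ 0) (measurable_mild hV₀ measurable_const)).trans ?_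
    rw [two_mul]
    refine add_le_add (h1.trans ?_) (by rw [e1]; exact hlin)
    rw [sub_zero]
    refine (mul_le_mul_right ih _).trans_eq ?_
    rw [← mul_assoc, ENNReal.inv_mul_cancel two_ne_zero ENNReal.ofNat_ne_top, one_mul]

theorem solNorm_picard_sub_le (h : IsSetting p r α ν g Ω N c b M J) (hV₀ : Measurable V₀)
    (he : e < ∞)
    (hlin : solNorm p r α (rate ν) J (size b c fun t ξ => semigroup ν ν g Ω N t ξ *ᵥ V₀ ξ) ≤ e)
    (hs : 8 * (lipConst p M α (rate ν) * e) ≤ 1) (n : ℕ) :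
    solNorm p r α (rate ν) J (size b c (picard ν g Ω N V₀ (n + 1) - picard ν g Ω N V₀ n)) ≤
      2⁻¹ ^ n * (2 * e) := by
  induction n with
  | zero =>
    rw [picard, sub_zero, pow_zero, one_mul]
    exact solNorm_picard_le h hV₀ he hlin hs 1
  | succ n ih =>
    refine (solNorm_size_mild_sub_le_self h V₀ (measurable_picard hV₀ (n + 1))
      (measurable_picard hV₀ n) he (solNorm_picard_le h hV₀ he hlin hs _)
      (solNorm_picard_le h hV₀ he hlin hs _) hs).trans ?_
    rw [pow_succ', mul_assoc]
    exact mul_le_mul_right ih _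

theorem wn_sub_eq_edist (x y : Fin 4 → ℂ) : wn c (x - y) = edist (weightMap c x) (weightMap c y) := by
  rw [wn, map_sub, edist_eq_enorm_sub]

/-- A sequence whose increments decay geometrically in the solution norm converges. -/
theorem exists_solNorm_limit (h : IsSetting p r α ν g Ω N c b M J) (he : e < ∞)
    {X : ℕ → ℝ → R3 → Fin 4 → ℂ} (hmX : ∀ n, Measurable (Function.uncurry (X n)))
    (hX : ∀ n, solNorm p r α (rate ν) J (size b c (X (n + 1) - X n)) ≤ 2⁻¹ ^ n * (2 * e)) :
    ∃ V : ℝ → R3 → Fin 4 → ℂ, Measurable (Function.uncurry V) ∧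
      ∀ n, solNorm p r α (rate ν) J (size b c (X n - V)) ≤ 2⁻¹ ^ n * (4 * e) := by
  set D : ℕ → ℝ → R3 → ℝ≥0∞ := fun n => size b c (X (n + 1) - X n) with hD
  have hmD : ∀ n, Measurable (Function.uncurry (D n)) := fun n =>
    measurable_size (measurable_uncurry_sub (hmX (n + 1)) (hmX n))
  have hsum : ∀ n, solNorm p r α (rate ν) J (fun t ξ => ∑' k, D (n + k) t ξ) ≤
      2⁻¹ ^ n * (4 * e) := fun n => by
    refine (solNorm_tsum_le h.one_lt_p.le h.one_le_r h.alpha_mem' fun k => hmD (n + k)).trans ?_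
    refine (ENNReal.tsum_le_tsum fun k => hX (n + k)).trans_eq ?_
    simp_rw [pow_add, mul_assoc]
    rw [ENNReal.tsum_mul_left, ENNReal.tsum_mul_right, ENNReal.tsum_geometric,
      ENNReal.one_sub_inv_two, inv_inv, ← mul_assoc 2 2]
    norm_num
  have hmsum : Measurable (Function.uncurry fun t ξ => ∑' k, D (0 + k) t ξ) := by
    refine Measurable.tsum fun k => ?_
    exact hmD (0 + k)
  -- The sum of all increments has finite norm, hence is finite at almost every `(t, ξ)`; there the
  -- sequence is Cauchy. The limit is thus a pointwise, jointly measurable function, and no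
  -- completeness of a function space is invoked.
  have hfin := finite_of_solNorm h.p_ne_zero h.r_ne_zero h.rate_pos h.alpha_mem' hmsum
    ((hsum 0).trans_lt (by
      rw [pow_zero, one_mul]; exact ENNReal.mul_lt_top ENNReal.ofNat_lt_top he))
  have hfin' : ∀ᵐ z ∂((volume.restrict J).prod (volume : Measure R3)),
      ∑' k, D (0 + k) z.1 z.2 < ∞ :=
    (Measure.ae_prod_iff_ae_ae (measurableSet_lt hmsum measurable_const)).2 hfin
  have hK : ENNReal.ofReal (1 + c⁻¹) ≠ ∞ := ENNReal.ofReal_ne_top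
  have hconv : ∀ᵐ z ∂((volume.restrict J).prod (volume : Measure R3)),
      ∃ l, Tendsto (fun n => X n z.1 z.2) atTop (𝓝 l) := by
    filter_upwards [hfin'] with z hz
    refine cauchySeq_tendsto_of_complete (cauchySeq_of_edist_le_of_tsum_ne_top
      (fun n => ENNReal.ofReal (1 + c⁻¹) * D (0 + n) z.1 z.2) (fun n => ?_) ?_)
    · have h1 := wn_le_size (b := b) (c := c) (X (n + 1) - X n) z.1 z.2
      have h2 := enorm_le_wn h.c_pos (X (n + 1) z.1 z.2 - X n z.1 z.2)
      rw [edist_comm, edist_eq_enorm_sub, zero_add]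
      exact h2.trans (mul_le_mul_right h1 _)
    · rw [ENNReal.tsum_mul_left]
      exact ENNReal.mul_ne_top hK hz.ne
  obtain ⟨V, hVm, hV⟩ := measurable_limit_of_tendsto_metrizable_ae
    (fun n => (hmX n).aemeasurable) hconv
  have hV' : ∀ᵐ t ∂(volume.restrict J), ∀ᵐ ξ : R3,
      Tendsto (fun n => X n t ξ) atTop (𝓝 (V (t, ξ))) := Measure.ae_ae_of_ae_prod hV
  refine ⟨fun t ξ => V (t, ξ), hVm, fun n => ?_⟩
  refine (solNorm_mono ?_).trans (hsum n)
  filter_upwards [hV'] with t ht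
  filter_upwards [ht] with ξ hξ
  have h1 := edist_le_tsum_of_edist_le_of_tendsto (f := fun n => weightMap c (X n t ξ))
    (fun n => wn c (X (n + 1) t ξ - X n t ξ))
    (fun n => by rw [edist_comm, ← wn_sub_eq_edist])
    (((weightMap c).continuous.tendsto _).comp hξ) n
  rw [← wn_sub_eq_edist] at h1
  change growth b t ξ * wn c (X n t ξ - V (t, ξ)) ≤
    ∑' k, growth b t ξ * wn c (X (n + k + 1) t ξ - X (n + k) t ξ)
  rw [ENNReal.tsum_mul_left]
  exact mul_le_mul_right h1 _

theorem quad_congr {V W : ℝ → R3 → Fin 4 → ℂ} {t : ℝ} (h : V t =ᵐ[volume] W t) :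
    quad V t = quad W t := bilinearTerm_congr h h

theorem ae_eq_of_solNorm_eq_zero (h : IsSetting p r α ν g Ω N c b M J)
    {V W : ℝ → R3 → Fin 4 → ℂ}
    (hV : Measurable (Function.uncurry V)) (hW : Measurable (Function.uncurry W))
    (h0 : solNorm p r α (rate ν) I (size b c (V - W)) = 0) :
    ∀ᵐ t ∂(volume.restrict I), V t =ᵐ[volume] W t := by
  filter_upwards [ae_zero_of_solNorm h.p_ne_zero h.r_ne_zero h.alpha_mem'
    (measurable_size (measurable_uncurry_sub hV hW)) h0] with t ht
  filter_upwards [ht] with ξ hξ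
  exact sub_eq_zero.1 (eq_zero_of_wn_eq_zero h.c_pos
    (nonpos_iff_eq_zero.1 ((wn_le_size (V - W) t ξ).trans hξ.le)))

/-- The limit `X` of the Picard iterates satisfies the equation at almost every `(t, ξ)`; the
contraction property extends to it because its norm is also at most `2 e`. -/
theorem exists_mild (h : IsSetting p r α ν g Ω N c b M J) (hV₀ : Measurable V₀)
    (he : e < ∞)
    (hlin : solNorm p r α (rate ν) J (size b c fun t ξ => semigroup ν ν g Ω N t ξ *ᵥ V₀ ξ) ≤ e)
    (hs : 8 * (lipConst p M α (rate ν) * e) ≤ 1) :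
    ∃ V : ℝ → R3 → Fin 4 → ℂ, Measurable (Function.uncurry V) ∧
      solNorm p r α (rate ν) J (size b c V) < ∞ ∧
      ∀ t ∈ J, V t = mild ν g Ω N V₀ V t := by
  obtain ⟨X, hXm, hX⟩ := exists_solNorm_limit h he (measurable_picard hV₀)
    (solNorm_picard_sub_le h hV₀ he hlin hs)
  have hmP := fun n => measurable_picard (ν := ν) (g := g) (Ω := Ω) (N := N) hV₀ n
  have hmX := measurable_mild (ν := ν) (g := g) (Ω := Ω) (N := N) hV₀ hXm
  have h4e : 4 * e < ∞ := ENNReal.mul_lt_top ENNReal.ofNat_lt_top he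
  have hXfin : solNorm p r α (rate ν) J (size b c X) < ∞ := by
    have := hX 0
    rw [size_sub_comm, picard, sub_zero, pow_zero, one_mul] at this
    exact this.trans_lt h4e
  have hle : solNorm p r α (rate ν) J (size b c X) ≤ 2 * e := by
    have hlim : Tendsto (fun n : ℕ => (2⁻¹ : ℝ≥0∞) ^ n * (4 * e) + 2 * e) atTop
        (𝓝 (0 * (4 * e) + 2 * e)) :=
      ((ENNReal.Tendsto.mul_const (ENNReal.tendsto_pow_atTop_nhds_zero_of_lt_one
        (by simp)) (Or.inr h4e.ne)).add tendsto_const_nhds)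
    rw [zero_mul, zero_add] at hlim
    refine ge_of_tendsto' hlim fun n => (solNorm_size_le_add h hXm (hmP n)).trans ?_
    rw [size_sub_comm]
    exact add_le_add (hX n) (solNorm_picard_le h hV₀ he hlin hs n)
  have h0 : solNorm p r α (rate ν) J (size b c (mild ν g Ω N V₀ X - X)) = 0 := by
    have hlim : Tendsto (fun n : ℕ => (2⁻¹ : ℝ≥0∞) ^ n * (4 * e + 4 * e)) atTop
        (𝓝 (0 * (4 * e + 4 * e))) :=
      ENNReal.Tendsto.mul_const (ENNReal.tendsto_pow_atTop_nhds_zero_of_lt_one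
        (by simp)) (Or.inr (ENNReal.add_lt_top.2 ⟨h4e, h4e⟩).ne)
    rw [zero_mul] at hlim
    refine nonpos_iff_eq_zero.1 (ge_of_tendsto' hlim fun n => ?_)
    have h1 := solNorm_size_mild_sub_le_self h V₀ hXm (hmP n) he hle
      (solNorm_picard_le h hV₀ he hlin hs n) hs
    rw [size_sub_comm X] at h1
    have h2 := hX (n + 1)
    rw [picard] at h2
    have h3 : solNorm p r α (rate ν) J (size b c (mild ν g Ω N V₀ X - X)) ≤
        solNorm p r α (rate ν) J (size b c (mild ν g Ω N V₀ X -
          mild ν g Ω N V₀ (picard ν g Ω N V₀ n))) +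
        solNorm p r α (rate ν) J (size b c (mild ν g Ω N V₀ (picard ν g Ω N V₀ n) - X)) := by
      have := solNorm_size_le_add h (measurable_uncurry_sub hmX hXm)
        (measurable_uncurry_sub (hmP (n + 1)) hXm)
      rwa [sub_sub_sub_cancel_right] at this
    refine h3.trans ?_
    rw [mul_add]
    refine add_le_add (h1.trans ((mul_le_of_le_one_left zero_le (by simp)).trans (hX n)))
      (h2.trans ?_)
    rw [pow_succ', mul_assoc]
    exact mul_le_of_le_one_left zero_le (by simp)
  have hae := ae_eq_of_solNorm_eq_zero h hmX hXm h0
  -- The image of `X`, rather than `X` itself, is taken as the solution. The Duhamel integral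
  -- ignores null sets of times and frequencies, so the equation now holds at every `t` in `J` and
  -- every `ξ`.
  refine ⟨mild ν g Ω N V₀ X, hmX, ?_, fun t ht => ?_⟩
  · refine (solNorm_mono ?_).trans_lt hXfin
    filter_upwards [hae] with t ht
    filter_upwards [ht] with ξ hξ
    rw [size, hξ, size]
  · ext1 ξ
    rw [mild, mild, forced, forced]
    congr 1
    refine integral_congr_ae ?_
    filter_upwards [ae_restrict_of_ae_restrict_of_subset (h.interval.Ioc_subset ht) hae] with τ hτ
    rw [quad_congr hτ]

end PrimitiveEq

namespace PrimitiveEq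

/-! ### Short time intervals and uniqueness -/

variable {p r M : ℝ≥0∞} {α ν g Ω N c b κ : ℝ} {J I : Set ℝ}

/-- Dominated convergence in `ℓ^r`, where `r < ∞` is essential. Both smallness on short intervals
and continuity in time rest on it. -/
theorem tendsto_eLpNorm_count {ι : Type*} {l : Filter ι} [l.IsCountablyGenerated] (hr : r ≠ 0)
    (hr' : r ≠ ∞) {a : ι → ℤ → ℝ≥0∞} {B : ℤ → ℝ≥0∞} (hB : eLpNorm B r Measure.count < ∞)
    (hle : ∀ᶠ i in l, ∀ j, a i j ≤ B j) (h : ∀ j, Tendsto (fun i => a i j) l (𝓝 0)) :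
    Tendsto (fun i => eLpNorm (a i) r Measure.count) l (𝓝 0) := by
  have hr0 : 0 < r.toReal := ENNReal.toReal_pos hr hr'
  have h1 : Tendsto (fun i => ∫⁻ j, ‖a i j‖ₑ ^ r.toReal ∂(Measure.count : Measure ℤ)) l
      (𝓝 (∫⁻ _, 0 ∂(Measure.count : Measure ℤ))) := by
    refine tendsto_lintegral_filter_of_dominated_convergence (fun j => ‖B j‖ₑ ^ r.toReal)
      (Eventually.of_forall fun i => measurable_of_countable _) ?_
      (lintegral_rpow_enorm_lt_top_of_eLpNorm_lt_top hr hr' hB).ne (ae_of_all _ fun j => ?_)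
    · filter_upwards [hle] with i hi
      refine ae_of_all _ fun j => ?_
      simp only [enorm_eq_self]
      exact ENNReal.rpow_le_rpow (hi j) hr0.le
    · simp only [enorm_eq_self]
      have := (h j).ennrpow_const r.toReal
      rwa [ENNReal.zero_rpow_of_pos hr0] at this
  rw [lintegral_zero] at h1
  simp_rw [eLpNorm_eq_lintegral_rpow_enorm_toReal hr hr']
  have h2 := h1.ennrpow_const (1 / r.toReal)
  rwa [ENNReal.zero_rpow_of_pos (by positivity)] at h2

/-- On each annulus this is absolute continuity of the integral, which needs `δ < ∞`; the norm on
`J` dominates the sum over the annuli. -/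
theorem tendsto_spaceTimeNorm {ι : Type*} {l : Filter ι} [l.IsCountablyGenerated] {δ : ℝ≥0∞}
    (hr : r ≠ 0) (hr' : r ≠ ∞) (hδ : δ ≠ 0) (hδ' : δ ≠ ∞) {s : ℝ} {F : ℝ → R3 → ℝ≥0∞}
    (hfin : spaceTimeNorm p r δ s J F < ∞)
    {I : ι → Set ℝ} (hI : ∀ i, MeasurableSet (I i)) (hIJ : ∀ᶠ i in l, I i ⊆ J)
    (hvol : Tendsto (fun i => volume (I i)) l (𝓝 0)) :
    Tendsto (fun i => spaceTimeNorm p r δ s (I i) F) l (𝓝 0) := by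
  have hδ0 : 0 < δ.toReal := ENNReal.toReal_pos hδ hδ'
  refine tendsto_eLpNorm_count hr hr' hfin ?_ fun j => ?_
  · filter_upwards [hIJ] with i hi j
    exact mul_le_mul_right (eLpNorm_mono_measure _ (Measure.restrict_mono_set _ hi)) _
  · have h1 := (le_eLpNorm_count (fun j : ℤ => (2 : ℝ≥0∞) ^ ((j : ℝ) * s) *
      eLpNorm (fun t => annNorm p j (F t)) δ (volume.restrict J)) hr j).trans_lt hfin
    have h2 := ENNReal.lt_top_of_mul_ne_top_right h1.ne (two_rpow_ne_zero _)
    have h3 := (lintegral_rpow_enorm_lt_top_of_eLpNorm_lt_top hδ hδ' h2).ne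
    have hvol' : Tendsto (fun i => (volume.restrict J) (I i)) l (𝓝 0) :=
      tendsto_of_tendsto_of_tendsto_of_le_of_le tendsto_const_nhds hvol (fun _ => zero_le)
        (fun i => Measure.restrict_apply_le _ _)
    have h4 := tendsto_setLIntegral_zero h3 hvol'
    have h5 : Tendsto (fun i => eLpNorm (fun t => annNorm p j (F t)) δ (volume.restrict (I i)))
        l (𝓝 0) := by
      have h6 := h4.ennrpow_const (1 / δ.toReal)
      rw [ENNReal.zero_rpow_of_pos (by positivity)] at h6
      refine h6.congr' ?_
      filter_upwards [hIJ] with i hi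
      rw [eLpNorm_eq_lintegral_rpow_enorm_toReal hδ hδ', Measure.restrict_restrict (hI i),
        inter_eq_self_of_subset_left hi]
    have h7 := ENNReal.Tendsto.const_mul h5 (Or.inr (two_rpow_ne_top ((j : ℝ) * s)))
    rwa [mul_zero] at h7

theorem tendsto_solNorm {ι : Type*} {l : Filter ι} [l.IsCountablyGenerated]
    (hr : r ≠ 0) (hr' : r ≠ ∞) (hκ : 0 < κ) (hα : α ∈ Ioo (-1 : ℝ) 1) {F : ℝ → R3 → ℝ≥0∞}
    (hfin : solNorm p r α κ J F < ∞)
    {I : ι → Set ℝ} (hI : ∀ i, MeasurableSet (I i)) (hIJ : ∀ᶠ i in l, I i ⊆ J)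
    (hvol : Tendsto (fun i => volume (I i)) l (𝓝 0)) :
    Tendsto (fun i => solNorm p r α κ (I i) F) l (𝓝 0) := by
  have hα' := neg_mem_Ioo hα
  have h1 := tendsto_spaceTimeNorm (p := p) (s := critIndex p + 1 + α) hr hr'
    (zero_lt_one.trans_le (one_le_ofReal_two_div hα)).ne' ENNReal.ofReal_ne_top
    (plusNorm_lt_top hκ hα hfin) hI hIJ hvol
  have h2 := tendsto_spaceTimeNorm (p := p) (s := critIndex p + 1 + -α) hr hr'
    (zero_lt_one.trans_le (one_le_ofReal_two_div hα')).ne' ENNReal.ofReal_ne_top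
    (plusNorm_lt_top hκ hα' (by rwa [solNorm_neg])) hI hIJ hvol
  have h3 := (ENNReal.Tendsto.const_mul (a := (timeConst κ α)⁻¹) h1
    (Or.inr (ENNReal.inv_ne_top.2 (timeConst_ne_zero hκ hα.1)))).add
    (ENNReal.Tendsto.const_mul (a := (timeConst κ (-α))⁻¹) h2
    (Or.inr (ENNReal.inv_ne_top.2 (timeConst_ne_zero hκ hα'.1))))
  rw [mul_zero, mul_zero, add_zero] at h3
  exact h3

/-- The solution norm is uniformly small on short time intervals. -/
theorem exists_solNorm_le_of_volume_le (hr : r ≠ 0) (hr' : r ≠ ∞) (hκ : 0 < κ)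
    (hα : α ∈ Ioo (-1 : ℝ) 1) {F : ℝ → R3 → ℝ≥0∞} (hfin : solNorm p r α κ J F < ∞) {ε : ℝ≥0∞}
    (hε : 0 < ε) : ∃ d : ℝ, 0 < d ∧ ∀ I ⊆ J, MeasurableSet I → volume I ≤ ENNReal.ofReal d →
      solNorm p r α κ I F ≤ ε := by
  -- A failure for every length would give sets of measure at most `1/(n+1)` on which the norm stays
  -- above `ε`, against `tendsto_solNorm`.
  by_contra! hcon
  choose! I hI using fun n : ℕ => hcon (1 / (n + 1)) (by positivity)
  have hvol : Tendsto (fun n => volume (I n)) atTop (𝓝 0) := by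
    refine tendsto_of_tendsto_of_tendsto_of_le_of_le tendsto_const_nhds ?_ (fun _ => zero_le)
      (fun n => (hI n).2.2.1)
    have := ENNReal.tendsto_ofReal (tendsto_one_div_add_atTop_nhds_zero_nat (𝕜 := ℝ))
    rwa [ENNReal.ofReal_zero] at this
  have h1 := tendsto_solNorm hr hr' hκ hα hfin (fun n => (hI n).2.1)
    (Eventually.of_forall fun n => (hI n).1) hvol
  obtain ⟨n, hn⟩ := (h1.eventually (ge_mem_nhds hε)).exists
  exact absurd hn (not_le.2 (hI n).2.2.2)

theorem forced_congr (hJ : IsTimeInterval J) {V W : ℝ → R3 → Fin 4 → ℂ}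
    (h : ∀ᵐ τ ∂(volume.restrict J), V τ =ᵐ[volume] W τ) {t : ℝ} (ht : t ∈ J) :
    forced ν g Ω N (quad V) t = forced ν g Ω N (quad W) t := by
  ext1 ξ
  refine integral_congr_ae ?_
  filter_upwards [ae_restrict_of_ae_restrict_of_subset (hJ.Ioc_subset ht) h] with τ hτ
  rw [quad_congr hτ]

/-- The time axis is cut into slabs so short that both solutions have norm at most `1/(4 Λ)` on
each. Once they agree before a slab, their difference on it is at most half of itself, hence zero.
The solutions themselves need not be small. -/
theorem mild_unique (h : IsSetting p r α ν g Ω N c b M J) (hr' : r ≠ ∞)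
    {V₀ : R3 → Fin 4 → ℂ} {V W : ℝ → R3 → Fin 4 → ℂ}
    (hV : Measurable (Function.uncurry V)) (hW : Measurable (Function.uncurry W))
    (h1 : solNorm p r α (rate ν) J (size b c V) < ∞)
    (h2 : solNorm p r α (rate ν) J (size b c W) < ∞)
    (eV : ∀ t ∈ J, V t =ᵐ[volume] mild ν g Ω N V₀ V t)
    (eW : ∀ t ∈ J, W t =ᵐ[volume] mild ν g Ω N V₀ W t) {t : ℝ} (ht : t ∈ J) :
    V t =ᵐ[volume] W t := by
  have hΛ : lipConst p M α (rate ν) ≠ ∞ := ENNReal.mul_ne_top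
    (ENNReal.mul_ne_top ENNReal.ofNat_ne_top h.M_ne_top)
    (quadConst_lt_top h.one_lt_p h.alpha_mem.1).ne
  have hε : 0 < (4 * (lipConst p M α (rate ν)))⁻¹ :=
    ENNReal.inv_pos.2 (ENNReal.mul_ne_top ENNReal.ofNat_ne_top hΛ)
  obtain ⟨d₁, hd₁, hs₁⟩ := exists_solNorm_le_of_volume_le h.r_ne_zero hr' h.rate_pos h.alpha_mem'
    h1 hε
  obtain ⟨d₂, hd₂, hs₂⟩ := exists_solNorm_le_of_volume_le h.r_ne_zero hr' h.rate_pos h.alpha_mem'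
    h2 hε
  set d := min d₁ d₂ with hd
  have hd0 : 0 < d := lt_min hd₁ hd₂
  have hJm := h.interval.measurableSet
  have hae : ∀ n : ℕ, ∀ᵐ τ ∂(volume.restrict (J ∩ Iic (n * d))), V τ =ᵐ[volume] W τ := by
    intro n
    induction n with
    | zero =>
      have h0 : volume.restrict (J ∩ Iic (((0 : ℕ) : ℝ) * d)) = 0 := by
        rw [Measure.restrict_eq_zero]
        refine measure_mono_null (t := {0}) (fun x hx => ?_) (measure_singleton 0)
        have h3 := h.interval.nonneg x hx.1
        have h4 : x ≤ ((0 : ℕ) : ℝ) * d := hx.2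
        rw [Nat.cast_zero, zero_mul] at h4
        exact le_antisymm h4 h3
      rw [h0]
      exact ae_zero.symm ▸ trivial
    | succ n ih =>
      set I := J ∩ Ioc ((n : ℝ) * d) ((n + 1 : ℕ) * d) with hI
      have hIm : MeasurableSet I := hJm.inter measurableSet_Ioc
      have hIJ : I ⊆ J := inter_subset_left
      have hvol : volume I ≤ ENNReal.ofReal d := by
        refine (measure_mono inter_subset_right).trans_eq ?_
        rw [Real.volume_Ioc]
        congr 1
        push_cast
        ring
      have hz := measurable_uncurry_sub hV hW
      have hb := solNorm_size_mild_sub_le h hIm hIJ V₀ hV hW h1 h2 (by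
        intro t ht
        refine ae_of_all _ fun ξ => ?_
        have h3 : ∀ᵐ τ ∂(volume.restrict J), τ ∈ J ∩ Iic (n * d) → V τ =ᵐ[volume] W τ := by
          have := (ae_restrict_iff' (hJm.inter measurableSet_Iic)).1 ih
          exact ae_restrict_of_ae this
        filter_upwards [ae_restrict_of_ae_restrict_of_subset sdiff_subset h3,
          ae_restrict_mem (hJm.diff hIm)] with τ hτ hmem hle
        -- A time outside the slab but not later than a point of it lies before the slab, where the
        -- induction hypothesis applies.
        have : τ ≤ n * d := by
          by_contra hlt
          exact hmem.2 ⟨hmem.1, not_le.1 hlt, hle.trans ht.2.2⟩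
        rw [quad_congr (hτ ⟨hmem.1, this⟩)])
      have hfin : solNorm p r α (rate ν) I (size b c (V - W)) < ∞ := by
        refine (solNorm_mono_set hIJ _).trans_lt ((solNorm_mono (ae_of_all _ fun t =>
          ae_of_all _ fun ξ => size_sub_le V W t ξ)).trans_lt ?_)
        exact (solNorm_add_le h.one_lt_p.le h.one_le_r h.alpha_mem' (measurable_size hV)
          (measurable_size hW)).trans_lt (ENNReal.add_lt_top.2 ⟨h1, h2⟩)
      have hzero : solNorm p r α (rate ν) I (size b c (V - W)) = 0 := by
        have hle : solNorm p r α (rate ν) I (size b c (V - W)) ≤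
            2⁻¹ * solNorm p r α (rate ν) I (size b c (V - W)) := by
          calc solNorm p r α (rate ν) I (size b c (V - W))
              ≤ solNorm p r α (rate ν) I
                  (size b c (mild ν g Ω N V₀ V - mild ν g Ω N V₀ W)) := by
                refine solNorm_mono ?_
                filter_upwards [ae_restrict_mem hIm] with t ht
                filter_upwards [eV t (hIJ ht), eW t (hIJ ht)] with ξ a1 a2
                rw [size, size, Pi.sub_apply, Pi.sub_apply, Pi.sub_apply, Pi.sub_apply, ← a1, ← a2]
            _ ≤ _ := hb
            _ ≤ lipConst p M α (rate ν) * (((4 * (lipConst p M α (rate ν)))⁻¹ +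
                  (4 * (lipConst p M α (rate ν)))⁻¹) *
                  solNorm p r α (rate ν) I (size b c (V - W))) := by
                gcongr
                · exact hs₁ I hIJ hIm (hvol.trans (ENNReal.ofReal_le_ofReal (min_le_left _ _)))
                · exact hs₂ I hIJ hIm (hvol.trans (ENNReal.ofReal_le_ofReal (min_le_right _ _)))
            _ ≤ _ := by
                rw [← mul_assoc]
                refine mul_le_mul_left ?_ _
                rw [ENNReal.mul_inv (Or.inl (by norm_num)) (Or.inl (by norm_num)), ← add_mul,
                  mul_left_comm]
                have h4 : (4 : ℝ≥0∞)⁻¹ + 4⁻¹ = 2⁻¹ := by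
                  rw [show (4 : ℝ≥0∞) = 2 * 2 by norm_num,
                    ENNReal.mul_inv (Or.inl (by norm_num)) (Or.inl (by norm_num)), ← mul_add,
                    ENNReal.inv_two_add_inv_two, mul_one]
                rw [h4]
                exact mul_le_of_le_one_right zero_le (ENNReal.mul_inv_le_one _)
        -- The inequality `x ≤ x/2` forces `x = 0` only for finite `x`, which is why `hfin` is
        -- needed.
        by_contra hne
        refine absurd hle (not_le.2 ?_)
        calc 2⁻¹ * solNorm p r α (rate ν) I (size b c (V - W))
            < 1 * solNorm p r α (rate ν) I (size b c (V - W)) :=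
              (ENNReal.mul_lt_mul_iff_left hne hfin.ne).2 (by simp)
          _ = _ := one_mul _
      have h3 := ae_eq_of_solNorm_eq_zero h hV hW hzero
      have hcov : J ∩ Iic ((n + 1 : ℕ) * d) ⊆ (J ∩ Iic (n * d)) ∪ I := fun x hx => by
        rcases le_or_gt x (n * d) with hx' | hx'
        · exact Or.inl ⟨hx.1, hx'⟩
        · exact Or.inr ⟨hx.1, hx', hx.2⟩
      refine ae_restrict_of_ae_restrict_of_subset hcov ?_
      rw [ae_restrict_union_iff]
      exact ⟨ih, h3⟩
  have hall : ∀ᵐ τ ∂(volume.restrict J), V τ =ᵐ[volume] W τ := by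
    have : J = ⋃ n : ℕ, J ∩ Iic (n * d) := by
      refine Subset.antisymm (fun x hx => ?_) (iUnion_subset fun n => inter_subset_left)
      obtain ⟨n, hn⟩ := exists_nat_ge (x / d)
      exact mem_iUnion.2 ⟨n, hx, (div_le_iff₀ hd0).1 hn⟩
    rw [this, ae_restrict_iUnion_iff]
    exact hae
  -- Agreement at almost every time is upgraded to the given `t` by the equation, whose right-hand
  -- side sees only almost every time.
  filter_upwards [eV t ht, eW t ht] with ξ a1 a2
  rw [a1, a2, mild, mild, forced_congr h.interval hall ht]

end PrimitiveEq

namespace PrimitiveEq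

/-! ### Regularity in time of solutions of the integral equation -/

variable {p r M : ℝ≥0∞} {α ν g Ω N c b κ : ℝ} {J I : Set ℝ} {V₀ : R3 → Fin 4 → ℂ}
  {V A : ℝ → R3 → Fin 4 → ℂ}

/-- The total size of the data and of the forcing. -/
noncomputable def budget (b c : ℝ) (J : Set ℝ) (V₀ : R3 → Fin 4 → ℂ) (A : ℝ → R3 → Fin 4 → ℂ)
    (ξ : R3) : ℝ≥0∞ := wn c (V₀ ξ) + ∫⁻ τ in J, size b c A τ ξ

theorem measurable_wn_comp (hV₀ : Measurable V₀) : Measurable fun ξ => wn c (V₀ ξ) :=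
  (continuous_wn c).measurable.comp hV₀

theorem measurable_lintegral_size (hA : Measurable (Function.uncurry A)) (I : Set ℝ) :
    Measurable fun ξ => ∫⁻ τ in I, size b c A τ ξ :=
  Measurable.lintegral_prod_left (f := size b c A) (measurable_size hA)

theorem measurable_budget (hV₀ : Measurable V₀) (hA : Measurable (Function.uncurry A)) :
    Measurable (budget b c J V₀ A) :=
  (measurable_wn_comp hV₀).add (measurable_lintegral_size hA J)

/-- The bound is uniform in `t` and its right-hand side has finite critical norm, so it serves as
the dominating function for limits in time, with the parabolic weight included. -/
theorem size_mild_le_budget (h : IsSetting p r α ν g Ω N c b M J) {t : ℝ} (ht : t ∈ J) (ξ : R3) :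
    size b c (mild ν g Ω N V₀ V) t ξ ≤ M * budget b c J V₀ (quad V) ξ := by
  have h1 := size_heat_le (V₀ := V₀) h.decay rfl h.b_nonneg h.b_le ht ξ
  have h2 := size_forced_le h.interval h.M_ne_top h.decay rfl h.b_nonneg h.b_le (quad V) ht ξ
  have h3 := h.nu_pos.le
  have hk : 0 ≤ rate ν := h.rate_pos.le
  rw [budget, mul_add]
  refine (size_sub_le (fun t ξ => semigroup ν ν g Ω N t ξ *ᵥ V₀ ξ)
    (forced ν g Ω N (quad V)) t ξ).trans (add_le_add (h1.trans ?_) (h2.trans ?_))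
  · exact mul_le_mul_right (mul_le_of_le_one_left zero_le (decay_le_one (by positivity) t)) _
  · exact mul_le_mul_right (duhamel_le _ hk J _ t ξ) _

theorem annNorm_add_le (hp : 1 ≤ p) (j : ℤ) {f f' : R3 → ℝ≥0∞} (hf : Measurable f)
    (hf' : Measurable f') : annNorm p j (fun ξ => f ξ + f' ξ) ≤ annNorm p j f + annNorm p j f' :=
  eLpNorm_add_le hf.aestronglyMeasurable hf'.aestronglyMeasurable hp

theorem annNorm_lintegral_size_le (hp : 1 ≤ p) (hA : Measurable (Function.uncurry A)) (I : Set ℝ)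
    (j : ℤ) : annNorm p j (fun ξ => ∫⁻ τ in I, size b c A τ ξ) ≤
      ∫⁻ τ in I, annNorm p j (size b c A τ) :=
  eLpNorm_lintegral_le _ _ (measurable_size hA) hp

theorem spaceNorm_budget_lt_top (h : IsSetting p r α ν g Ω N c b M J) (hV₀ : Measurable V₀)
    (hfin₀ : spaceNorm p r (critIndex p) (fun ξ => wn c (V₀ ξ)) < ∞)
    (hA : Measurable (Function.uncurry A)) (hfin : forceNorm p r J (size b c A) < ∞) :
    spaceNorm p r (critIndex p) (budget b c J V₀ A) < ∞ := by
  have hle : spaceNorm p r (critIndex p) (budget b c J V₀ A) ≤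
      spaceNorm p r (critIndex p) (fun ξ => wn c (V₀ ξ)) + forceNorm p r J (size b c A) := by
    refine le_trans ?_ (eLpNorm_add_le (measurable_of_countable _).aestronglyMeasurable
      (measurable_of_countable _).aestronglyMeasurable h.one_le_r)
    refine eLpNorm_mono_enorm fun j => ?_
    simp only [enorm_eq_self, Pi.add_apply]
    rw [← mul_add]
    refine mul_le_mul_right ((annNorm_add_le h.one_lt_p.le j (measurable_wn_comp hV₀)
      (measurable_lintegral_size hA J)).trans (add_le_add_right ?_ _)) _
    rw [eLpNorm_one_eq_lintegral_enorm]
    exact annNorm_lintegral_size_le h.one_lt_p.le hA J j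
  exact hle.trans_lt (ENNReal.add_lt_top.2 ⟨hfin₀, hfin⟩)

theorem annNorm_lt_top_of_spaceNorm (hr : r ≠ 0) {s : ℝ} {f : R3 → ℝ≥0∞}
    (h : spaceNorm p r s f < ∞) (j : ℤ) : annNorm p j f < ∞ := by
  have h1 := (le_eLpNorm_count (fun j : ℤ => (2 : ℝ≥0∞) ^ ((j : ℝ) * s) * annNorm p j f)
    hr j).trans_lt h
  exact ENNReal.lt_top_of_mul_ne_top_right h1.ne (two_rpow_ne_zero _)

theorem lintegral_annNorm_lt_top (hr : r ≠ 0) {F : ℝ → R3 → ℝ≥0∞} (h : forceNorm p r J F < ∞)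
    (j : ℤ) : ∫⁻ τ in J, annNorm p j (F τ) < ∞ := by
  have h1 := (le_eLpNorm_count (fun j : ℤ => (2 : ℝ≥0∞) ^ ((j : ℝ) * critIndex p) *
    eLpNorm (fun t => annNorm p j (F t)) 1 (volume.restrict J)) hr j).trans_lt h
  have h2 := ENNReal.lt_top_of_mul_ne_top_right h1.ne (two_rpow_ne_zero _)
  simpa [eLpNorm_one_eq_lintegral_enorm] using h2

theorem enorm_semigroup_sub_le {C R : ℝ} {j : ℤ} (hc : 0 < c)
    (hC : ∀ ξ ∈ annulus j, ∀ t ∈ Icc 0 R, ∀ t' ∈ Icc 0 R, ∀ x : Fin 4 → ℂ,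
      ‖semigroup ν ν g Ω N t ξ *ᵥ x - semigroup ν ν g Ω N t' ξ *ᵥ x‖ ≤ C * |t - t'| * ‖x‖)
    (hC0 : 0 ≤ C) {ξ : R3} (hξ : ξ ∈ annulus j) {t t' : ℝ} (ht : t ∈ Icc 0 R) (ht' : t' ∈ Icc 0 R)
    (x : Fin 4 → ℂ) :
    ‖semigroup ν ν g Ω N t ξ *ᵥ x - semigroup ν ν g Ω N t' ξ *ᵥ x‖ₑ ≤
      ENNReal.ofReal (C * (1 + c⁻¹)) * (ENNReal.ofReal |t - t'| * wn c x) := by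
  have h1 := ENNReal.ofReal_le_ofReal (hC ξ hξ t ht t' ht' x)
  rw [ofReal_norm, ENNReal.ofReal_mul (by positivity), ENNReal.ofReal_mul hC0, ofReal_norm] at h1
  refine h1.trans ((mul_le_mul_right (enorm_le_wn hc x) _).trans_eq ?_)
  rw [ENNReal.ofReal_mul hC0]
  ring

/-- On an annulus the generator is bounded, so the semigroup is Lipschitz in time there. The
remaining contribution is the forcing between the two times, and the null set of frequencies is
chosen before the times. -/
theorem exists_enorm_mild_sub_le (h : IsSetting p r α ν g Ω N c b M J)
    (hV : Measurable (Function.uncurry V))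
    (hfin : forceNorm p r J (size b c (quad V)) < ∞) (j : ℤ) (R : ℝ) :
    ∃ K : ℝ≥0∞, K ≠ ∞ ∧ ∀ᵐ ξ, ξ ∈ annulus j → ∀ t ∈ J, ∀ t' ∈ J, t ≤ t' → t' ≤ R →
      ‖mild ν g Ω N V₀ V t' ξ - mild ν g Ω N V₀ V t ξ‖ₑ ≤
        K * (ENNReal.ofReal |t' - t| * budget b c J V₀ (quad V) ξ +
          ∫⁻ τ in uIoc t t', size b c (quad V) τ ξ) := by
  obtain ⟨C, hC0, hC⟩ := exists_semigroup_lipschitz ν g Ω N h.nu_pos.le j R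
  set K₁ := ENNReal.ofReal (C * (1 + c⁻¹)) with hK₁
  set K₂ := ENNReal.ofReal (1 + c⁻¹) * M with hK₂
  have hK₂' : K₂ ≠ ∞ := ENNReal.mul_ne_top ENNReal.ofReal_ne_top h.M_ne_top
  refine ⟨K₁ + K₂, ENNReal.add_ne_top.2 ⟨ENNReal.ofReal_ne_top, hK₂'⟩, ?_⟩
  have hA := measurable_quad hV
  filter_upwards [lintegral_wn_lt_top h hA hfin] with ξ hξ hmem t ht t' ht' htt' hR
  have h0t := h.interval.nonneg t ht
  have hi := integrableOn_semigroup_mulVec h.interval h.c_pos h.nu_pos.le h.M_ne_top h.decay hA hξ ht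
  have hi' := integrableOn_semigroup_mulVec h.interval h.c_pos h.nu_pos.le h.M_ne_top h.decay hA
    hξ ht'
  have hun : Ioc 0 t' = Ioc 0 t ∪ Ioc t t' := (Ioc_union_Ioc_eq_Ioc h0t htt').symm
  rw [hun] at hi'
  have hi1 := hi'.left_of_union
  have hi2 := hi'.right_of_union
  -- Three contributions: the change of the semigroup on the data, its change on the past forcing,
  -- and the forcing that is new on `(t, t']`.
  have hsplit : mild ν g Ω N V₀ V t' ξ - mild ν g Ω N V₀ V t ξ =
      (semigroup ν ν g Ω N t' ξ *ᵥ V₀ ξ - semigroup ν ν g Ω N t ξ *ᵥ V₀ ξ) -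
      (∫ τ in Ioc 0 t, (semigroup ν ν g Ω N (t' - τ) ξ *ᵥ quad V τ ξ -
        semigroup ν ν g Ω N (t - τ) ξ *ᵥ quad V τ ξ)) -
      ∫ τ in Ioc t t', semigroup ν ν g Ω N (t' - τ) ξ *ᵥ quad V τ ξ := by
    rw [mild, mild, forced, forced, integral_sub hi1 hi, hun,
      setIntegral_union (Ioc_disjoint_Ioc_of_le le_rfl) measurableSet_Ioc hi1 hi2]
    abel
  rw [hsplit]
  refine (enorm_sub_le.trans (add_le_add_left enorm_sub_le _)).trans ?_
  have e1 : ‖semigroup ν ν g Ω N t' ξ *ᵥ V₀ ξ - semigroup ν ν g Ω N t ξ *ᵥ V₀ ξ‖ₑ ≤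
      K₁ * (ENNReal.ofReal |t' - t| * wn c (V₀ ξ)) :=
    enorm_semigroup_sub_le h.c_pos hC hC0 hmem ⟨h0t.trans htt', hR⟩ ⟨h0t, htt'.trans hR⟩ _
  have e2 : ‖∫ τ in Ioc 0 t, (semigroup ν ν g Ω N (t' - τ) ξ *ᵥ quad V τ ξ -
        semigroup ν ν g Ω N (t - τ) ξ *ᵥ quad V τ ξ)‖ₑ ≤
      K₁ * (ENNReal.ofReal |t' - t| * ∫⁻ τ in J, size b c (quad V) τ ξ) := by
    refine (enorm_integral_le_lintegral_enorm _).trans ?_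
    rw [← lintegral_const_mul' _ _ ENNReal.ofReal_ne_top,
      ← lintegral_const_mul' _ _ ENNReal.ofReal_ne_top]
    refine le_trans ?_ (lintegral_mono_set (h.interval.Ioc_subset ht))
    refine setLIntegral_mono' measurableSet_Ioc fun τ hτ => ?_
    have h3 := enorm_semigroup_sub_le h.c_pos hC hC0 hmem (t := t' - τ) (t' := t - τ)
      ⟨by linarith [hτ.2], by linarith [hτ.1]⟩ ⟨by linarith [hτ.2], by linarith [hτ.1]⟩
      (quad V τ ξ)
    rw [sub_sub_sub_cancel_right] at h3
    exact h3.trans (mul_le_mul_right (mul_le_mul_right (wn_le_size _ _ _) _) _)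
  have e3 : ‖∫ τ in Ioc t t', semigroup ν ν g Ω N (t' - τ) ξ *ᵥ quad V τ ξ‖ₑ ≤
      K₂ * ∫⁻ τ in uIoc t t', size b c (quad V) τ ξ := by
    refine (enorm_integral_le_lintegral_enorm _).trans ?_
    rw [← lintegral_const_mul' _ _ hK₂', uIoc_of_le htt']
    refine setLIntegral_mono' measurableSet_Ioc fun τ hτ => ?_
    rw [hK₂, mul_assoc]
    refine (enorm_le_wn h.c_pos _).trans (mul_le_mul_right ((wn_semigroup_le h.decay h.nu_pos.le
      ?_ ξ _).trans (mul_le_mul_right (wn_le_size _ _ _) _)) _)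
    exact h.interval.Icc_subset t' ht' ⟨by linarith [hτ.2], by linarith [hτ.1]⟩
  refine (add_le_add (add_le_add e1 e2) e3).trans ?_
  rw [← mul_add, ← mul_add, ← budget, mul_add]
  exact add_le_add (mul_le_mul_left le_self_add _) (mul_le_mul_left le_add_self _)

theorem tendsto_annNorm_mild_sub (h : IsSetting p r α ν g Ω N c b M J)
    (hV₀ : Measurable V₀) (hV : Measurable (Function.uncurry V))
    (hfin₀ : spaceNorm p r (critIndex p) (fun ξ => wn c (V₀ ξ)) < ∞)
    (hfin : forceNorm p r J (size b c (quad V)) < ∞) (j : ℤ) {t : ℝ} (ht : t ∈ J) :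
    Tendsto (fun t' => annNorm p j fun ξ =>
      ‖mild ν g Ω N V₀ V t' ξ - mild ν g Ω N V₀ V t ξ‖ₑ) (𝓝[J] t) (𝓝 0) := by
  have hA := measurable_quad hV
  -- The Lipschitz constant needs a finite horizon; for a limit at `t` the horizon `t + 1` is
  -- enough.
  obtain ⟨K, hK, hle⟩ := exists_enorm_mild_sub_le (V₀ := V₀) h hV hfin j (t + 1)
  have hbud := annNorm_lt_top_of_spaceNorm h.r_ne_zero
    (spaceNorm_budget_lt_top h hV₀ hfin₀ hA hfin) j
  have hint := lintegral_annNorm_lt_top h.r_ne_zero hfin j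
  set E := annNorm p j (budget b c J V₀ (quad V)) with hE
  have hp0 := h.p_ne_zero
  have hmB := measurable_budget (b := b) (c := c) (J := J) hV₀ hA
  have hbound : ∀ t' ∈ J, t' ≤ t + 1 → annNorm p j (fun ξ =>
      ‖mild ν g Ω N V₀ V t' ξ - mild ν g Ω N V₀ V t ξ‖ₑ) ≤
      K * (ENNReal.ofReal |t' - t| * E + ∫⁻ τ in uIoc t t', annNorm p j (size b c (quad V) τ)) := by
    intro t' ht' hR
    have h1 : annNorm p j (fun ξ => ‖mild ν g Ω N V₀ V t' ξ - mild ν g Ω N V₀ V t ξ‖ₑ) ≤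
        annNorm p j (fun ξ => K * (ENNReal.ofReal |t' - t| * budget b c J V₀ (quad V) ξ +
          ∫⁻ τ in uIoc t t', size b c (quad V) τ ξ)) := by
      refine annNorm_mono ((ae_restrict_iff' (measurableSet_annulus j)).2 ?_)
      filter_upwards [hle] with ξ hξ hmem
      rcases le_total t t' with htt' | htt'
      · exact hξ hmem t ht t' ht' htt' hR
      · have := hξ hmem t' ht' t ht htt' (by linarith)
        rwa [uIoc_comm, abs_sub_comm, ← edist_eq_enorm_sub, edist_comm, edist_eq_enorm_sub] at this
    refine h1.trans ?_
    have hm1 : Measurable fun ξ => ENNReal.ofReal |t' - t| * budget b c J V₀ (quad V) ξ :=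
      hmB.const_mul _
    have hm2 := measurable_lintegral_size (b := b) (c := c) hA (uIoc t t')
    rw [annNorm_const_mul hp0 j K (f := fun ξ => ENNReal.ofReal |t' - t| *
      budget b c J V₀ (quad V) ξ + ∫⁻ τ in uIoc t t', size b c (quad V) τ ξ)
      (hm1.add hm2).aemeasurable]
    refine mul_le_mul_right ((annNorm_add_le h.one_lt_p.le j hm1 hm2).trans ?_) K
    rw [annNorm_const_mul hp0 j _ hmB.aemeasurable]
    exact add_le_add_right (annNorm_lintegral_size_le h.one_lt_p.le hA _ j) _
  have habs : Tendsto (fun t' => ENNReal.ofReal |t' - t|) (𝓝[J] t) (𝓝 0) := by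
    have h1 : Tendsto (fun t' : ℝ => |t' - t|) (𝓝[J] t) (𝓝 0) := by
      have : Tendsto (fun t' : ℝ => |t' - t|) (𝓝 t) (𝓝 |t - t|) :=
        (Continuous.abs (by fun_prop)).tendsto t
      rw [sub_self, abs_zero] at this
      exact this.mono_left nhdsWithin_le_nhds
    simpa using ENNReal.tendsto_ofReal h1
  have hsub : ∀ t' ∈ J, uIoc t t' ⊆ J := fun t' ht' x hx => by
    have hx2 : x ≤ max t t' := hx.2
    have hx1 : min t t' < x := hx.1
    have hmax : max t t' ∈ J := by
      rcases max_choice t t' with e | e <;> rw [e] <;> assumption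
    have hmin : 0 ≤ min t t' := le_min (h.interval.nonneg t ht) (h.interval.nonneg t' ht')
    exact h.interval.Icc_subset _ hmax ⟨hmin.trans hx1.le, hx2⟩
  have hI : Tendsto (fun t' => ∫⁻ τ in uIoc t t', annNorm p j (size b c (quad V) τ))
      (𝓝[J] t) (𝓝 0) := by
    have h1 : Tendsto (fun t' => (volume.restrict J) (uIoc t t')) (𝓝[J] t) (𝓝 0) := by
      refine tendsto_of_tendsto_of_tendsto_of_le_of_le tendsto_const_nhds habs
        (fun _ => zero_le) (fun t' => (Measure.restrict_apply_le _ _).trans_eq ?_)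
      rw [uIoc, Real.volume_Ioc, max_sub_min_eq_abs']
      rw [abs_sub_comm]
    refine (tendsto_setLIntegral_zero hint.ne h1).congr' ?_
    filter_upwards [self_mem_nhdsWithin] with t' ht'
    rw [Measure.restrict_restrict measurableSet_uIoc, inter_eq_self_of_subset_left (hsub t' ht')]
  have hlim : Tendsto (fun t' => K * (ENNReal.ofReal |t' - t| * E +
      ∫⁻ τ in uIoc t t', annNorm p j (size b c (quad V) τ))) (𝓝[J] t) (𝓝 0) := by
    have h1 := ENNReal.Tendsto.const_mul (a := K)
      ((ENNReal.Tendsto.mul_const habs (Or.inr hbud.ne)).add hI) (Or.inr hK)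
    rwa [zero_mul, add_zero, mul_zero] at h1
  refine tendsto_of_tendsto_of_tendsto_of_le_of_le' tendsto_const_nhds hlim
    (Eventually.of_forall fun _ => zero_le) ?_
  filter_upwards [self_mem_nhdsWithin, nhdsWithin_le_nhds (Iic_mem_nhds (show t < t + 1 by linarith))]
    with t' ht' hR
  exact hbound t' ht' hR

/-! ### Parabolic smoothing -/

/-- For `0 ≤ s - critIndex p ≤ 2` the extra weight is at most `1 + |ξ|²` on the annulus, and after
time `t₀` this is at most a multiple of `1 + b t |ξ|²`. At the critical order nothing has to be
gained, so `b = 0` and `t₀ = 0` are allowed. -/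
theorem exists_two_rpow_le_growth {s t₀ : ℝ}
    (hs : s = critIndex p ∨ (0 < b ∧ 0 < t₀ ∧ critIndex p ≤ s ∧ s ≤ critIndex p + 2)) :
    ∃ K : ℝ≥0∞, K ≠ ∞ ∧ ∀ t, t₀ ≤ t → ∀ j : ℤ, ∀ ξ ∈ annulus j,
      (2 : ℝ≥0∞) ^ ((j : ℝ) * s) ≤ K * 2 ^ ((j : ℝ) * critIndex p) * growth b t ξ := by
  rcases hs with rfl | ⟨hb, ht₀, h1, h2⟩
  · refine ⟨1, ENNReal.one_ne_top, fun t _ j ξ _ => ?_⟩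
    rw [one_mul]
    exact le_mul_of_one_le_right zero_le (one_le_growth b t ξ)
  · refine ⟨1 + ENNReal.ofReal (b * t₀)⁻¹, ENNReal.add_ne_top.2
      ⟨ENNReal.one_ne_top, ENNReal.ofReal_ne_top⟩, fun t ht j ξ hξ => ?_⟩
    have hbt : 0 < b * t₀ := by positivity
    have e : (2 : ℝ≥0∞) ^ ((j : ℝ) * s) =
        2 ^ ((j : ℝ) * (s - critIndex p)) * 2 ^ ((j : ℝ) * critIndex p) := by
      rw [← two_rpow_add]; congr 1; ring
    rw [e, mul_right_comm]
    refine mul_le_mul_left ?_ _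
    have h3 : (2 : ℝ≥0∞) ^ ((j : ℝ) * (s - critIndex p)) ≤ 1 + ENNReal.ofReal (‖ξ‖ ^ 2) := by
      rcases le_total (j : ℝ) 0 with hj | hj
      · refine le_trans ?_ le_self_add
        exact (ENNReal.rpow_le_rpow_of_exponent_le (by norm_num)
          (mul_nonpos_of_nonpos_of_nonneg hj (sub_nonneg.2 h1))).trans_eq ENNReal.rpow_zero
      · refine le_trans ?_ le_add_self
        have h4 : (2 : ℝ≥0∞) ^ ((j : ℝ) * (s - critIndex p)) ≤ 2 ^ ((j : ℝ) * 2) :=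
          ENNReal.rpow_le_rpow_of_exponent_le (by norm_num) (by gcongr; linarith)
        refine h4.trans ?_
        rw [two_rpow_eq_ofReal]
        refine ENNReal.ofReal_le_ofReal ?_
        have h5 := hξ.1
        rw [Real.rpow_mul two_pos.le, Real.rpow_intCast]
        norm_num
        gcongr
    refine h3.trans ?_
    have h6 : ENNReal.ofReal (‖ξ‖ ^ 2) ≤
        ENNReal.ofReal (b * t₀)⁻¹ * ENNReal.ofReal (b * t * ‖ξ‖ ^ 2) := by
      rw [← ENNReal.ofReal_mul (by positivity)]
      refine ENNReal.ofReal_le_ofReal ?_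
      rw [← div_eq_inv_mul, le_div_iff₀ hbt]
      have : b * t₀ ≤ b * t := by gcongr
      nlinarith [sq_nonneg ‖ξ‖]
    rw [growth]
    set k := ENNReal.ofReal (b * t₀)⁻¹
    set G := ENNReal.ofReal (b * t * ‖ξ‖ ^ 2)
    refine (add_le_add_right h6 1).trans ?_
    have e2 : (1 + k) * (1 + G) = 1 + k * G + (k + G) := by ring
    rw [e2]
    exact le_self_add

/-- The weighted size of the solution on an annulus is controlled by the data, for positive
times with a gain of up to two derivatives. -/
theorem exists_two_rpow_mul_annNorm_le (h : IsSetting p r α ν g Ω N c b M J) {s t₀ : ℝ}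
    (hs : s = critIndex p ∨ (0 < b ∧ 0 < t₀ ∧ critIndex p ≤ s ∧ s ≤ critIndex p + 2))
    (hV₀ : Measurable V₀) (hV : Measurable (Function.uncurry V)) :
    ∃ K : ℝ≥0∞, K ≠ ∞ ∧ ∀ t ∈ J, t₀ ≤ t → ∀ j : ℤ,
      2 ^ ((j : ℝ) * s) * annNorm p j (fun ξ => wn c (mild ν g Ω N V₀ V t ξ)) ≤
        K * (2 ^ ((j : ℝ) * critIndex p) * annNorm p j (budget b c J V₀ (quad V))) := by
  have hmB := measurable_budget (b := b) (c := c) (J := J) hV₀ (measurable_quad hV)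
  obtain ⟨K, hK, hle⟩ := exists_two_rpow_le_growth (p := p) hs
  refine ⟨K * M, ENNReal.mul_ne_top hK h.M_ne_top, fun t ht ht₀ j => ?_⟩
  have hmm := measurable_wn_comp (c := c) (V₀ := mild ν g Ω N V₀ V t)
    (measurable_mild hV₀ hV).of_uncurry_left
  rw [← annNorm_const_mul h.p_ne_zero j _ hmm.aemeasurable,
    ← annNorm_const_mul h.p_ne_zero j _ hmB.aemeasurable,
    ← annNorm_const_mul h.p_ne_zero j _ (hmB.const_mul _).aemeasurable]
  refine annNorm_mono ((ae_restrict_iff' (measurableSet_annulus j)).2 (ae_of_all _ fun ξ hξ => ?_))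
  calc 2 ^ ((j : ℝ) * s) * wn c (mild ν g Ω N V₀ V t ξ)
      ≤ K * 2 ^ ((j : ℝ) * critIndex p) * growth b t ξ * wn c (mild ν g Ω N V₀ V t ξ) :=
        mul_le_mul_left (hle t ht₀ j ξ hξ) _
    _ = K * 2 ^ ((j : ℝ) * critIndex p) * size b c (mild ν g Ω N V₀ V) t ξ := by
        rw [size]; ring
    _ ≤ K * 2 ^ ((j : ℝ) * critIndex p) * (M * budget b c J V₀ (quad V) ξ) :=
        mul_le_mul_right (size_mild_le_budget h ht ξ) _
    _ = _ := by ring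

/-- The solution takes values in the Fourier-Besov spaces and is continuous there. -/
theorem spaceNorm_mild (h : IsSetting p r α ν g Ω N c b M J) (hr' : r ≠ ∞) {s t : ℝ}
    (hs : s = critIndex p ∨ (0 < b ∧ 0 < t ∧ critIndex p ≤ s ∧ s ≤ critIndex p + 2))
    (hV₀ : Measurable V₀) (hV : Measurable (Function.uncurry V))
    (hfin₀ : spaceNorm p r (critIndex p) (fun ξ => wn c (V₀ ξ)) < ∞)
    (hfin : forceNorm p r J (size b c (quad V)) < ∞) (ht : t ∈ J) (a : Fin 4) :
    spaceNorm p r s (fun ξ => ‖mild ν g Ω N V₀ V t ξ a‖ₑ) < ∞ ∧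
    Tendsto (fun t' => spaceNorm p r s fun ξ =>
      ‖mild ν g Ω N V₀ V t' ξ a - mild ν g Ω N V₀ V t ξ a‖ₑ) (𝓝[J] t) (𝓝 0) := by
  have hbud := spaceNorm_budget_lt_top h hV₀ hfin₀ (measurable_quad hV) hfin
  -- The threshold `t / 2` makes the bound uniform in a neighbourhood of `t`. At `t = 0` it is zero
  -- and every time in `J` passes it.
  obtain ⟨K, hK, hle⟩ := exists_two_rpow_mul_annNorm_le (V₀ := V₀) h (t₀ := t / 2)
    (hs.imp_right fun ⟨h1, h2, h3⟩ => ⟨h1, by positivity, h3⟩) hV₀ hV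
  set L := ENNReal.ofReal (1 + c⁻¹) with hL
  set B : ℤ → ℝ≥0∞ := fun j => 2 ^ ((j : ℝ) * critIndex p) *
    annNorm p j (budget b c J V₀ (quad V)) with hB
  have hmt : ∀ t, Measurable (mild ν g Ω N V₀ V t) := fun t =>
    (measurable_mild hV₀ hV).of_uncurry_left
  have hle' : ∀ t' ∈ J, t / 2 ≤ t' → ∀ j : ℤ,
      2 ^ ((j : ℝ) * s) * annNorm p j (fun ξ => ‖mild ν g Ω N V₀ V t' ξ a‖ₑ) ≤
        L * (K * B j) := fun t' ht' htt' j => by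
    refine le_trans ?_ (mul_le_mul_right (hle t' ht' htt' j) L)
    rw [mul_left_comm, ← annNorm_const_mul h.p_ne_zero j L
      (measurable_wn_comp (hmt t')).aemeasurable]
    exact mul_le_mul_right (annNorm_mono (ae_of_all _ fun ξ => enorm_apply_le_wn h.c_pos _ a)) _
  have ht0 := h.interval.nonneg t ht
  have hconst : ∀ C : ℝ≥0∞, C ≠ ∞ → eLpNorm (fun j => C * B j) r Measure.count < ∞ :=
    fun C hC => by
      rw [eLpNorm_const_mul_count h.r_ne_zero]
      exact ENNReal.mul_lt_top hC.lt_top hbud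
  have hLK : L * K ≠ ∞ := ENNReal.mul_ne_top ENNReal.ofReal_ne_top hK
  refine ⟨?_, ?_⟩
  · refine (eLpNorm_mono_enorm fun j => ?_).trans_lt (hconst (L * K) hLK)
    simp only [enorm_eq_self]
    rw [mul_assoc L K]
    exact hle' t ht (by linarith) j
  · refine tendsto_eLpNorm_count h.r_ne_zero hr' (hconst (2 * (L * K))
      (ENNReal.mul_ne_top ENNReal.ofNat_ne_top hLK)) ?_ fun j => ?_
    · have hev : ∀ᶠ t' in 𝓝[J] t, t / 2 ≤ t' := by
        rcases ht0.eq_or_lt with rfl | hpos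
        · filter_upwards [self_mem_nhdsWithin] with t' ht'
          simpa using h.interval.nonneg t' ht'
        · exact nhdsWithin_le_nhds (Ici_mem_nhds (by linarith))
      filter_upwards [self_mem_nhdsWithin, hev] with t' ht' htt' j
      have h1 := hle' t' ht' htt' j
      have h2 := hle' t ht (by linarith) j
      have hm : ∀ t, Measurable fun ξ => ‖mild ν g Ω N V₀ V t ξ a‖ₑ := fun t =>
        ((measurable_pi_apply a).comp (hmt t)).enorm
      calc _ ≤ 2 ^ ((j : ℝ) * s) * (annNorm p j (fun ξ => ‖mild ν g Ω N V₀ V t' ξ a‖ₑ) +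
            annNorm p j (fun ξ => ‖mild ν g Ω N V₀ V t ξ a‖ₑ)) := by
              refine mul_le_mul_right (le_trans ?_
                (annNorm_add_le h.one_lt_p.le j (hm t') (hm t))) _
              exact annNorm_mono (ae_of_all _ fun ξ => enorm_sub_le)
        _ ≤ L * (K * B j) + L * (K * B j) := by rw [mul_add]; exact add_le_add h1 h2
        _ = _ := by ring
    · have h1 := tendsto_annNorm_mild_sub h hV₀ hV hfin₀ hfin j ht
      have h2 : Tendsto (fun t' => annNorm p j fun ξ =>
          ‖mild ν g Ω N V₀ V t' ξ a - mild ν g Ω N V₀ V t ξ a‖ₑ) (𝓝[J] t) (𝓝 0) := by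
        refine tendsto_of_tendsto_of_tendsto_of_le_of_le tendsto_const_nhds h1 (fun _ => zero_le)
          fun t' => annNorm_mono (ae_of_all _ fun ξ => ?_)
        rw [← ofReal_norm, ← ofReal_norm]
        exact ENNReal.ofReal_le_ofReal (norm_le_pi_norm (mild ν g Ω N V₀ V t' ξ -
          mild ν g Ω N V₀ V t ξ) a)
      have h3 := ENNReal.Tendsto.const_mul h2 (Or.inr (two_rpow_ne_top ((j : ℝ) * s)))
      rwa [mul_zero] at h3

end PrimitiveEq

namespace PrimitiveEq

/-! ### Strong measurability of continuous functions -/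

variable {p r M : ℝ≥0∞} {α ν g Ω N c b κ : ℝ} {J I : Set ℝ} {V₀ : R3 → Fin 4 → ℂ}
  {V W : ℝ → R3 → Fin 4 → ℂ} {L : LittlewoodPaley}

theorem spaceNorm_mono {s : ℝ} {f f' : R3 → ℝ≥0∞} (h : ∀ᵐ ξ, f ξ ≤ f' ξ) :
    spaceNorm p r s f ≤ spaceNorm p r s f' :=
  eLpNorm_mono_enorm fun j => by
    simp only [enorm_eq_self]
    exact mul_le_mul_right (annNorm_mono (ae_restrict_of_ae h)) _

theorem spaceNorm_const_mul (hp : p ≠ 0) (hr : r ≠ 0) {s : ℝ} (C : ℝ≥0∞) {f : R3 → ℝ≥0∞}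
    (hf : Measurable f) : spaceNorm p r s (fun ξ => C * f ξ) = C * spaceNorm p r s f := by
  rw [spaceNorm, spaceNorm, ← eLpNorm_const_mul_count hr]
  congr 1
  ext j
  rw [annNorm_const_mul hp j C hf.aemeasurable, mul_left_comm]

theorem spaceNorm_tsum_le {ι : Type*} [Countable ι] (hp : 1 ≤ p) (hr : 1 ≤ r) {s : ℝ}
    {f : ι → R3 → ℝ≥0∞} (hf : ∀ i, Measurable (f i)) :
    spaceNorm p r s (fun ξ => ∑' i, f i ξ) ≤ ∑' i, spaceNorm p r s (f i) := by
  refine le_trans ?_ (eLpNorm_tsum_le Measure.count (fun i => measurable_of_countable _) hr)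
  refine eLpNorm_mono_enorm fun j => ?_
  simp only [enorm_eq_self]
  rw [ENNReal.tsum_mul_left]
  exact mul_le_mul_right (eLpNorm_tsum_le _ hf hp) _

theorem wn_le_tsum (c : ℝ) (x : Fin 4 → ℂ) :
    wn c x ≤ ENNReal.ofReal (1 + |c|) * ∑' a, ‖x a‖ₑ := by
  rw [wn_le_iff]
  intro a
  rw [enorm_mul]
  refine mul_le_mul' ?_ (ENNReal.le_tsum a)
  rw [← ofReal_norm, Complex.norm_real, Real.norm_eq_abs]
  refine ENNReal.ofReal_le_ofReal ?_
  induction a using Fin.lastCases with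
  | last => rw [weight_last]; linarith [abs_nonneg c]
  | cast k => rw [weight_castSucc, abs_one]; linarith [abs_nonneg c]

theorem fbNorm_zero (hp : 1 ≤ p) (hr : 1 ≤ r) (s : ℝ) : fbNorm L s p r 0 = 0 := by
  refine nonpos_iff_eq_zero.1 ((IsFourierTransform.zero.fbNorm_le L hp hr s).trans_eq ?_)
  have h := spaceNorm_const_mul (p := p) (r := r) (s := s) (zero_lt_one.trans_le hp).ne'
    (zero_lt_one.trans_le hr).ne' 0 (f := fun _ => 0) measurable_const
  simp only [mul_zero, zero_mul] at h
  simp only [enorm_zero]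
  rw [h, mul_zero]

/-- The index of the grid point below `t`, on the grid with mesh `1 / n`. -/
noncomputable def gridIndex (hJ : IsTimeInterval J) (n : ℕ) : SimpleFunc ℝ ℕ :=
  haveI := Classical.decPred (· ∈ J ∩ Iic (n : ℝ))
  have hm : Measurable fun t : ℝ => if t ∈ J ∩ Iic (n : ℝ) then ⌊t * n⌋₊ else 0 :=
    Measurable.ite (hJ.measurableSet.inter measurableSet_Iic)
      (Nat.measurable_floor.comp (measurable_id.mul_const _)) measurable_const
  -- The truncation at `t ≤ n` keeps the range finite. The default index `0` will be sent to the
  -- zero distribution, so the value of the solution at time `0` is never used.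
  { toFun := fun t => if t ∈ J ∩ Iic (n : ℝ) then ⌊t * n⌋₊ else 0
    measurableSet_fiber' := fun k => hm (measurableSet_singleton k)
    finite_range' := by
      refine (finite_Iic (n * n)).subset ?_
      rintro _ ⟨t, rfl⟩
      simp only [mem_Iic]
      split_ifs with h
      · refine Nat.floor_le_of_le ?_
        push_cast
        exact mul_le_mul_of_nonneg_right h.2 n.cast_nonneg
      · exact Nat.zero_le _ }

theorem gridIndex_of_mem (hJ : IsTimeInterval J) {n : ℕ} {t : ℝ} (ht : t ∈ J) (htn : t ≤ n) :
    gridIndex hJ n t = ⌊t * n⌋₊ := if_pos ⟨ht, htn⟩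

theorem gridIndex_eq_zero_or (hJ : IsTimeInterval J) (n : ℕ) (t : ℝ) :
    gridIndex hJ n t = 0 ∨ ((gridIndex hJ n t : ℕ) : ℝ) / n ∈ J ∩ Ioi 0 := by
  by_cases h : t ∈ J ∩ Iic (n : ℝ)
  · rw [gridIndex_of_mem hJ h.1 h.2]
    rcases Nat.eq_zero_or_pos ⌊t * n⌋₊ with h0 | h0
    · exact Or.inl h0
    · right
      have hn : 0 < (n : ℝ) := by
        rcases Nat.eq_zero_or_pos n with rfl | hn
        · simp at h0
        · exact_mod_cast hn
      have hpos : 0 < (⌊t * n⌋₊ : ℝ) / n := by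
        have : (0 : ℝ) < ⌊t * n⌋₊ := by exact_mod_cast h0
        positivity
      refine ⟨hJ.Icc_subset t h.1 ⟨hpos.le, ?_⟩, hpos⟩
      rw [div_le_iff₀ hn]
      exact Nat.floor_le (mul_nonneg (hJ.nonneg t h.1) hn.le)
  · exact Or.inl (if_neg h)

/-- Sampling at grid points `⌊t n⌋ / n ≤ t`, which stay in `J`, gives simple functions that converge
by continuity. Only positive times matter, because the supercritical norms may be infinite at time
`0`. -/
theorem stronglyMeasurableFB_of_continuous (hp : 1 ≤ p) (hr : 1 ≤ r) (hJ : IsTimeInterval J)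
    {s : ℝ} {u : ℝ → Sh} (hmem : ∀ t ∈ J, 0 < t → MemFB L s p r (u t))
    (hcont : ∀ t ∈ J, 0 < t → Tendsto (fun τ => fbNorm L s p r (u τ - u t)) (𝓝[J] t) (𝓝 0)) :
    StronglyMeasurableFB L s p r J u := by
  classical
  refine ⟨fun n => (gridIndex hJ n).map fun k : ℕ => if k = 0 then 0 else u ((k : ℝ) / n),
    fun n t => ?_, ?_⟩
  · rw [SimpleFunc.map_apply]
    rcases gridIndex_eq_zero_or hJ n t with h0 | h0
    · rw [if_pos h0, MemFB, fbNorm_zero hp hr]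
      exact ENNReal.zero_lt_top
    · split_ifs with h1
      · rw [MemFB, fbNorm_zero hp hr]
        exact ENNReal.zero_lt_top
      · exact hmem _ h0.1 h0.2
  · have hne : ∀ᵐ t ∂(volume.restrict J), t ≠ 0 := ae_restrict_of_ae (by simp [ae_iff])
    filter_upwards [ae_restrict_mem hJ.measurableSet, hne] with t ht ht0
    have hpos : 0 < t := lt_of_le_of_ne (hJ.nonneg t ht) ht0.symm
    have hlim : Tendsto (fun n : ℕ => (⌊t * n⌋₊ : ℝ) / n) atTop (𝓝[J] t) := by
      refine tendsto_nhdsWithin_iff.2 ⟨(tendsto_nat_floor_mul_div_atTop hpos.le).comp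
        tendsto_natCast_atTop_atTop, ?_⟩
      filter_upwards [eventually_gt_atTop 0] with n hn
      have hn' : (0 : ℝ) < n := by exact_mod_cast hn
      refine hJ.Icc_subset t ht ⟨by positivity, ?_⟩
      rw [div_le_iff₀ hn']
      exact Nat.floor_le (by positivity)
    refine ((hcont t ht hpos).comp hlim).congr' ?_
    -- The condition `n ≥ t` puts `t` inside the truncation, and `n ≥ 1/t` makes the grid index
    -- nonzero.
    filter_upwards [eventually_ge_atTop ⌈t⌉₊, eventually_ge_atTop ⌈t⁻¹⌉₊] with n h1 h2
    have h1' : t ≤ n := Nat.ceil_le.1 h1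
    have h2' : t⁻¹ ≤ n := Nat.ceil_le.1 h2
    have h3 : ⌊t * n⌋₊ ≠ 0 := by
      have : 1 ≤ ⌊t * n⌋₊ := by
        rw [Nat.one_le_floor_iff]
        rwa [inv_le_iff_one_le_mul₀' hpos] at h2'
      omega
    rw [SimpleFunc.map_apply, gridIndex_of_mem hJ ht h1', if_neg h3]
    rfl

end PrimitiveEq

namespace PrimitiveEq

/-! ### Passage from functions to distributions -/

variable {p r M : ℝ≥0∞} {α ν g Ω N c b κ : ℝ} {J I : Set ℝ} {V₀ : R3 → Fin 4 → ℂ}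
  {V W : ℝ → R3 → Fin 4 → ℂ} {L : LittlewoodPaley} {v₀ : Fin 4 → Sh} {v : ℝ → Fin 4 → Sh}

/-- Uniqueness is run without the parabolic weight, because a competing solution is only known to
lie in the unweighted class. -/
theorem IsSetting.zero (h : IsSetting p r α ν g Ω N c b M J) :
    IsSetting p r α ν g Ω N c 0 M J :=
  { h with
    b_nonneg := le_rfl
    b_le := by have := h.nu_pos; positivity }

theorem measurable_component (hV : Measurable (Function.uncurry V)) (a : Fin 4) :
    Measurable (Function.uncurry fun t ξ => V t ξ a) := (measurable_pi_apply a).comp hV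

/-- A solution in Fourier variables, together with the distributions that it represents. -/
structure IsRealization (V₀ : R3 → Fin 4 → ℂ) (V : ℝ → R3 → Fin 4 → ℂ) (ν g Ω N c b : ℝ)
    (p r : ℝ≥0∞) (α : ℝ) (J : Set ℝ) (v : ℝ → Fin 4 → Sh) : Prop where
  measurable₀ : Measurable V₀
  finite₀ : spaceNorm p r (critIndex p) (fun ξ => wn c (V₀ ξ)) < ∞
  measurable : Measurable (Function.uncurry V)
  finite : solNorm p r α (rate ν) J (size b c V) < ∞
  eq : ∀ t ∈ J, V t = mild ν g Ω N V₀ V t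
  isFourierTransform : ∀ t ∈ J, ∀ a, IsFourierTransform (v t a) (fun ξ => V t ξ a)

theorem IsRealization.fbNorm (h : IsSetting p r α ν g Ω N c b M J) (hr' : r ≠ ∞)
    (hv : IsRealization V₀ V ν g Ω N c b p r α J v) {s t : ℝ}
    (hs : s = critIndex p ∨ (0 < b ∧ 0 < t ∧ critIndex p ≤ s ∧ s ≤ critIndex p + 2))
    (ht : t ∈ J) (a : Fin 4) :
    MemFB L s p r (v t a) ∧
      Tendsto (fun τ => fbNorm L s p r (v τ a - v t a)) (𝓝[J] t) (𝓝 0) := by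
  have hf := forceNorm_size_quad_lt_top h hv.measurable hv.finite
  obtain ⟨h1, h2⟩ := spaceNorm_mild h hr' hs hv.measurable₀ hv.measurable hv.finite₀ hf ht a
  have hC : shiftConst s * L.hatBound ≠ ∞ :=
    ENNReal.mul_ne_top (shiftConst_ne_top s) L.hatBound_ne_top
  rw [← hv.eq t ht] at h1 h2
  refine ⟨((hv.isFourierTransform t ht a).fbNorm_le L h.one_lt_p.le h.one_le_r s).trans_lt
    (ENNReal.mul_lt_top hC.lt_top h1), ?_⟩
  have h3 := ENNReal.Tendsto.const_mul h2 (Or.inr hC)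
  rw [mul_zero] at h3
  refine tendsto_of_tendsto_of_tendsto_of_le_of_le' tendsto_const_nhds h3
    (Eventually.of_forall fun _ => zero_le) ?_
  filter_upwards [self_mem_nhdsWithin] with τ hτ
  have := ((hv.isFourierTransform τ hτ a).sub (hv.isFourierTransform t ht a)).fbNorm_le L
    h.one_lt_p.le h.one_le_r s
  rwa [hv.eq τ hτ] at this

/-- A finite Chemin-Lerner norm need not place `v t` in the space at almost every time when `r`
exceeds the time exponent. Membership and measurability come instead from parabolic smoothing at
positive times, whence the condition `0 < b`. -/
theorem IsRealization.memCheminLerner (h : IsSetting p r α ν g Ω N c b M J) (hb : 0 < b)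
    (hr' : r ≠ ∞) (hv : IsRealization V₀ V ν g Ω N c b p r α J v) {β : ℝ}
    (hβ : β ∈ Ioo (-1 : ℝ) 1) (hfin : plusNorm p r β J (size b c V) < ∞) (a : Fin 4) :
    MemCheminLerner L (ENNReal.ofReal (2 / (1 + β))) (critIndex p + 1 + β) p r J
      (fun t => v t a) := by
  have hs : ∀ t : ℝ, 0 < t → critIndex p + 1 + β = critIndex p ∨ (0 < b ∧ 0 < t ∧
      critIndex p ≤ critIndex p + 1 + β ∧ critIndex p + 1 + β ≤ critIndex p + 2) := fun t ht =>
    Or.inr ⟨hb, ht, by linarith [hβ.1], by linarith [hβ.2]⟩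
  refine ⟨?_, stronglyMeasurableFB_of_continuous h.one_lt_p.le h.one_le_r h.interval
    (fun t ht ht0 => (hv.fbNorm h hr' (hs t ht0) ht a).1)
    (fun t ht ht0 => (hv.fbNorm h hr' (hs t ht0) ht a).2), ?_⟩
  · have hne : ∀ᵐ t ∂(volume.restrict J), t ≠ 0 := ae_restrict_of_ae (by simp [ae_iff])
    filter_upwards [ae_restrict_mem h.interval.measurableSet, hne] with t ht ht0
    have hpos : 0 < t := lt_of_le_of_ne (h.interval.nonneg t ht) ht0.symm
    exact (hv.fbNorm h hr' (hs t hpos) ht a).1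
  · refine (cheminLernerNorm_le L h.one_lt_p.le h.one_le_r (one_le_ofReal_two_div hβ) _
      h.interval.measurableSet (measurable_component hv.measurable a)
      (fun t ht => hv.isFourierTransform t ht a)).trans_lt ?_
    refine ENNReal.mul_lt_top (ENNReal.mul_lt_top (shiftConst_ne_top _).lt_top
      L.hatBound_ne_top.lt_top) ?_
    have h1 : spaceTimeNorm p r (ENNReal.ofReal (2 / (1 + β))) (critIndex p + 1 + β) J
        (fun t ξ => ‖V t ξ a‖ₑ) ≤ spaceTimeNorm p r (ENNReal.ofReal (2 / (1 + β)))
          (critIndex p + 1 + β) J (fun t ξ => ENNReal.ofReal (1 + c⁻¹) * size b c V t ξ) :=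
      spaceTimeNorm_mono (ae_of_all _ fun t => ae_of_all _ fun ξ =>
        (enorm_apply_le_wn h.c_pos _ a).trans (mul_le_mul_right (wn_le_size V t ξ) _))
    refine h1.trans_lt ?_
    rw [spaceTimeNorm_const_mul h.p_ne_zero (zero_lt_one.trans_le (one_le_ofReal_two_div hβ)).ne'
      h.r_ne_zero _ (measurable_size hv.measurable)]
    exact ENNReal.mul_lt_top ENNReal.ofReal_lt_top hfin

theorem IsRealization.inSolutionClass (h : IsSetting p r α ν g Ω N c b M J) (hb : 0 < b)
    (hr' : r ≠ ∞) (hv : IsRealization V₀ V ν g Ω N c b p r α J v) :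
    InSolutionClass L p r α J v where
  cont a := ⟨fun t ht => (hv.fbNorm h hr' (Or.inl rfl) ht a).1,
    fun t ht => (hv.fbNorm h hr' (Or.inl rfl) ht a).2⟩
  plus a := hv.memCheminLerner h hb hr' h.alpha_mem' (plusNorm_lt_top h.rate_pos h.alpha_mem'
    hv.finite) a
  minus a := by
    have := hv.memCheminLerner (L := L) h hb hr' (neg_mem_Ioo h.alpha_mem')
      (plusNorm_lt_top h.rate_pos (neg_mem_Ioo h.alpha_mem')
        (by rw [solNorm_neg]; exact hv.finite)) a
    rwa [← sub_eq_add_neg, ← sub_eq_add_neg] at this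

theorem IsRealization.isMildSolution (h : IsSetting p r α ν g Ω N c b M J)
    (hv : IsRealization V₀ V ν g Ω N c b p r α J v)
    (hV₀ : ∀ a, IsFourierTransform (v₀ a) (fun ξ => V₀ ξ a)) :
    IsMildSolution ν ν g Ω N J v₀ v := by
  refine ⟨V₀, V, hV₀, hv.measurable, hv.isFourierTransform,
    ae_integrable_conv h.one_lt_p h.one_le_r h.rate_pos h.alpha_mem h.c_pos hv.measurable
      hv.measurable hv.finite hv.finite, fun t ht => ?_⟩
  have hq := measurable_quad hv.measurable
  filter_upwards [lintegral_wn_lt_top h hq (forceNorm_size_quad_lt_top h hv.measurable hv.finite)]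
    with ξ hξ
  have h0 := h.interval.nonneg t ht
  refine ⟨(intervalIntegrable_iff_integrableOn_Ioc_of_le h0).2
    (integrableOn_semigroup_mulVec h.interval h.c_pos h.nu_pos.le h.M_ne_top h.decay hq hξ ht), ?_⟩
  rw [intervalIntegral.integral_of_le h0]
  exact congrFun (hv.eq t ht) ξ

theorem isFourierTransform_divVelocity {w : Fin 4 → Sh} {F : R3 → Fin 4 → ℂ}
    (hw : ∀ a, IsFourierTransform (w a) (fun ξ => F ξ a)) :
    IsFourierTransform (divVelocity w)
      (fun ξ => 2 * Real.pi * Complex.I * ((fun a => (freq ξ a : ℂ)) ⬝ᵥ F ξ)) := by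
  have h1 := IsFourierTransform.finset_sum Finset.univ
    (fun k _ => (hw (Fin.castSucc k)).partialDeriv k)
  refine h1.congr_ae (ae_of_all _ fun ξ => ?_)
  simp only [dotProduct, Fin.sum_univ_castSucc (n := 3), freq_castSucc, freq_last,
    Complex.ofReal_zero, zero_mul, add_zero, Finset.mul_sum]
  exact Finset.sum_congr rfl fun k _ => by ring

theorem freq_dotProduct_forced (h : IsSetting p r α ν g Ω N c b M J)
    (hV : Measurable (Function.uncurry V)) {ξ : R3} (hξ : ∫⁻ τ in J, wn c (quad V τ ξ) < ∞)
    {t : ℝ} (ht : t ∈ J) : (fun a => (freq ξ a : ℂ)) ⬝ᵥ forced ν g Ω N (quad V) t ξ = 0 := by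
  set x : Fin 4 → ℂ := fun a => (freq ξ a : ℂ)
  set ℓ : (Fin 4 → ℂ) →L[ℂ] ℂ := LinearMap.toContinuousLinearMap (dotProductBilin ℂ ℂ x)
  have h1 : ℓ (forced ν g Ω N (quad V) t ξ) = 0 := by
    rw [forced, ← ContinuousLinearMap.integral_comp_comm _ (integrableOn_semigroup_mulVec h.interval
      h.c_pos h.nu_pos.le h.M_ne_top h.decay (measurable_quad hV) hξ ht)]
    rw [integral_eq_zero_of_ae (ae_of_all _ fun τ => ?_)]
    exact freq_dotProduct_semigroup ν g Ω N _ ξ _ (freq_dotProduct_bilinearTerm _ _ ξ)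
  exact h1

theorem IsRealization.divVelocity_eq_zero (h : IsSetting p r α ν g Ω N c b M J)
    (hv : IsRealization V₀ V ν g Ω N c b p r α J v)
    (hV₀ : ∀ a, IsFourierTransform (v₀ a) (fun ξ => V₀ ξ a)) (hdiv : divVelocity v₀ = 0)
    {t : ℝ} (ht : t ∈ J) : divVelocity (v t) = 0 := by
  refine (isFourierTransform_divVelocity (hv.isFourierTransform t ht)).eq_of_ae_eq
    IsFourierTransform.zero ?_
  have h0 := isFourierTransform_divVelocity hV₀
  rw [hdiv] at h0
  filter_upwards [h0.ae_eq IsFourierTransform.zero, lintegral_wn_lt_top h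
    (measurable_quad hv.measurable) (forceNorm_size_quad_lt_top h hv.measurable hv.finite)]
    with ξ h1 h2
  have h3 := (mul_eq_zero.1 h1).resolve_left Complex.two_pi_I_ne_zero
  rw [hv.eq t ht, mild, dotProduct_sub, freq_dotProduct_semigroup ν g Ω N t ξ _ h3,
    freq_dotProduct_forced h hv.measurable h2 ht, sub_zero, mul_zero]

theorem plusNorm_size_lt_top (h : IsSetting p r α ν g Ω N c b M J) {w : ℝ → Fin 4 → Sh}
    (hW : Measurable (Function.uncurry W))
    (hFT : ∀ t ∈ J, ∀ a, IsFourierTransform (w t a) (fun ξ => W t ξ a)) {β : ℝ}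
    (hβ : β ∈ Ioo (-1 : ℝ) 1)
    (hfin : ∀ a, MemCheminLerner L (ENNReal.ofReal (2 / (1 + β))) (critIndex p + 1 + β) p r J
      (fun t => w t a)) : plusNorm p r β J (size 0 c W) < ∞ := by
  have hδ := one_le_ofReal_two_div hβ
  have hm : ∀ a, Measurable (Function.uncurry fun t ξ => ‖W t ξ a‖ₑ) := fun a =>
    (measurable_component hW a).enorm
  have hm' : Measurable (Function.uncurry fun t ξ => ∑' a, ‖W t ξ a‖ₑ) :=
    Measurable.tsum fun a => hm a
  rw [size_zero_left]
  have h1 : plusNorm p r β J (fun t ξ => wn c (W t ξ)) ≤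
      plusNorm p r β J (fun t ξ => ENNReal.ofReal (1 + |c|) * ∑' a, ‖W t ξ a‖ₑ) :=
    spaceTimeNorm_mono (ae_of_all _ fun t => ae_of_all _ fun ξ => wn_le_tsum c _)
  refine h1.trans_lt ?_
  rw [plusNorm, spaceTimeNorm_const_mul h.p_ne_zero (zero_lt_one.trans_le hδ).ne' h.r_ne_zero _ hm']
  refine ENNReal.mul_lt_top ENNReal.ofReal_lt_top
    ((spaceTimeNorm_tsum_le h.one_lt_p.le hδ h.one_le_r hm).trans_lt ?_)
  rw [tsum_fintype, ENNReal.sum_lt_top]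
  intro a _
  refine (spaceTimeNorm_le_cheminLernerNorm L h.one_lt_p.le h.one_le_r hδ _
    h.interval.measurableSet (measurable_component hW a) (fun t ht => hFT t ht a)).trans_lt ?_
  exact ENNReal.mul_lt_top (shiftConst_ne_top _).lt_top (hfin a).finite

theorem IsRealization.unique (h : IsSetting p r α ν g Ω N c b M J) (hr' : r ≠ ∞)
    (hv : IsRealization V₀ V ν g Ω N c b p r α J v)
    (hV₀ : ∀ a, IsFourierTransform (v₀ a) (fun ξ => V₀ ξ a)) {w : ℝ → Fin 4 → Sh}
    (hw : InSolutionClass L p r α J w) (hmild : IsMildSolution ν ν g Ω N J v₀ w) :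
    EqOn w v J := by
  obtain ⟨W₀, W, hW₀, hW, hFT, -, heq⟩ := hmild
  have h00 : W₀ =ᵐ[volume] V₀ := by
    filter_upwards [ae_all_iff.2 fun a => (hW₀ a).ae_eq (hV₀ a)] with ξ hξ
    exact funext hξ
  have hWfin : solNorm p r α (rate ν) J (size 0 c W) < ∞ := by
    refine solNorm_lt_top h.rate_pos h.alpha_mem'
      (plusNorm_size_lt_top h hW hFT h.alpha_mem' hw.plus)
      (plusNorm_size_lt_top (L := L) h hW hFT (neg_mem_Ioo h.alpha_mem') fun a => ?_)
    have := hw.minus a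
    rwa [sub_eq_add_neg, sub_eq_add_neg] at this
  have hVfin : solNorm p r α (rate ν) J (size 0 c V) < ∞ := by
    refine (solNorm_mono (ae_of_all _ fun t => ae_of_all _ fun ξ => ?_)).trans_lt hv.finite
    rw [size_zero_left]
    exact wn_le_size V t ξ
  have eW : ∀ t ∈ J, W t =ᵐ[volume] mild ν g Ω N V₀ W t := fun t ht => by
    filter_upwards [heq t ht, h00] with ξ h1 h2
    rw [h1.2, h2, intervalIntegral.integral_of_le (h.interval.nonneg t ht)]
    rfl
  intro t ht
  -- Agreement of the initial transforms almost everywhere lets both functions solve the integral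
  -- equation with the same `V₀`; `h.zero` removes the weight.
  have huniq := mild_unique h.zero hr' hv.measurable hW hVfin hWfin
    (fun t ht => (ae_of_all _ fun ξ => congrFun (hv.eq t ht) ξ)) eW ht
  funext a
  refine (hFT t ht a).eq_of_ae_eq (hv.isFourierTransform t ht a) ?_
  filter_upwards [huniq] with ξ hξ
  rw [hξ]

theorem hasUniqueMildSolution (h : IsSetting p r α ν g Ω N c b M J) (hb : 0 < b) (hr' : r ≠ ∞)
    (hmV₀ : Measurable V₀) (hV₀ : ∀ a, IsFourierTransform (v₀ a) (fun ξ => V₀ ξ a))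
    (hfin₀ : spaceNorm p r (critIndex p) (fun ξ => wn c (V₀ ξ)) < ∞)
    (hdiv : divVelocity v₀ = 0) {e : ℝ≥0∞} (he : e < ∞)
    (hlin : solNorm p r α (rate ν) J (size b c fun t ξ => semigroup ν ν g Ω N t ξ *ᵥ V₀ ξ) ≤ e)
    (hs : 8 * (lipConst p M α (rate ν) * e) ≤ 1) :
    HasUniqueMildSolution L p r α ν ν g Ω N J v₀ := by
  classical
  obtain ⟨V, hV, hVfin, heq⟩ := exists_mild h hmV₀ he hlin hs
  have hf := forceNorm_size_quad_lt_top h hV hVfin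
  have hex : ∀ t ∈ J, ∀ a, ∃ u : Sh, IsFourierTransform u (fun ξ => V t ξ a) := fun t ht a => by
    refine exists_sh_of_spaceNorm_lt_top h.one_lt_p.le h.r_ne_zero (r := r)
      (measurable_component hV a).of_uncurry_left.aestronglyMeasurable ?_
    rw [heq t ht]
    exact (spaceNorm_mild h hr' (Or.inl rfl) hmV₀ hV hfin₀ hf ht a).1
  choose! u hu using hex
  have hv : IsRealization V₀ V ν g Ω N c b p r α J u := ⟨hmV₀, hfin₀, hV, hVfin, heq, hu⟩
  exact ⟨u, hv.inSolutionClass h hb hr', hv.isMildSolution h hV₀,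
    fun t ht => hv.divVelocity_eq_zero h hV₀ hdiv ht,
    fun w hw hmild => hv.unique h hr' hV₀ hw hmild⟩

end PrimitiveEq

namespace PrimitiveEq

/-! ### Local and global well-posedness -/

variable {p r M : ℝ≥0∞} {α ν g Ω N c b κ : ℝ} {J : Set ℝ} {V₀ : R3 → Fin 4 → ℂ}
  {L : LittlewoodPaley} {v₀ : Fin 4 → Sh}

theorem isTimeInterval_Icc (T : ℝ) : IsTimeInterval (Icc 0 T) :=
  ⟨measurableSet_Icc, fun _ ht => ht.1, fun _ ht => Icc_subset_Icc_right ht.2⟩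

theorem isTimeInterval_Ici : IsTimeInterval (Ici (0 : ℝ)) :=
  ⟨measurableSet_Ici, fun _ ht => ht, fun _ _ _ hx => hx.1⟩

/-- The initial data have a measurable representative in Fourier variables. -/
theorem exists_measurable_data (hp : 1 ≤ p) (hr : 1 ≤ r) {s : ℝ}
    (h : ∀ a, MemFB L s p r (v₀ a)) : ∃ V₀ : R3 → Fin 4 → ℂ, Measurable V₀ ∧
      ∀ a, IsFourierTransform (v₀ a) (fun ξ => V₀ ξ a) := by
  choose f hf using fun a =>
    exists_isFourierTransform_of_memFB L hp (zero_lt_one.trans_le hr).ne' (h a)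
  exact ⟨fun ξ a => (hf a).aestronglyMeasurable.mk (f a) ξ,
    measurable_pi_iff.2 fun a => (hf a).aestronglyMeasurable.stronglyMeasurable_mk.measurable,
    fun a => (hf a).congr_ae (hf a).aestronglyMeasurable.ae_eq_mk⟩

theorem spaceNorm_wn_le (hp : 1 ≤ p) (hr : 1 ≤ r) (s : ℝ) (hV₀ : Measurable V₀)
    (hFT : ∀ a, IsFourierTransform (v₀ a) (fun ξ => V₀ ξ a)) :
    spaceNorm p r s (fun ξ => wn c (V₀ ξ)) ≤ shiftConst s *
      ((∑ k : Fin 3, fbNorm L s p r (v₀ k.castSucc)) +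
        fbNorm L s p r ((c : ℂ) • v₀ (Fin.last 3))) := by
  set f : Fin 4 → R3 → ℝ≥0∞ := Fin.snoc (α := fun _ => R3 → ℝ≥0∞)
    (fun k ξ => ‖V₀ ξ k.castSucc‖ₑ) (fun ξ => ‖(c : ℂ) * V₀ ξ (Fin.last 3)‖ₑ) with hf
  have f1 : ∀ k : Fin 3, f k.castSucc = fun ξ => ‖V₀ ξ k.castSucc‖ₑ :=
    fun k => Fin.snoc_castSucc ..
  have f2 : f (Fin.last 3) = fun ξ => ‖(c : ℂ) * V₀ ξ (Fin.last 3)‖ₑ := Fin.snoc_last ..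
  have hma : ∀ a, Measurable fun ξ => V₀ ξ a := fun a => (measurable_pi_apply a).comp hV₀
  have hm : ∀ a, Measurable (f a) := fun a => by
    induction a using Fin.lastCases with
    | last => rw [f2]; exact ((hma _).const_mul _).enorm
    | cast k => rw [f1]; exact (hma _).enorm
  have h1 : spaceNorm p r s (fun ξ => wn c (V₀ ξ)) ≤ spaceNorm p r s (fun ξ => ∑' a, f a ξ) := by
    refine spaceNorm_mono (ae_of_all _ fun ξ => (wn_le_sum c _).trans_eq ?_)
    rw [tsum_fintype, Fin.sum_univ_castSucc (n := 3) (f := fun a => f a ξ)]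
    simp only [f1, f2]
  refine h1.trans ((spaceNorm_tsum_le hp hr hm).trans ?_)
  rw [tsum_fintype, Fin.sum_univ_castSucc, mul_add, Finset.mul_sum]
  refine add_le_add (Finset.sum_le_sum fun k _ => ?_) ?_
  · rw [f1]
    exact (hFT k.castSucc).spaceNorm_le L hp hr s
  · rw [f2]
    exact ((hFT (Fin.last 3)).const_smul (c : ℂ)).spaceNorm_le L hp hr s

theorem solNorm_size_heat_le (h : IsSetting p r α ν g Ω N c b M J) (hV₀ : Measurable V₀) :
    solNorm p r α (rate ν) J (size b c fun t ξ => semigroup ν ν g Ω N t ξ *ᵥ V₀ ξ) ≤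
      2 * M * spaceNorm p r (critIndex p) (fun ξ => wn c (V₀ ξ)) := by
  have hm := measurable_wn_comp (c := c) hV₀
  have h1 : solNorm p r α (rate ν) J (size b c fun t ξ => semigroup ν ν g Ω N t ξ *ᵥ V₀ ξ) ≤
      solNorm p r α (rate ν) J (fun t ξ => M * (decay (rate ν * ‖ξ‖ ^ 2) t * wn c (V₀ ξ))) := by
    refine solNorm_mono ?_
    filter_upwards [ae_restrict_mem h.interval.measurableSet] with t ht
    exact ae_of_all _ fun ξ => size_heat_le h.decay rfl h.b_nonneg h.b_le V₀ ht ξ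
  refine h1.trans ?_
  have hmd : Measurable (Function.uncurry fun t (ξ : R3) =>
      decay (rate ν * ‖ξ‖ ^ 2) t * wn c (V₀ ξ)) :=
    (measurable_decay.comp (f := fun z : ℝ × R3 => (rate ν * ‖z.2‖ ^ 2, z.1)) (by fun_prop)).mul
      (hm.comp measurable_snd)
  rw [solNorm_const_mul h.p_ne_zero h.r_ne_zero h.alpha_mem' M hmd, mul_comm 2 M, mul_assoc]
  exact mul_le_mul_right (solNorm_heat_le h.one_lt_p.le h.one_le_r h.rate_pos h.alpha_mem' hm) M

theorem lipConst_ne_top (hp : 1 < p) (hα : 0 < α) (hM : M ≠ ∞) : lipConst p M α κ ≠ ∞ :=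
  ENNReal.mul_ne_top (ENNReal.mul_ne_top ENNReal.ofNat_ne_top hM) (quadConst_lt_top hp hα).ne

/-- The linear evolution has finite solution norm on `[0, 1]`, hence small norm on a shorter
interval. The decay constant of `[0, 1]` serves all shorter intervals, so the smallness threshold is
fixed before the time is chosen. -/
theorem exists_local_solution (hp : 1 < p) (hr : 1 ≤ r) (hr' : r ≠ ∞) (hα : α ∈ Ioo (0 : ℝ) 1)
    (hν : 0 < ν) (g Ω N : ℝ) (hv₀ : ∀ a, MemFB L (critIndex p) p r (v₀ a))
    (hdiv : divVelocity v₀ = 0) :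
    ∃ T : ℝ, 0 < T ∧ HasUniqueMildSolution L p r α ν ν g Ω N (Icc 0 T) v₀ := by
  obtain ⟨V₀, hm, hFT⟩ := exists_measurable_data hp.le hr hv₀
  have hfin₀ : spaceNorm p r (critIndex p) (fun ξ => wn 1 (V₀ ξ)) < ∞ := by
    refine (spaceNorm_wn_le (L := L) hp.le hr _ hm hFT).trans_lt
      (ENNReal.mul_lt_top (shiftConst_ne_top _).lt_top (ENNReal.add_lt_top.2
        ⟨ENNReal.sum_lt_top.2 fun k _ => hv₀ k.castSucc, ?_⟩))
    rw [Complex.ofReal_one, one_smul]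
    exact hv₀ _
  obtain ⟨M, hM, hD⟩ : ∃ M : ℝ≥0∞, M ≠ ∞ ∧ DecayBound ν g Ω N 1 M (Icc 0 1) :=
    ⟨_, ENNReal.ofReal_ne_top, decayBound_Icc ν g Ω N⟩
  have hset : ∀ T ≤ 1, IsSetting p r α ν g Ω N 1 (rate ν) M (Icc 0 T) := fun T hT =>
    { one_lt_p := hp
      one_le_r := hr
      alpha_mem := hα
      nu_pos := hν
      c_pos := one_pos
      b_nonneg := by unfold rate; positivity
      b_le := le_rfl
      M_ne_top := hM
      interval := isTimeInterval_Icc T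
      decay := fun t ht => hD t ⟨ht.1, ht.2.trans hT⟩ }
  have h1 := hset 1 le_rfl
  have hΛ := lipConst_ne_top (κ := rate ν) hp hα.1 hM
  have hheat := (solNorm_size_heat_le h1 hm).trans_lt (ENNReal.mul_lt_top
    (ENNReal.mul_lt_top ENNReal.ofNat_lt_top hM.lt_top) hfin₀)
  -- The summand `1` keeps the threshold finite without a check that the Lipschitz constant is
  -- nonzero.
  have hε : 0 < (8 * lipConst p M α (rate ν) + 1)⁻¹ := ENNReal.inv_pos.2
    (ENNReal.add_ne_top.2 ⟨ENNReal.mul_ne_top ENNReal.ofNat_ne_top hΛ, ENNReal.one_ne_top⟩)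
  obtain ⟨d, hd, hsmall⟩ := exists_solNorm_le_of_volume_le h1.r_ne_zero hr' h1.rate_pos
    h1.alpha_mem' hheat hε
  have hT := hset (min d 1) (min_le_right _ _)
  refine ⟨min d 1, lt_min hd one_pos, hasUniqueMildSolution hT h1.rate_pos hr' hm hFT hfin₀ hdiv
    (e := (8 * lipConst p M α (rate ν) + 1)⁻¹) (ENNReal.inv_lt_top.2 (by simp))
    (hsmall _ (Icc_subset_Icc_right (min_le_right _ _)) measurableSet_Icc ?_) ?_⟩
  · rw [Real.volume_Icc, sub_zero]
    exact ENNReal.ofReal_le_ofReal (min_le_left _ _)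
  · rw [← mul_assoc]
    exact (mul_le_mul_left le_self_add _).trans (ENNReal.mul_inv_le_one _)

/-- The constant in the smallness condition, up to the normalization by the viscosity. -/
noncomputable def smallConst (p : ℝ≥0∞) (α : ℝ) : ℝ≥0∞ :=
  8 * (2 * 4 * (2 * bilinearConst * (2 * productConst p α * (timeConst 1 α * timeConst 1 (-α))))) *
    (2 * 4 * shiftConst (critIndex p))

theorem smallConst_ne_top (hp : 1 < p) (hα : 0 < α) : smallConst p α ≠ ∞ := by
  have h1 := (productConst_lt_top hp hα).ne
  have h2 := shiftConst_ne_top (critIndex p)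
  have h3 : bilinearConst ≠ ∞ := ENNReal.ofReal_ne_top
  have h4 : timeConst 1 α ≠ ∞ := timeConst_ne_top
  have h5 : timeConst 1 (-α) ≠ ∞ := timeConst_ne_top
  unfold smallConst
  finiteness

/-- With the absolute decay constant `4`, the viscosity is the only physical parameter left, and it
enters as a single factor. -/
theorem lipConst_four (hν : 0 < rate ν) (hα : α ∈ Ioo (-1 : ℝ) 1) :
    8 * lipConst p 4 α (rate ν) * (2 * 4 * shiftConst (critIndex p)) =
      smallConst p α * ENNReal.ofReal (rate ν)⁻¹ := by
  rw [lipConst, quadConst, forceConst, timeConst_mul_timeConst hν hα, smallConst]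
  ring

theorem exists_global_solution (hp : 1 < p) (hr : 1 ≤ r) (hr' : r ≠ ∞) (hα : α ∈ Ioo (0 : ℝ) 1)
    (hν : 0 < ν) (Ω : ℝ) (hg : 0 < g) (hN : 0 < N) {C : ℝ}
    (hC : smallConst p α * ENNReal.ofReal C ≤ 1)
    (hv₀ : ∀ a, MemFB L (critIndex p) p r (v₀ a)) (hdiv : divVelocity v₀ = 0)
    (hsmall : (∑ k : Fin 3, fbNorm L (critIndex p) p r (v₀ k.castSucc)) +
      fbNorm L (critIndex p) p r (((Real.sqrt g / N : ℝ) : ℂ) • v₀ (Fin.last 3)) ≤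
        ENNReal.ofReal (C * ν)) :
    HasUniqueMildSolution L p r α ν ν g Ω N (Ici 0) v₀ := by
  obtain ⟨V₀, hm, hFT⟩ := exists_measurable_data hp.le hr hv₀
  have h : IsSetting p r α ν g Ω N (Real.sqrt g / N) (rate ν) 4 (Ici 0) :=
    { one_lt_p := hp
      one_le_r := hr
      alpha_mem := hα
      nu_pos := hν
      c_pos := div_pos (Real.sqrt_pos.2 hg) hN
      b_nonneg := by unfold rate; positivity
      b_le := le_rfl
      M_ne_top := ENNReal.ofNat_ne_top
      interval := isTimeInterval_Ici
      decay := decayBound_Ici ν Ω hg hN }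
  have hdata := (spaceNorm_wn_le (L := L) (c := Real.sqrt g / N) hp.le hr (critIndex p) hm
    hFT).trans (mul_le_mul_right hsmall _)
  have hfin : shiftConst (critIndex p) * ENNReal.ofReal (C * ν) < ∞ :=
    ENNReal.mul_lt_top (shiftConst_ne_top _).lt_top ENNReal.ofReal_lt_top
  refine hasUniqueMildSolution h h.rate_pos hr' hm hFT (hdata.trans_lt hfin) hdiv
    (e := 2 * 4 * (shiftConst (critIndex p) * ENNReal.ofReal (C * ν)))
    (ENNReal.mul_lt_top (by finiteness) hfin)
    ((solNorm_size_heat_le h hm).trans (mul_le_mul_right hdata _)) ?_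
  have e1 : 8 * (lipConst p 4 α (rate ν) * (2 * 4 * (shiftConst (critIndex p) *
      ENNReal.ofReal (C * ν)))) = 8 * lipConst p 4 α (rate ν) *
      (2 * 4 * shiftConst (critIndex p)) * ENNReal.ofReal (C * ν) := by ring
  rw [e1, lipConst_four h.rate_pos h.alpha_mem', mul_assoc]
  refine (mul_le_mul_right ?_ _).trans hC
  rw [← ENNReal.ofReal_mul (inv_nonneg.2 h.rate_pos.le)]
  -- Positivity of `C` is not assumed; for `C ≤ 0` the product truncates to zero.
  rcases le_or_gt C 0 with hC0 | hC0
  · rw [ENNReal.ofReal_eq_zero.2]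
    · exact zero_le
    · exact mul_nonpos_of_nonneg_of_nonpos (inv_nonneg.2 h.rate_pos.le)
        (mul_nonpos_of_nonpos_of_nonneg hC0 hν.le)
  · refine ENNReal.ofReal_le_ofReal ?_
    rw [inv_mul_le_iff₀ h.rate_pos, mul_comm C ν]
    refine mul_le_mul_of_nonneg_right ?_ hC0.le
    -- The decay rate is `2 π² ν ≥ ν`, so smallness relative to `ν` suffices.
    have h2 : (1 : ℝ) ≤ 2 * Real.pi ^ 2 := by nlinarith [Real.pi_gt_three]
    unfold rate
    nlinarith

end PrimitiveEq

theorem theorem1p4 (L : PrimitiveEq.LittlewoodPaley) (p r : ℝ≥0∞) (hp : 1 < p)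
    (hr : 1 ≤ r) (hr' : r < ∞) (α : ℝ) (hα : 0 < α) (hα' : α < 1) :
    (∀ ν g Ω N : ℝ, 0 < ν → 0 < g → 0 ≤ N →
      ∀ v₀ : Fin 4 → PrimitiveEq.Sh,
        (∀ a, PrimitiveEq.MemFB L (PrimitiveEq.critIndex p) p r (v₀ a)) →
        PrimitiveEq.divVelocity v₀ = 0 →
        ∃ T : ℝ, 0 < T ∧
          PrimitiveEq.HasUniqueMildSolution L p r α ν ν g Ω N (Set.Icc 0 T) v₀) ∧
    ∃ C : ℝ, 0 < C ∧
      ∀ ν g Ω N : ℝ, 0 < ν → 0 < g → 0 < N →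
        ∀ v₀ : Fin 4 → PrimitiveEq.Sh,
          (∀ a, PrimitiveEq.MemFB L (PrimitiveEq.critIndex p) p r (v₀ a)) →
          PrimitiveEq.divVelocity v₀ = 0 →
          (∑ k : Fin 3, PrimitiveEq.fbNorm L (PrimitiveEq.critIndex p) p r (v₀ k.castSucc)) +
              PrimitiveEq.fbNorm L (PrimitiveEq.critIndex p) p r
                (((Real.sqrt g / N : ℝ) : ℂ) • v₀ (Fin.last 3)) ≤ ENNReal.ofReal (C * ν) →
          PrimitiveEq.HasUniqueMildSolution L p r α ν ν g Ω N (Set.Ici 0) v₀ := by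
  have hI : α ∈ Ioo (0 : ℝ) 1 := ⟨hα, hα'⟩
  refine ⟨fun ν g Ω N hν _ _ v₀ hv₀ hdiv =>
    PrimitiveEq.exists_local_solution hp hr hr'.ne hI hν g Ω N hv₀ hdiv, ?_⟩
  obtain ⟨K, hK⟩ : ∃ K : NNReal, (K : ℝ≥0∞) = PrimitiveEq.smallConst p α :=
    ⟨_, ENNReal.coe_toNNReal (PrimitiveEq.smallConst_ne_top hp hα)⟩
  -- The constant depends on `p` and `α` only. The summand `1` makes it well defined and positive
  -- also for `K = 0`, and the product with `K` is still at most `1`.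
  refine ⟨((K : ℝ) + 1)⁻¹, by positivity, fun ν g Ω N hν hg hN v₀ hv₀ hdiv hsmall =>
    PrimitiveEq.exists_global_solution hp hr hr'.ne hI hν Ω hg hN ?_ hv₀ hdiv hsmall⟩
  rw [← hK, ← ENNReal.ofReal_coe_nnreal, ← ENNReal.ofReal_mul K.coe_nonneg, ENNReal.ofReal_le_one,
    mul_inv_le_iff₀ (by positivity)]
  linarith
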